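/- Let $g\ge 1$ be a fixed integer and let $(X_t)_{t\in\mathbb Z}$ be a real covariance stationary Gaussian process with spectral density $$f(\omega)=|\omega|^{-2d}f_\star(\omega),\qquad \omega\in[-\pi,\pi],\qquad d\in(-1/2,1/2),$$ that is, $\mathrm{Cov}(X_s,X_t)=\int_{-\pi}^{\pi}e^{\mathrm i(s-t)\omega}f(\omega)\,d\omega$ for all $s,t\in\mathbb Z$, where $f_\star:[-\pi,\pi]\to[0,\infty)$ satisfies $0<f_\star(0)<\infty$. For $n\ge 1$ and $k\ge1$ put $\omega_k=2\pi k/n$, $$\bar I_{g,n}(\omega_k)=\frac1g\sum_{\ell=0}^{g-1}\frac{1}{2\pi n}\Bigl|\sum_{t=1}^{n}X_{t+\ell n}e^{\mathrm i t\omega_k}\Bigr|^2,$$ and, for $m\ge 2$, $$a_{k,n}(m)=\frac{c_k}{\sum_{j=1}^m c_j^2},\quad c_k=-2\log\omega_k-\frac1m\sum_{j=1}^m(-2\log\omega_j),\qquad \hat d_{m,g}=\sum_{k=1}^{m}a_{k,n}(m)\log \bar I_{g,n}(\omega_k).$$ Assume that, for some constants $\mu\ge1$ and $\nu\in(0,1]$,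 $f_\star$ belongs to $\mathcal L(\mu,\nu)$, i.e. $f_\star(\omega)\le\mu f_\star(0)$ for all $\omega\in[-\pi,\pi]$ and, for all $\omega,\omega'\in[-\pi,\pi]\setminus\{0\}$, $$|f_\star(\omega)-f_\star(\omega')|\le\mu f_\star(0)\frac{|\omega-\omega'|}{\min(|\omega|,|\omega'|)},\qquad |f_\star(\omega)-f_\star(\omega')|\le\mu f_\star(0)\,\bigl||\omega|-|\omega'|\bigr|^{\nu}.$$ Assume moreover that for some $\Omega_0\in(0,\pi]$ the function $f_\star$ is three times differentiable (with finite derivatives) at every point of $(-\Omega_0,\Omega_0)$, and that $f_\star'(0)=0$. Let $(m_n)$ be a sequence of nonnegative integers with $m_n\to\infty$ and $m_n/n\to0$ as $n\to\infty$. Then, for all large $n$, $\hat d_{m_n,g}$ is square integrable, and, as $n\to\infty$, $$\mathbb E[\hat d_{m_n,g}-d]=-\frac{2\pi^2f_\star''(0)\,m_n^2}{9f_\star(0)\,n^2}+o\Bigl(\frac{m_n^2}{n^2}\Bigr)+O\Bigl(\frac{\log^3 m_n}{m_n}\Bigr),\qquad \mathrm{Var}(\hat d_{m_n,g})=\frac{\psi'(g)}{4m_n}+o\Bigl(\frac1{m_n}\Bigr),$$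 where $\psi=\Gamma'/\Gamma$ is the digamma function. -/

import Mathlib

open MeasureTheory ProbabilityTheory Filter Asymptotics Topology

/-- The class `L(μ, ν)` of functions on `[-π, π]`: nonnegative functions `φ` bounded by `μ φ(0)`
and satisfying the two Lipschitz / Hölder type conditions away from the origin.
Only the values of `φ` on `[-π, π]` matter. -/
structure LocalLipschitz (μ ν : ℝ) (φ : ℝ → ℝ) : Prop where
  nonneg : ∀ ω ∈ Set.Icc (-Real.pi) Real.pi, 0 ≤ φ ω
  bound : ∀ ω ∈ Set.Icc (-Real.pi) Real.pi, φ ω ≤ μ * φ 0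
  lipschitz : ∀ ω ∈ Set.Icc (-Real.pi) Real.pi, ∀ ω' ∈ Set.Icc (-Real.pi) Real.pi,
    ω ≠ 0 → ω' ≠ 0 → |φ ω - φ ω'| ≤ μ * φ 0 * (|ω - ω'| / min |ω| |ω'|)
  holder : ∀ ω ∈ Set.Icc (-Real.pi) Real.pi, ∀ ω' ∈ Set.Icc (-Real.pi) Real.pi,
    ω ≠ 0 → ω' ≠ 0 → |φ ω - φ ω'| ≤ μ * φ 0 * |(|ω| - |ω'|)| ^ ν

/-- The semiparametric spectral density `f(ω) = |ω|^{-2d} f⋆(ω)`. -/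
noncomputable def memorySpectralDensity (d : ℝ) (fstar : ℝ → ℝ) (ω : ℝ) : ℝ :=
  |ω| ^ (-2 * d) * fstar ω

/-- `X` is a (second order) covariance stationary real process indexed by `ℤ`. -/
structure IsCovarianceStationary {Ω : Type*} [MeasurableSpace Ω] (X : ℤ → Ω → ℝ)
    (P : Measure Ω) : Prop where
  memLp : ∀ t, MemLp (X t) 2 P
  mean_eq : ∀ s t, ∫ x, X s x ∂P = ∫ x, X t x ∂P
  cov_eq : ∀ s t h, cov[X (s + h), X (t + h); P] = cov[X s, X t; P]

/-- `f` is a spectral density of the process `X`: it is nonnegative and integrable on `[-π, π]`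
and `Cov (X s) (X t) = ∫_{-π}^{π} exp (i (s - t) ω) f(ω) dω`. -/
structure HasSpectralDensity {Ω : Type*} [MeasurableSpace Ω] (X : ℤ → Ω → ℝ)
    (P : Measure Ω) (f : ℝ → ℝ) : Prop where
  nonneg : ∀ ω ∈ Set.Icc (-Real.pi) Real.pi, 0 ≤ f ω
  integrable : IntegrableOn f (Set.Icc (-Real.pi) Real.pi) volume
  cov_eq : ∀ s t : ℤ, ((cov[X s, X t; P] : ℝ) : ℂ) =
    ∫ ω in (-Real.pi)..Real.pi, Complex.exp (Complex.I * ((s : ℂ) - (t : ℂ)) * (ω : ℂ)) * (f ω : ℂ)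

/-- The Fourier frequency `ω_k = 2 π k / n`. -/
noncomputable def fourierFreq (n k : ℕ) : ℝ := 2 * Real.pi * k / n

/-- The discrete Fourier transform of the epoch `ℓ` of length `n` of the path `x`:
`(2 π n)^{-1/2} ∑_{t=1}^n x_{t + ℓ n} e^{i t ω_k}`. -/
noncomputable def epochDFT (x : ℤ → ℝ) (n ℓ k : ℕ) : ℂ :=
  (((2 * Real.pi * n) ^ (-(1 / 2) : ℝ) : ℝ) : ℂ) *
    ∑ t ∈ Finset.Icc 1 n, ((x ((t : ℤ) + (ℓ : ℤ) * (n : ℤ)) : ℝ) : ℂ) *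
      Complex.exp (Complex.I * (t : ℂ) * (fourierFreq n k : ℂ))

/-- The periodogram of the epoch `ℓ` at `ω_k`. -/
noncomputable def epochPeriodogram (x : ℤ → ℝ) (n ℓ k : ℕ) : ℝ := ‖epochDFT x n ℓ k‖ ^ 2

/-- The periodogram at `ω_k` averaged over the `g` epochs `0, …, g - 1` of length `n`. -/
noncomputable def averagedPeriodogram (x : ℤ → ℝ) (g n k : ℕ) : ℝ :=
  (g : ℝ)⁻¹ * ∑ ℓ ∈ Finset.range g, epochPeriodogram x n ℓ k

/-- The centred regressor `[-2 log ω_k] - m⁻¹ ∑_{j=1}^m [-2 log ω_j]`. -/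
noncomputable def centredRegressor (n m k : ℕ) : ℝ :=
  -2 * Real.log (fourierFreq n k)
    - (m : ℝ)⁻¹ * ∑ j ∈ Finset.Icc 1 m, (-2 * Real.log (fourierFreq n j))

/-- The least squares weight `a_{k,n}(m)`. -/
noncomputable def regressionWeight (n m k : ℕ) : ℝ :=
  centredRegressor n m k / ∑ j ∈ Finset.Icc 1 m, centredRegressor n m j ^ 2

/-- The log-averaged-periodogram regression estimator of the memory parameter, computed from `g`
epochs of length `n` of the path `x` with bandwidth `m`. -/
noncomputable def memoryEstimator (x : ℤ → ℝ) (g n m : ℕ) : ℝ :=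
  ∑ k ∈ Finset.Icc 1 m, regressionWeight n m k * Real.log (averagedPeriodogram x g n k)

/-- The trigamma function `ψ'` on the real line, `ψ` being the digamma function. -/
noncomputable def trigamma (x : ℝ) : ℝ := (deriv Complex.digamma (x : ℂ)).re

/-! The averaged periodogram at `ω_k` equals `f(ω_k) / (2g)` times `‖Z_k‖²`, where `Z_k ∈ ℝ^{2g}`
collects the cosine and sine transforms of the `g` epochs divided by `(π n f(ω_k))^{1/2}`
(`norm_sq_arrayVector_normalisedTrig`). The regression weights sum to zero and reproduce the slope
of `-2 log ω_k`, so that almost surely `d̂ = d + D_n + ∑ a_k log ‖Z_k‖²` with a deterministic `D_n =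
∑ a_k (log f⋆(ω_k) - log f⋆(0))` (`memoryEstimator_ae_eq`). Since `f⋆'(0) = 0`, a second order
expansion of `log f⋆` together with `∑ a_k k² ~ -m²/9` turns `D_n` into the stated bias
(`isLittleO_sum_log_smooth`).

It remains to see that the `Z_k` behave like independent standard Gaussian vectors. The
trigonometric polynomials at Fourier frequencies are exactly orthogonal for Lebesgue measure, so a
covariance differs from its ideal value by an integral of `f(x) - f(ω_j)` against two Dirichlet
kernels. The increment cancels one kernel and the other costs a logarithm; after normalisation the
error is `O((1 + log j) / √(jk))` for `k ≤ j` (`abs_covariance_normalisedTrig_sub_le`).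

For a standard Gaussian `N` in `ℝ^{2g}`, `‖N‖² / 2` has the Gamma law of shape `g`, and its
logarithm has variance `ψ'(g)`. A perturbation argument gives `log ‖Z_k‖²` a mean and a variance
within `O((1 + log k) / k)` of the standard ones (`log_norm_sq_of_variance_near`). The decisive
point is that the covariance of `log ‖Z_j‖²` and `log ‖Z_k‖²` is quadratic in the cross covariance,
hence `O((1 + log j)² / (jk))` (`abs_covariance_log_norm_sq_le`). To see this, Frullani's formula
reduces logarithms to exponentials `exp (-s ‖Y‖²)`, these are Gaussian averages of characters, and
the symmetry `x ↦ -x` removes the linear term.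

The weights are `O(log m / m)`. Summing the errors in the means gives `O(log³ m / m)`. In the
variance the diagonal gives `ψ'(g) ∑ a_k² ~ ψ'(g) / (4m)` and the remainder is `o(1/m)`. At the
finitely many lowest frequencies the perturbation bounds are not small; there a uniform second
moment bound, resting on one nondegenerate coordinate (`exists_bound_log_norm_sq`,
`exists_le_variance_normalisedTrig`), suffices. -/

set_option linter.unusedSectionVars false

/-! ### Frullani's formula and the covariance of two logarithms -/

/-- The integrand of Frullani's representation
`log x = ∫_0^∞ (exp (-s) - exp (-x s)) / s ds`. -/
noncomputable def logKernel (s x : ℝ) : ℝ := s⁻¹ * (Real.exp (-s) - Real.exp (-(x * s)))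

lemma measurable_logKernel : Measurable (fun p : ℝ × ℝ => logKernel p.1 p.2) := by
  unfold logKernel; fun_prop

/-- Factoring out the larger exponential and using `1 - exp (-u) ≤ u` absorbs the factor `1/s`,
which leaves a majorant integrable both at `0` and at infinity. -/
lemma abs_logKernel_le {s x : ℝ} (hs : 0 < s) :
    |logKernel s x| ≤ |x - 1| * Real.exp (-(min 1 x) * s) := by
  have key : ∀ a b : ℝ, a ≤ b →
      |s⁻¹ * (Real.exp (-(a * s)) - Real.exp (-(b * s)))| ≤ (b - a) * Real.exp (-a * s) := by
    intro a b hab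
    have h1 : Real.exp (-(b * s)) ≤ Real.exp (-(a * s)) := by
      apply Real.exp_le_exp.2; nlinarith
    rw [abs_of_nonneg (mul_nonneg (inv_nonneg.2 hs.le) (sub_nonneg.2 h1)), inv_mul_le_iff₀ hs]
    have h2 : Real.exp (-(b * s)) = Real.exp (-(a * s)) * Real.exp (-((b - a) * s)) := by
      rw [← Real.exp_add]; ring_nf
    have h3 := Real.add_one_le_exp (-((b - a) * s))
    have h4 := Real.exp_pos (-(a * s))
    rw [h2, show -a * s = -(a * s) by ring]
    nlinarith
  unfold logKernel
  rcases le_total x 1 with hx | hx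
  · have := key x 1 hx
    rw [min_eq_right hx, abs_sub_comm x 1, abs_of_nonneg (sub_nonneg.2 hx)]
    rw [abs_mul, abs_sub_comm, ← abs_mul]; simpa using this
  · have := key 1 x hx
    rw [min_eq_left hx, abs_of_nonneg (sub_nonneg.2 hx)]
    simpa using this

lemma integrable_logKernel {x : ℝ} (hx : 0 < x) :
    Integrable (fun s => logKernel s x) (volume.restrict (Set.Ioi 0)) := by
  refine Integrable.mono' (g := fun s => |x - 1| * Real.exp (-(min 1 x) * s)) ?_ ?_ ?_
  · exact (integrableOn_exp_mul_Ioi (by simp [hx]) 0).const_mul _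
  · exact (measurable_logKernel.comp (by fun_prop : Measurable fun s : ℝ => (s, x))).aestronglyMeasurable
  · refine (ae_restrict_iff' measurableSet_Ioi).2 (Eventually.of_forall fun s hs => ?_)
    exact abs_logKernel_le hs

lemma integral_logKernel {x : ℝ} (hx : 0 < x) :
    ∫ s in Set.Ioi 0, logKernel s x = Real.log x := by
  have h := Frullani.integral_Ioi_eq (f := fun s : ℝ => Real.exp (-s)) (a := 1) (b := x)
    (L := 1) (R := 0) ?_ one_pos hx ?_ ?_ ?_
  · simpa [logKernel] using h
  · exact (Continuous.locallyIntegrable (by fun_prop)).locallyIntegrableOn _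
  · have : Continuous fun s : ℝ => Real.exp (-s) := by fun_prop
    have h0 := (this.tendsto 0)
    simp only [neg_zero, Real.exp_zero] at h0
    exact h0.mono_left nhdsWithin_le_nhds
  · exact Real.tendsto_exp_neg_atTop_nhds_zero
  · simpa [logKernel, IntegrableOn] using integrable_logKernel hx

/-- For fixed `x` the kernel keeps the sign of `log x`. Hence Fubini for `logKernel s (Q ω)` asks
for nothing beyond integrability of `log Q`. -/
lemma integral_abs_logKernel {x : ℝ} (hx : 0 < x) :
    ∫ s in Set.Ioi 0, |logKernel s x| = |Real.log x| := by
  rcases le_total x 1 with h1 | h1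
  · rw [abs_of_nonpos (Real.log_nonpos hx.le h1), ← integral_logKernel hx, ← integral_neg]
    refine setIntegral_congr_fun measurableSet_Ioi fun s hs => ?_
    refine abs_of_nonpos (mul_nonpos_of_nonneg_of_nonpos (inv_nonneg.2 (le_of_lt hs)) ?_)
    have hs' : (0 : ℝ) < s := hs
    exact sub_nonpos.2 (Real.exp_le_exp.2 (by nlinarith))
  · rw [abs_of_nonneg (Real.log_nonneg h1), ← integral_logKernel hx]
    refine setIntegral_congr_fun measurableSet_Ioi fun s hs => ?_
    refine abs_of_nonneg (mul_nonneg (inv_nonneg.2 (le_of_lt hs)) ?_)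
    have hs' : (0 : ℝ) < s := hs
    exact sub_nonneg.2 (Real.exp_le_exp.2 (by nlinarith))

section CovarianceLog

variable {Ω : Type*} [MeasurableSpace Ω] {P : Measure Ω}

lemma integrable_logKernel_prod [SFinite P] {Q : Ω → ℝ} (hQ : AEMeasurable Q P) (hpos : ∀ᵐ ω ∂P, 0 < Q ω)
    (hL : Integrable (fun ω => Real.log (Q ω)) P) :
    Integrable (fun p : Ω × ℝ => logKernel p.2 (Q p.1)) (P.prod (volume.restrict (Set.Ioi 0))) := by
  have hm : AEStronglyMeasurable (fun p : Ω × ℝ => logKernel p.2 (Q p.1))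
      (P.prod (volume.restrict (Set.Ioi 0))) :=
    (measurable_logKernel.comp_aemeasurable
      (measurable_snd.aemeasurable.prodMk hQ.comp_fst)).aestronglyMeasurable
  rw [integrable_prod_iff hm]
  refine ⟨hpos.mono fun ω h => integrable_logKernel h, ?_⟩
  refine hL.abs.congr (hpos.mono fun ω h => ?_)
  simp only [Real.norm_eq_abs]
  exact (integral_abs_logKernel h).symm

lemma integral_log_eq [SFinite P] {Q : Ω → ℝ} (hQ : AEMeasurable Q P) (hpos : ∀ᵐ ω ∂P, 0 < Q ω)
    (hL : Integrable (fun ω => Real.log (Q ω)) P) :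
    ∫ ω, Real.log (Q ω) ∂P = ∫ s in Set.Ioi 0, ∫ ω, logKernel s (Q ω) ∂P := by
  rw [← integral_integral_swap (integrable_logKernel_prod hQ hpos hL)]
  exact integral_congr_ae (hpos.mono fun ω h => (integral_logKernel h).symm)

lemma memLp_exp_neg_mul [IsProbabilityMeasure P] {Q : Ω → ℝ} (hQ : AEMeasurable Q P) (hpos : ∀ᵐ ω ∂P, 0 < Q ω)
    {s : ℝ} (hs : 0 < s) : MemLp (fun ω => Real.exp (-(Q ω * s))) 2 P := by
  refine MemLp.of_bound (C := 1) (by fun_prop) (hpos.mono fun ω h => ?_)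
  rw [Real.norm_eq_abs, abs_of_pos (Real.exp_pos _), Real.exp_le_one_iff]
  have := mul_pos h hs
  linarith

/-- Frullani's formula is inserted in both arguments. The terms `exp (-s)` and `exp (-t)` are
constants, so only the covariance of the random exponentials survives; square integrability of the
logarithms is what justifies the exchange of integrals. -/
lemma covariance_log_eq [IsProbabilityMeasure P] {Q₁ Q₂ : Ω → ℝ} (hQ₁ : AEMeasurable Q₁ P) (hQ₂ : AEMeasurable Q₂ P)
    (hpos₁ : ∀ᵐ ω ∂P, 0 < Q₁ ω) (hpos₂ : ∀ᵐ ω ∂P, 0 < Q₂ ω)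
    (hL₁ : MemLp (fun ω => Real.log (Q₁ ω)) 2 P) (hL₂ : MemLp (fun ω => Real.log (Q₂ ω)) 2 P) :
    cov[fun ω => Real.log (Q₁ ω), fun ω => Real.log (Q₂ ω); P] =
      ∫ z, z.1⁻¹ * z.2⁻¹ * cov[fun ω => Real.exp (-(Q₁ ω * z.1)), fun ω => Real.exp (-(Q₂ ω * z.2)); P]
        ∂((volume.restrict (Set.Ioi (0 : ℝ))).prod (volume.restrict (Set.Ioi (0 : ℝ)))) := by
  set ν : Measure ℝ := volume.restrict (Set.Ioi (0 : ℝ))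
  have hI₁ := integrable_logKernel_prod hQ₁ hpos₁ (hL₁.integrable one_le_two)
  have hI₂ := integrable_logKernel_prod hQ₂ hpos₂ (hL₂.integrable one_le_two)
  have hm : AEStronglyMeasurable
      (fun p : Ω × (ℝ × ℝ) => logKernel p.2.1 (Q₁ p.1) * logKernel p.2.2 (Q₂ p.1))
      (P.prod (ν.prod ν)) := by
    refine AEMeasurable.aestronglyMeasurable (AEMeasurable.mul ?_ ?_)
    · exact measurable_logKernel.comp_aemeasurable
        ((measurable_fst.comp measurable_snd).aemeasurable.prodMk hQ₁.comp_fst)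
    · exact measurable_logKernel.comp_aemeasurable
        ((measurable_snd.comp measurable_snd).aemeasurable.prodMk hQ₂.comp_fst)
  have hI : Integrable
      (fun p : Ω × (ℝ × ℝ) => logKernel p.2.1 (Q₁ p.1) * logKernel p.2.2 (Q₂ p.1))
      (P.prod (ν.prod ν)) := by
    rw [integrable_prod_iff hm]
    refine ⟨?_, ?_⟩
    · filter_upwards [hpos₁, hpos₂] with ω h1 h2
      exact (integrable_logKernel h1).mul_prod (integrable_logKernel h2)
    · refine (hL₁.integrable_mul hL₂).abs.congr ?_
      filter_upwards [hpos₁, hpos₂] with ω h1 h2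
      simp only [Real.norm_eq_abs, abs_mul, Pi.mul_apply]
      rw [integral_prod_mul (fun s => |logKernel s (Q₁ ω)|) (fun s => |logKernel s (Q₂ ω)|)]
      rw [integral_abs_logKernel h1, integral_abs_logKernel h2]
  have e1 : ∫ ω, Real.log (Q₁ ω) * Real.log (Q₂ ω) ∂P =
      ∫ z, ∫ ω, logKernel z.1 (Q₁ ω) * logKernel z.2 (Q₂ ω) ∂P ∂(ν.prod ν) := by
    rw [← integral_integral_swap hI]
    refine integral_congr_ae ?_
    filter_upwards [hpos₁, hpos₂] with ω h1 h2
    rw [integral_prod_mul (fun s => logKernel s (Q₁ ω)) (fun s => logKernel s (Q₂ ω)),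
      integral_logKernel h1, integral_logKernel h2]
  have e2 : (∫ ω, Real.log (Q₁ ω) ∂P) * (∫ ω, Real.log (Q₂ ω) ∂P) =
      ∫ z, (∫ ω, logKernel z.1 (Q₁ ω) ∂P) * (∫ ω, logKernel z.2 (Q₂ ω) ∂P) ∂(ν.prod ν) := by
    rw [integral_log_eq hQ₁ hpos₁ (hL₁.integrable one_le_two),
      integral_log_eq hQ₂ hpos₂ (hL₂.integrable one_le_two)]
    exact (integral_prod_mul (fun s => ∫ ω, logKernel s (Q₁ ω) ∂P)
      (fun s => ∫ ω, logKernel s (Q₂ ω) ∂P)).symm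
  rw [covariance_eq_sub hL₁ hL₂]
  simp only [Pi.mul_apply]
  rw [e1, e2, ← integral_sub hI.integral_prod_right
    (hI₁.integral_prod_right.mul_prod hI₂.integral_prod_right)]
  have hν : ∀ᵐ z ∂(ν.prod ν), 0 < z.1 ∧ 0 < z.2 := by
    have : ν.prod ν = (volume.prod volume).restrict (Set.Ioi (0 : ℝ) ×ˢ Set.Ioi (0 : ℝ)) :=
      Measure.prod_restrict _ _
    rw [this]
    refine (ae_restrict_iff' (measurableSet_Ioi.prod measurableSet_Ioi)).2
      (Eventually.of_forall fun z hz => ?_)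
    exact ⟨hz.1, hz.2⟩
  refine integral_congr_ae (hν.mono fun z hz => ?_)
  have hE₁ := memLp_exp_neg_mul hQ₁ hpos₁ hz.1
  have hE₂ := memLp_exp_neg_mul hQ₂ hpos₂ hz.2
  have k1 : MemLp (fun ω => logKernel z.1 (Q₁ ω)) 2 P :=
    ((memLp_const (Real.exp (-z.1))).sub hE₁).const_mul _
  have k2 : MemLp (fun ω => logKernel z.2 (Q₂ ω)) 2 P :=
    ((memLp_const (Real.exp (-z.2))).sub hE₂).const_mul _
  have := covariance_eq_sub k1 k2
  simp only [Pi.mul_apply] at this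
  dsimp only
  rw [← this]
  unfold logKernel
  rw [covariance_const_mul_left, covariance_const_mul_right,
    covariance_const_sub_left (hE₁.integrable one_le_two),
    covariance_const_sub_right (hE₂.integrable one_le_two)]
  ring

/-- The hypothesis carries the factors `s` and `t` explicitly so that they cancel the singular
weights `1/s` and `1/t` of the Frullani representation. -/
lemma abs_covariance_log_le [IsProbabilityMeasure P] {Q₁ Q₂ : Ω → ℝ} (hQ₁ : AEMeasurable Q₁ P) (hQ₂ : AEMeasurable Q₂ P)
    (hpos₁ : ∀ᵐ ω ∂P, 0 < Q₁ ω) (hpos₂ : ∀ᵐ ω ∂P, 0 < Q₂ ω)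
    (hL₁ : MemLp (fun ω => Real.log (Q₁ ω)) 2 P) (hL₂ : MemLp (fun ω => Real.log (Q₂ ω)) 2 P)
    {φ : ℝ → ℝ} (hφ : IntegrableOn φ (Set.Ioi 0)) {C : ℝ}
    (h : ∀ s t : ℝ, 0 < s → 0 < t →
      |cov[fun ω => Real.exp (-(Q₁ ω * s)), fun ω => Real.exp (-(Q₂ ω * t)); P]| ≤
        C * (s * φ s) * (t * φ t)) :
    |cov[fun ω => Real.log (Q₁ ω), fun ω => Real.log (Q₂ ω); P]| ≤
      C * (∫ s in Set.Ioi 0, φ s) ^ 2 := by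
  rw [covariance_log_eq hQ₁ hQ₂ hpos₁ hpos₂ hL₁ hL₂, sq,
    ← integral_prod_mul (μ := volume.restrict (Set.Ioi (0 : ℝ)))
      (ν := volume.restrict (Set.Ioi (0 : ℝ))) φ φ, ← integral_const_mul, ← Real.norm_eq_abs]
  refine norm_integral_le_of_norm_le ((hφ.mul_prod hφ).const_mul C) ?_
  rw [Measure.prod_restrict]
  refine (ae_restrict_iff' (measurableSet_Ioi.prod measurableSet_Ioi)).2
    (Eventually.of_forall fun z hz => ?_)
  have h1 : 0 < z.1 := hz.1
  have h2 : 0 < z.2 := hz.2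
  rw [Real.norm_eq_abs, abs_mul, abs_of_pos (mul_pos (inv_pos.2 h1) (inv_pos.2 h2))]
  calc z.1⁻¹ * z.2⁻¹ * _ ≤ z.1⁻¹ * z.2⁻¹ * (C * (z.1 * φ z.1) * (z.2 * φ z.2)) :=
        mul_le_mul_of_nonneg_left (h _ _ h1 h2) (by positivity)
    _ = C * (φ z.1 * φ z.2) := by field_simp

end CovarianceLog

/-! ### Gaussian linearisation of `exp (-s ‖y‖²)` -/

section StdGaussian

variable {E : Type*} [NormedAddCommGroup E] [InnerProductSpace ℝ E] [FiniteDimensional ℝ E]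
  [MeasurableSpace E] [BorelSpace E]

lemma measurePreserving_neg_stdGaussian :
    MeasurePreserving (fun x : E => -x) (stdGaussian E) (stdGaussian E) :=
  ⟨measurable_neg, stdGaussian_map (LinearIsometryEquiv.neg ℝ (E := E))⟩

/-- The characteristic function of the standard Gaussian read backwards: an exponential of a
quadratic form becomes an average of characters, which is linear in `y` inside the exponent. -/
lemma exp_neg_norm_sq_mul_eq (y : E) {s : ℝ} (hs : 0 ≤ s) :
    ((Real.exp (-(‖y‖ ^ 2 * s)) : ℝ) : ℂ) =
      ∫ x, Complex.exp ((inner ℝ (√(2 * s) • x) y : ℝ) * Complex.I) ∂(stdGaussian E) := by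
  have h := charFun_stdGaussian (√(2 * s) • y)
  rw [charFun_apply] at h
  simp only [inner_smul_left, inner_smul_right] at h ⊢
  simp only [conj_trivial]
  rw [h, norm_smul, Complex.ofReal_exp]
  congr 1
  rw [Real.norm_eq_abs, abs_of_nonneg (Real.sqrt_nonneg _)]
  have : (√(2 * s)) ^ 2 = 2 * s := Real.sq_sqrt (by positivity)
  push_cast
  rw [mul_pow, ← Complex.ofReal_pow (√(2 * s)), this]
  push_cast; ring

/-- The function `s ↦ E[‖N‖² exp (-s ‖N‖² / 4)]` for a standard Gaussian vector `N`. -/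
noncomputable def gaussianTilt (E : Type*) [NormedAddCommGroup E] [InnerProductSpace ℝ E]
    [FiniteDimensional ℝ E] [MeasurableSpace E] (s : ℝ) : ℝ :=
  ∫ x, ‖x‖ ^ 2 * Real.exp (-(s * ‖x‖ ^ 2 / 4)) ∂(stdGaussian E)

/-- The integral is exactly `4` unless `x = 0`, where it vanishes. Its independence of `x` is why
`gaussianTilt` is integrable whatever the dimension. -/
lemma integral_norm_sq_mul_exp (x : E) :
    ∫ s in Set.Ioi (0 : ℝ), ‖x‖ ^ 2 * Real.exp (-(s * ‖x‖ ^ 2 / 4)) ≤ 4 := by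
  by_cases hx : x = 0
  · simp [hx]
  have hx' : 0 < ‖x‖ ^ 2 := by positivity
  rw [integral_const_mul]
  have := integral_exp_mul_Ioi (a := -(‖x‖ ^ 2 / 4)) (by linarith) 0
  have e : (fun s : ℝ => Real.exp (-(s * ‖x‖ ^ 2 / 4))) =
      fun s => Real.exp (-(‖x‖ ^ 2 / 4) * s) := by ext s; ring_nf
  rw [e, this]
  simp
  field_simp
  rfl

lemma integrable_norm_sq_mul_exp (x : E) :
    IntegrableOn (fun s : ℝ => ‖x‖ ^ 2 * Real.exp (-(s * ‖x‖ ^ 2 / 4))) (Set.Ioi 0) := by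
  by_cases hx : x = 0
  · simp [hx]
  have hx' : 0 < ‖x‖ ^ 2 := by positivity
  refine Integrable.const_mul ?_ _
  have e : (fun s : ℝ => Real.exp (-(s * ‖x‖ ^ 2 / 4))) =
      fun s => Real.exp (-(‖x‖ ^ 2 / 4) * s) := by ext s; ring_nf
  rw [e]
  exact integrableOn_exp_mul_Ioi (by linarith) 0

lemma integrable_prod_norm_sq_mul_exp :
    Integrable (fun p : E × ℝ => ‖p.1‖ ^ 2 * Real.exp (-(p.2 * ‖p.1‖ ^ 2 / 4)))
      ((stdGaussian E).prod (volume.restrict (Set.Ioi 0))) := by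
  have hm : AEStronglyMeasurable
      (fun p : E × ℝ => ‖p.1‖ ^ 2 * Real.exp (-(p.2 * ‖p.1‖ ^ 2 / 4)))
      ((stdGaussian E).prod (volume.restrict (Set.Ioi 0))) := by
    refine Measurable.aestronglyMeasurable ?_
    fun_prop
  rw [integrable_prod_iff hm]
  refine ⟨Eventually.of_forall fun x => integrable_norm_sq_mul_exp x, ?_⟩
  refine Integrable.of_bound (C := 4) hm.norm.integral_prod_right' (Eventually.of_forall fun x => ?_)
  have : ∀ s : ℝ, ‖‖x‖ ^ 2 * Real.exp (-(s * ‖x‖ ^ 2 / 4))‖ =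
      ‖x‖ ^ 2 * Real.exp (-(s * ‖x‖ ^ 2 / 4)) := fun s => by
    rw [Real.norm_eq_abs, abs_of_nonneg (by positivity)]
  simp only [this]
  rw [Real.norm_eq_abs, abs_of_nonneg (integral_nonneg fun s => by positivity)]
  exact integral_norm_sq_mul_exp x

lemma integrableOn_gaussianTilt : IntegrableOn (gaussianTilt E) (Set.Ioi 0) :=
  (integrable_prod_norm_sq_mul_exp (E := E)).integral_prod_right

lemma gaussianTilt_nonneg (s : ℝ) : 0 ≤ gaussianTilt E s :=
  integral_nonneg fun x => by positivity

lemma integral_gaussianTilt_le : ∫ s in Set.Ioi (0 : ℝ), gaussianTilt E s ≤ 4 := by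
  unfold gaussianTilt
  rw [← integral_integral_swap (integrable_prod_norm_sq_mul_exp (E := E))]
  calc _ ≤ ∫ _ : E, (4 : ℝ) ∂(stdGaussian E) := by
        refine integral_mono_of_nonneg (Eventually.of_forall fun x =>
          integral_nonneg fun s => by positivity) (integrable_const _)
          (Eventually.of_forall fun x => integral_norm_sq_mul_exp x)
    _ = 4 := by simp

lemma integrable_norm_sq_mul_exp_stdGaussian {s : ℝ} (hs : 0 < s) :
    Integrable (fun x : E => ‖x‖ ^ 2 * Real.exp (-(s * ‖x‖ ^ 2 / 4))) (stdGaussian E) := by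
  refine Integrable.of_bound (C := 4 / s) (by fun_prop) (Eventually.of_forall fun x => ?_)
  rw [Real.norm_eq_abs, abs_of_nonneg (by positivity), Real.exp_neg, ← div_eq_mul_inv,
    div_le_div_iff₀ (Real.exp_pos _) hs]
  have := Real.add_one_le_exp (s * ‖x‖ ^ 2 / 4)
  nlinarith

end StdGaussian

/-! ### Log norms of two nearly independent Gaussian vectors -/

/-- From `cosh z - 1 = 2 sinh² (z/2)` and `|sinh w| ≤ |w| exp |w|`. The factor `z²` will carry the
square of the cross covariance, while `exp |z|` is absorbed by the Gaussian exponent. -/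
lemma cosh_sub_one_le (z : ℝ) : Real.cosh z - 1 ≤ z ^ 2 / 2 * Real.exp |z| := by
  have h1 : Real.cosh z - 1 = 2 * Real.sinh (z / 2) ^ 2 := by
    have := Real.cosh_two_mul (z / 2)
    have h2 := Real.cosh_sq (z / 2)
    rw [show 2 * (z / 2) = z by ring] at this
    linarith
  have h3 : |Real.sinh (z / 2)| ≤ |z / 2| * Real.exp (|z| / 2) := by
    rw [Real.abs_sinh]
    set w := |z / 2| with hw
    have hw' : |z| / 2 = w := by rw [hw, abs_div]; norm_num
    rw [hw', Real.sinh_eq]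
    have hw0 : 0 ≤ w := abs_nonneg _
    have e1 : Real.exp (-w) = Real.exp w * Real.exp (-(2 * w)) := by
      rw [← Real.exp_add]; ring_nf
    have e2 := Real.add_one_le_exp (-(2 * w))
    rw [e1]
    nlinarith [Real.exp_pos w]
  have h4 : Real.sinh (z / 2) ^ 2 ≤ (|z / 2| * Real.exp (|z| / 2)) ^ 2 := by
    rw [← sq_abs (Real.sinh _)]
    exact pow_le_pow_left₀ (abs_nonneg _) h3 2
  rw [h1]
  have h5 : (|z / 2| * Real.exp (|z| / 2)) ^ 2 = z ^ 2 / 4 * Real.exp |z| := by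
    rw [mul_pow, sq_abs, ← Real.exp_nat_mul]
    have : ((2 : ℕ) : ℝ) * (|z| / 2) = |z| := by push_cast; ring
    rw [this]; ring
  rw [h5] at h4
  linarith

section GaussianPair

variable {E : Type*} [NormedAddCommGroup E] [InnerProductSpace ℝ E] [FiniteDimensional ℝ E]
  [MeasurableSpace E] [BorelSpace E]
  {Ω : Type*} [MeasurableSpace Ω] {P : Measure Ω} [IsProbabilityMeasure P]

/-- `(Y₁, Y₂)` is a centred Gaussian pair, with variance forms `v₁`, `v₂` and covariance form `c`,
whose marginals have variance at least one half and whose cross covariance is at most `ρ`. -/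
structure IsNearIndepGaussianPair (P : Measure Ω) (Y₁ Y₂ : Ω → E) (v₁ v₂ : E → ℝ) (c : E → E → ℝ)
    (ρ : ℝ) : Prop where
  aemeasurable_left : AEMeasurable Y₁ P
  aemeasurable_right : AEMeasurable Y₂ P
  charFun_eq : ∀ x y : E, ∫ ω, Complex.exp (((inner ℝ x (Y₁ ω) + inner ℝ y (Y₂ ω) : ℝ) : ℂ) *
    Complex.I) ∂P = Complex.exp (-((v₁ x + v₂ y) / 2 + c x y : ℝ))
  continuous_left : Continuous v₁
  continuous_right : Continuous v₂
  continuous_cross : Continuous (fun p : E × E => c p.1 p.2)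
  left_smul : ∀ (r : ℝ) x, v₁ (r • x) = r ^ 2 * v₁ x
  right_smul : ∀ (r : ℝ) x, v₂ (r • x) = r ^ 2 * v₂ x
  cross_smul : ∀ (r t : ℝ) x y, c (r • x) (t • y) = r * t * c x y
  le_left : ∀ x, ‖x‖ ^ 2 / 2 ≤ v₁ x
  le_right : ∀ x, ‖x‖ ^ 2 / 2 ≤ v₂ x
  cross_le : ∀ x y, |c x y| ≤ ρ * ‖x‖ * ‖y‖
  nonneg : 0 ≤ ρ
  le_quarter : ρ ≤ 1 / 4

namespace IsNearIndepGaussianPair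

variable {Y₁ Y₂ : Ω → E} {v₁ v₂ : E → ℝ} {c : E → E → ℝ} {ρ : ℝ}

/-- Both exponentials are linearised with independent auxiliary Gaussian vectors. After Fubini, the
expectation over `Ω` is the joint characteristic function of the pair. -/
lemma integral_exp_mul_exp (h : IsNearIndepGaussianPair P Y₁ Y₂ v₁ v₂ c ρ) {s t : ℝ}
    (hs : 0 ≤ s) (ht : 0 ≤ t) :
    ∫ ω, Real.exp (-(‖Y₁ ω‖ ^ 2 * s)) * Real.exp (-(‖Y₂ ω‖ ^ 2 * t)) ∂P =
      ∫ p, Real.exp (-(s * v₁ p.1 + t * v₂ p.2 + 2 * √(s * t) * c p.1 p.2))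
        ∂((stdGaussian E).prod (stdGaussian E)) := by
  set γ := stdGaussian E
  have hY₁ := h.aemeasurable_left
  have hY₂ := h.aemeasurable_right
  have key : ∀ ω, ((Real.exp (-(‖Y₁ ω‖ ^ 2 * s)) * Real.exp (-(‖Y₂ ω‖ ^ 2 * t)) : ℝ) : ℂ) =
      ∫ p, Complex.exp (((inner ℝ (√(2 * s) • p.1) (Y₁ ω) + inner ℝ (√(2 * t) • p.2) (Y₂ ω) : ℝ) : ℂ)
        * Complex.I) ∂(γ.prod γ) := by
    intro ω
    rw [Complex.ofReal_mul, exp_neg_norm_sq_mul_eq _ hs, exp_neg_norm_sq_mul_eq _ ht,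
      ← integral_prod_mul]
    refine integral_congr_ae (Eventually.of_forall fun p => ?_)
    simp only
    rw [← Complex.exp_add]
    push_cast; ring_nf
  have hm : AEStronglyMeasurable (fun q : Ω × (E × E) =>
      Complex.exp (((inner ℝ (√(2 * s) • q.2.1) (Y₁ q.1) + inner ℝ (√(2 * t) • q.2.2) (Y₂ q.1) : ℝ)
        : ℂ) * Complex.I)) (P.prod (γ.prod γ)) := by
    have a1 : AEMeasurable (fun q : Ω × (E × E) => Y₁ q.1) (P.prod (γ.prod γ)) := hY₁.comp_fst
    have a2 : AEMeasurable (fun q : Ω × (E × E) => Y₂ q.1) (P.prod (γ.prod γ)) := hY₂.comp_fst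
    have b1 : AEMeasurable (fun q : Ω × (E × E) => √(2 * s) • q.2.1) (P.prod (γ.prod γ)) :=
      Measurable.aemeasurable (by fun_prop)
    have b2 : AEMeasurable (fun q : Ω × (E × E) => √(2 * t) • q.2.2) (P.prod (γ.prod γ)) :=
      Measurable.aemeasurable (by fun_prop)
    exact (Complex.measurable_exp.comp_aemeasurable
      (((Complex.measurable_ofReal.comp_aemeasurable
        ((b1.inner a1).add (b2.inner a2)))).mul_const _)).aestronglyMeasurable
  have hI : Integrable (fun q : Ω × (E × E) =>
      Complex.exp (((inner ℝ (√(2 * s) • q.2.1) (Y₁ q.1) + inner ℝ (√(2 * t) • q.2.2) (Y₂ q.1) : ℝ)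
        : ℂ) * Complex.I)) (P.prod (γ.prod γ)) :=
    Integrable.of_bound hm 1 (Eventually.of_forall fun q => by
      rw [Complex.norm_exp_ofReal_mul_I])
  have e : ((∫ ω, Real.exp (-(‖Y₁ ω‖ ^ 2 * s)) * Real.exp (-(‖Y₂ ω‖ ^ 2 * t)) ∂P : ℝ) : ℂ) =
      ((∫ p, Real.exp (-(s * v₁ p.1 + t * v₂ p.2 + 2 * √(s * t) * c p.1 p.2)) ∂(γ.prod γ) : ℝ) : ℂ)
      := by
    rw [← integral_complex_ofReal, ← integral_complex_ofReal]
    rw [integral_congr_ae (Eventually.of_forall key), integral_integral_swap hI]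
    refine integral_congr_ae (Eventually.of_forall fun p => ?_)
    simp only
    rw [h.charFun_eq, h.left_smul, h.right_smul, h.cross_smul, Real.sq_sqrt (by positivity),
      Real.sq_sqrt (by positivity), Complex.ofReal_exp]
    have : √(2 * s) * √(2 * t) = 2 * √(s * t) := by
      rw [← Real.sqrt_mul (by positivity), show 2 * s * (2 * t) = 2 ^ 2 * (s * t) by ring,
        Real.sqrt_mul (by positivity), Real.sqrt_sq (by norm_num)]
    rw [this]
    push_cast
    ring_nf
  exact_mod_cast e

/-- By `2uv ≤ u² + v²` the cross term costs at most `ρ ≤ 1/4` of `s ‖x‖² + t ‖y‖²`, while the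
variances supply one half of it; one quarter is left over for integrability. -/
lemma exponent_le (h : IsNearIndepGaussianPair P Y₁ Y₂ v₁ v₂ c ρ) {s t : ℝ}
    (hs : 0 ≤ s) (ht : 0 ≤ t) (x y : E) :
    |2 * √(s * t) * c x y| - (s * v₁ x + t * v₂ y) ≤ -(s * ‖x‖ ^ 2 / 4) - t * ‖y‖ ^ 2 / 4 := by
  have h1 : |2 * √(s * t) * c x y| ≤ ρ * (s * ‖x‖ ^ 2 + t * ‖y‖ ^ 2) := by
    rw [abs_mul, abs_of_nonneg (by positivity)]
    have h2 := h.cross_le x y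
    have h3 : √(s * t) = √s * √t := Real.sqrt_mul hs t
    have h4 := Real.sq_sqrt hs
    have h5 := Real.sq_sqrt ht
    calc 2 * √(s * t) * |c x y| ≤ 2 * √(s * t) * (ρ * ‖x‖ * ‖y‖) :=
          mul_le_mul_of_nonneg_left h2 (by positivity)
      _ = ρ * (2 * (√s * ‖x‖) * (√t * ‖y‖)) := by rw [h3]; ring
      _ ≤ ρ * ((√s * ‖x‖) ^ 2 + (√t * ‖y‖) ^ 2) :=
          mul_le_mul_of_nonneg_left (two_mul_le_add_sq _ _) h.nonneg
      _ = _ := by rw [mul_pow, mul_pow, h4, h5]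
  have h6 := mul_le_mul_of_nonneg_left (h.le_left x) hs
  have h7 := mul_le_mul_of_nonneg_left (h.le_right y) ht
  have h8 : ρ * (s * ‖x‖ ^ 2 + t * ‖y‖ ^ 2) ≤ 1 / 4 * (s * ‖x‖ ^ 2 + t * ‖y‖ ^ 2) :=
    mul_le_mul_of_nonneg_right h.le_quarter (by positivity)
  linarith

/-- The parameter serves `covariance_exp_eq`, where `a = 1`, `a = -1` and `a = 0` are the joint law,
its reflection and the product of the marginals. -/
lemma integrable_exp (h : IsNearIndepGaussianPair P Y₁ Y₂ v₁ v₂ c ρ) {s t : ℝ}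
    (hs : 0 ≤ s) (ht : 0 ≤ t) {a : ℝ} (ha : |a| ≤ 1) :
    Integrable (fun p : E × E =>
        Real.exp (-(s * v₁ p.1 + t * v₂ p.2 + a * (2 * √(s * t) * c p.1 p.2))))
      ((stdGaussian E).prod (stdGaussian E)) := by
  have c1 := h.continuous_left
  have c2 := h.continuous_right
  have c3 := h.continuous_cross
  refine Integrable.of_bound (C := 1) ?_ (Eventually.of_forall fun p => ?_)
  · exact Continuous.aestronglyMeasurable (by fun_prop)
  · rw [Real.norm_eq_abs, abs_of_pos (Real.exp_pos _), Real.exp_le_one_iff]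
    have h1 := h.exponent_le hs ht p.1 p.2
    have h2 : |a * (2 * √(s * t) * c p.1 p.2)| ≤ |2 * √(s * t) * c p.1 p.2| := by
      rw [abs_mul]; exact mul_le_of_le_one_left (abs_nonneg _) ha
    have h3 := neg_abs_le (a * (2 * √(s * t) * c p.1 p.2))
    have h4 : 0 ≤ s * ‖p.1‖ ^ 2 := by positivity
    have h5 : 0 ≤ t * ‖p.2‖ ^ 2 := by positivity
    linarith

/-- Reflecting the first auxiliary vector changes the sign of the cross term only. Averaging over
the two signs produces `cosh`, and the product of expectations subtracts `1`. The term linear in `c`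
has disappeared, which is the source of the quadratic dependence on `ρ`. -/
lemma covariance_exp_eq (h : IsNearIndepGaussianPair P Y₁ Y₂ v₁ v₂ c ρ) {s t : ℝ}
    (hs : 0 ≤ s) (ht : 0 ≤ t) :
    cov[fun ω => Real.exp (-(‖Y₁ ω‖ ^ 2 * s)), fun ω => Real.exp (-(‖Y₂ ω‖ ^ 2 * t)); P] =
      ∫ p, Real.exp (-(s * v₁ p.1 + t * v₂ p.2)) * (Real.cosh (2 * √(s * t) * c p.1 p.2) - 1)
        ∂((stdGaussian E).prod (stdGaussian E)) := by
  set γ := stdGaussian E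
  have hY₁ := h.aemeasurable_left
  have hY₂ := h.aemeasurable_right
  have m : ∀ (Y : Ω → E) (r : ℝ), AEMeasurable Y P → 0 ≤ r →
      MemLp (fun ω => Real.exp (-(‖Y ω‖ ^ 2 * r))) 2 P := fun Y r hY hr => by
    refine MemLp.of_bound (C := 1) ?_ (Eventually.of_forall fun ω => ?_)
    · exact (AEMeasurable.aestronglyMeasurable (by fun_prop))
    · rw [Real.norm_eq_abs, abs_of_pos (Real.exp_pos _), Real.exp_le_one_iff]
      have : 0 ≤ ‖Y ω‖ ^ 2 * r := by positivity
      linarith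
  have I1 := h.integrable_exp hs ht (a := 1) (by simp)
  have I2 := h.integrable_exp hs ht (a := -1) (by simp)
  have I0 := h.integrable_exp hs ht (a := 0) (by simp)
  rw [covariance_eq_sub (m Y₁ s hY₁ hs) (m Y₂ t hY₂ ht)]
  simp only [Pi.mul_apply]
  have e0 := h.integral_exp_mul_exp hs ht
  have e1 := h.integral_exp_mul_exp hs le_rfl
  have e2 := h.integral_exp_mul_exp le_rfl ht
  simp only [mul_zero, zero_mul, neg_zero, Real.exp_zero, mul_one, one_mul, Real.sqrt_zero,
    add_zero, zero_add] at e1 e2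
  have e1' : ∫ p : E × E, Real.exp (-(s * v₁ p.1)) ∂(γ.prod γ) = ∫ x, Real.exp (-(s * v₁ x)) ∂γ := by
    simpa using integral_prod_mul (μ := γ) (ν := γ) (fun x => Real.exp (-(s * v₁ x))) (fun _ => (1 : ℝ))
  have e2' : ∫ p : E × E, Real.exp (-(t * v₂ p.2)) ∂(γ.prod γ) = ∫ x, Real.exp (-(t * v₂ x)) ∂γ := by
    simpa using integral_prod_mul (μ := γ) (ν := γ) (fun _ => (1 : ℝ)) (fun x => Real.exp (-(t * v₂ x)))
  have hflip : ∫ p, Real.exp (-(s * v₁ p.1 + t * v₂ p.2 + 2 * √(s * t) * c p.1 p.2)) ∂(γ.prod γ) =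
      ∫ p, Real.exp (-(s * v₁ p.1 + t * v₂ p.2 + (-1) * (2 * √(s * t) * c p.1 p.2))) ∂(γ.prod γ) := by
    have mp : MeasurePreserving (fun p : E × E => (-p.1, p.2)) (γ.prod γ) (γ.prod γ) :=
      (measurePreserving_neg_stdGaussian (E := E)).prod (MeasurePreserving.id γ)
    have me : MeasurableEmbedding (fun p : E × E => (-p.1, p.2)) :=
      ((MeasurableEquiv.neg E).prodCongr (MeasurableEquiv.refl E)).measurableEmbedding
    rw [← mp.integral_comp me]
    refine integral_congr_ae (Eventually.of_forall fun p => ?_)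
    have n1 : v₁ (-p.1) = v₁ p.1 := by simpa using h.left_smul (-1) p.1
    have n2 : c (-p.1) p.2 = -c p.1 p.2 := by simpa using h.cross_smul (-1) 1 p.1 p.2
    simp only [n1, n2]
    ring_nf
  rw [e0, e1, e2, e1', e2', ← integral_prod_mul (μ := γ) (ν := γ)]
  have hhalf : ∀ a b : ℝ, a = b → a = (a + b) / 2 := fun a b hab => by rw [hab]; ring
  rw [hhalf _ _ hflip]
  simp only [one_mul, zero_mul, add_zero] at I0 I1
  rw [← integral_add I1 I2, ← integral_div]
  have I0' : Integrable (fun p : E × E => Real.exp (-(s * v₁ p.1)) * Real.exp (-(t * v₂ p.2)))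
      (γ.prod γ) := by
    refine I0.congr (Eventually.of_forall fun p => ?_)
    simp only [← Real.exp_add]; ring_nf
  have I12 : Integrable (fun p : E × E =>
      (Real.exp (-(s * v₁ p.1 + t * v₂ p.2 + 2 * √(s * t) * c p.1 p.2)) +
        Real.exp (-(s * v₁ p.1 + t * v₂ p.2 + -1 * (2 * √(s * t) * c p.1 p.2)))) / 2) (γ.prod γ) :=
    (I1.add I2).div_const 2
  rw [← integral_sub I12 I0']
  refine integral_congr_ae (Eventually.of_forall fun p => ?_)
  simp only [Real.cosh_eq]
  rw [← Real.exp_add, mul_sub, mul_div_assoc', mul_add, ← Real.exp_add, ← Real.exp_add]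
  ring_nf

lemma abs_covariance_exp_le (h : IsNearIndepGaussianPair P Y₁ Y₂ v₁ v₂ c ρ) {s t : ℝ}
    (hs : 0 < s) (ht : 0 < t) :
    |cov[fun ω => Real.exp (-(‖Y₁ ω‖ ^ 2 * s)), fun ω => Real.exp (-(‖Y₂ ω‖ ^ 2 * t)); P]| ≤
      2 * ρ ^ 2 * (s * gaussianTilt E s) * (t * gaussianTilt E t) := by
  set γ := stdGaussian E
  rw [h.covariance_exp_eq hs.le ht.le]
  have e : 2 * ρ ^ 2 * (s * gaussianTilt E s) * (t * gaussianTilt E t) =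
      ∫ p : E × E, 2 * ρ ^ 2 * s * t * ((‖p.1‖ ^ 2 * Real.exp (-(s * ‖p.1‖ ^ 2 / 4))) *
        (‖p.2‖ ^ 2 * Real.exp (-(t * ‖p.2‖ ^ 2 / 4)))) ∂(γ.prod γ) := by
    rw [integral_const_mul, integral_prod_mul (μ := γ) (ν := γ)
      (fun x => ‖x‖ ^ 2 * Real.exp (-(s * ‖x‖ ^ 2 / 4)))
      (fun x => ‖x‖ ^ 2 * Real.exp (-(t * ‖x‖ ^ 2 / 4)))]
    unfold gaussianTilt
    ring
  rw [e, ← Real.norm_eq_abs]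
  refine norm_integral_le_of_norm_le ?_ (Eventually.of_forall fun p => ?_)
  · exact ((integrable_norm_sq_mul_exp_stdGaussian hs).mul_prod
      (integrable_norm_sq_mul_exp_stdGaussian ht)).const_mul _
  · set z := 2 * √(s * t) * c p.1 p.2 with hz
    have h1 := cosh_sub_one_le z
    have h2 := h.exponent_le hs.le ht.le p.1 p.2
    rw [← hz] at h2
    have h3 : 0 ≤ Real.cosh z - 1 := sub_nonneg.2 (Real.one_le_cosh z)
    rw [Real.norm_eq_abs, abs_of_nonneg (mul_nonneg (Real.exp_pos _).le h3)]
    have hz2 : z ^ 2 ≤ 4 * s * t * ρ ^ 2 * ‖p.1‖ ^ 2 * ‖p.2‖ ^ 2 := by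
      have h4 := pow_le_pow_left₀ (abs_nonneg _) (h.cross_le p.1 p.2) 2
      rw [sq_abs] at h4
      have h5 : z ^ 2 = 4 * (s * t) * c p.1 p.2 ^ 2 := by
        rw [hz, mul_pow, mul_pow, Real.sq_sqrt (by positivity)]; ring
      rw [h5]
      calc 4 * (s * t) * c p.1 p.2 ^ 2 ≤ 4 * (s * t) * (ρ * ‖p.1‖ * ‖p.2‖) ^ 2 :=
            mul_le_mul_of_nonneg_left h4 (by positivity)
        _ = _ := by ring
    calc Real.exp (-(s * v₁ p.1 + t * v₂ p.2)) * (Real.cosh z - 1)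
        ≤ Real.exp (-(s * v₁ p.1 + t * v₂ p.2)) * (z ^ 2 / 2 * Real.exp |z|) :=
          mul_le_mul_of_nonneg_left h1 (Real.exp_pos _).le
      _ = z ^ 2 / 2 * Real.exp (|z| - (s * v₁ p.1 + t * v₂ p.2)) := by
          rw [sub_eq_add_neg, Real.exp_add]; ring
      _ ≤ (4 * s * t * ρ ^ 2 * ‖p.1‖ ^ 2 * ‖p.2‖ ^ 2) / 2 *
          Real.exp (-(s * ‖p.1‖ ^ 2 / 4) - t * ‖p.2‖ ^ 2 / 4) := by
          gcongr
      _ = _ := by rw [sub_eq_add_neg, Real.exp_add]; ring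

/-- The logarithms of the squared norms of two nearly independent Gaussian vectors have a covariance
which is quadratic in the cross covariance of the vectors. -/
theorem abs_covariance_log_norm_sq_le (h : IsNearIndepGaussianPair P Y₁ Y₂ v₁ v₂ c ρ)
    (hpos₁ : ∀ᵐ ω ∂P, 0 < ‖Y₁ ω‖ ^ 2) (hpos₂ : ∀ᵐ ω ∂P, 0 < ‖Y₂ ω‖ ^ 2)
    (hL₁ : MemLp (fun ω => Real.log (‖Y₁ ω‖ ^ 2)) 2 P)
    (hL₂ : MemLp (fun ω => Real.log (‖Y₂ ω‖ ^ 2)) 2 P) :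
    |cov[fun ω => Real.log (‖Y₁ ω‖ ^ 2), fun ω => Real.log (‖Y₂ ω‖ ^ 2); P]| ≤ 32 * ρ ^ 2 := by
  have hY₁ := h.aemeasurable_left
  have hY₂ := h.aemeasurable_right
  have := abs_covariance_log_le (by fun_prop) (by fun_prop) hpos₁ hpos₂ hL₁ hL₂
    integrableOn_gaussianTilt (C := 2 * ρ ^ 2) (fun s t hs ht => h.abs_covariance_exp_le hs ht)
  refine this.trans ?_
  have h1 := integral_gaussianTilt_le (E := E)
  have h0 : 0 ≤ ∫ s in Set.Ioi (0 : ℝ), gaussianTilt E s :=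
    integral_nonneg fun s => gaussianTilt_nonneg s
  -- The constant is `32 = 2 * 4²`, each integral of `gaussianTilt` being at most `4`.
  have := pow_le_pow_left₀ h0 h1 2
  nlinarith [sq_nonneg ρ]

end IsNearIndepGaussianPair
end GaussianPair

/-! ### Logarithmic moments of the Gamma law and the trigamma function -/

section LogGammaMoments

lemma locallyIntegrableOn_log_pow_mul_exp (k : ℕ) :
    LocallyIntegrableOn (fun t : ℝ => ((Real.log t ^ k * Real.exp (-t) : ℝ) : ℂ)) (Set.Ioi 0) := by
  refine ContinuousOn.locallyIntegrableOn ?_ measurableSet_Ioi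
  refine Complex.continuous_ofReal.comp_continuousOn ?_
  refine ContinuousOn.mul (ContinuousOn.pow ?_ k) (by fun_prop)
  exact Real.continuousOn_log.mono fun x hx => ne_of_gt hx

/-- Each logarithm is paid for by one unit of the exponent, so the induction runs with the exponent
generalised. -/
lemma isBigO_atTop_log_pow_mul_exp (k : ℕ) (a : ℝ) :
    (fun t : ℝ => ((Real.log t ^ k * Real.exp (-t) : ℝ) : ℂ)) =O[atTop] (· ^ (-a)) := by
  induction k generalizing a with
  | zero =>
    rw [← isBigO_norm_left]
    simp_rw [Complex.norm_real, isBigO_norm_left]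
    simpa using (isLittleO_exp_neg_mul_rpow_atTop zero_lt_one (-a)).isBigO
  | succ k ih =>
    refine (isBigO_rpow_top_log_smul (lt_add_one a) (ih (a + 1))).congr_left fun t => ?_
    simp only [Complex.real_smul]
    push_cast; ring

lemma isBigO_nhdsGT_log_pow_mul_exp (k : ℕ) {b : ℝ} (hb : 0 < b) :
    (fun t : ℝ => ((Real.log t ^ k * Real.exp (-t) : ℝ) : ℂ)) =O[𝓝[>] 0] (· ^ (-b)) := by
  induction k generalizing b with
  | zero =>
    have h1 : (fun t : ℝ => ((Real.log t ^ 0 * Real.exp (-t) : ℝ) : ℂ)) =O[𝓝[>] 0]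
        (fun _ => (1 : ℝ)) := by
      refine isBigO_const_of_tendsto (y := (1 : ℂ)) ?_ one_ne_zero
      have : Continuous fun t : ℝ => ((Real.exp (-t) : ℝ) : ℂ) := by fun_prop
      have h := this.tendsto 0
      simp only [neg_zero, Real.exp_zero, Complex.ofReal_one] at h
      simpa using h.mono_left nhdsWithin_le_nhds
    refine h1.trans ?_
    refine IsBigO.of_bound 1 ?_
    filter_upwards [Ioo_mem_nhdsGT (zero_lt_one' ℝ)] with t ht
    rw [norm_one, one_mul, Real.norm_eq_abs, abs_of_nonneg (Real.rpow_nonneg ht.1.le _)]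
    exact Real.one_le_rpow_of_pos_of_le_one_of_nonpos ht.1 ht.2.le (by linarith)
  | succ k ih =>
    refine (isBigO_rpow_zero_log_smul (half_lt_self hb) (ih (half_pos hb))).congr_left fun t => ?_
    simp only [Complex.real_smul]
    push_cast; ring

/-- The derivatives of the Mellin integral of `log t ^ k * exp (-t)`. -/
lemma hasDerivAt_mellin_log_pow_mul_exp (k : ℕ) {s : ℂ} (hs : 0 < s.re) :
    MellinConvergent (fun t : ℝ => ((Real.log t ^ (k + 1) * Real.exp (-t) : ℝ) : ℂ)) s ∧
    HasDerivAt (mellin fun t : ℝ => ((Real.log t ^ k * Real.exp (-t) : ℝ) : ℂ))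
      (mellin (fun t : ℝ => ((Real.log t ^ (k + 1) * Real.exp (-t) : ℝ) : ℂ)) s) s := by
  have h := mellin_hasDerivAt_of_isBigO_rpow (E := ℂ) (locallyIntegrableOn_log_pow_mul_exp k)
    (isBigO_atTop_log_pow_mul_exp k _) (lt_add_one s.re)
    (isBigO_nhdsGT_log_pow_mul_exp k (half_pos hs)) (half_lt_self hs)
  have e : (fun t : ℝ => Real.log t • ((Real.log t ^ k * Real.exp (-t) : ℝ) : ℂ)) =
      fun t : ℝ => ((Real.log t ^ (k + 1) * Real.exp (-t) : ℝ) : ℂ) := by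
    ext t
    simp only [Complex.real_smul]
    push_cast; ring
  rwa [e] at h

lemma mellinConvergent_log_pow_mul_exp (k : ℕ) {s : ℂ} (hs : 0 < s.re) :
    MellinConvergent (fun t : ℝ => ((Real.log t ^ k * Real.exp (-t) : ℝ) : ℂ)) s :=
  mellinConvergent_of_isBigO_rpow (E := ℂ) (locallyIntegrableOn_log_pow_mul_exp k)
    (isBigO_atTop_log_pow_mul_exp k _) (lt_add_one s.re)
    (isBigO_nhdsGT_log_pow_mul_exp k (half_pos hs)) (half_lt_self hs)

/-- The integral `∫_0^∞ u ^ (a - 1) exp (-u) (log u) ^ k du`. -/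
noncomputable def logGammaMoment (a : ℝ) (k : ℕ) : ℝ :=
  ∫ u in Set.Ioi 0, u ^ (a - 1) * Real.exp (-u) * Real.log u ^ k

lemma ofReal_mellin_integrand {a u : ℝ} (hu : 0 < u) (k : ℕ) :
    (u : ℂ) ^ ((a : ℂ) - 1) • ((Real.log u ^ k * Real.exp (-u) : ℝ) : ℂ) =
      ((u ^ (a - 1) * Real.exp (-u) * Real.log u ^ k : ℝ) : ℂ) := by
  rw [smul_eq_mul, show (a : ℂ) - 1 = ((a - 1 : ℝ) : ℂ) by push_cast; rfl,
    ← Complex.ofReal_cpow hu.le]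
  push_cast; ring

lemma mellin_log_pow_mul_exp (a : ℝ) (k : ℕ) :
    mellin (fun t : ℝ => ((Real.log t ^ k * Real.exp (-t) : ℝ) : ℂ)) a = logGammaMoment a k := by
  rw [mellin, logGammaMoment, ← integral_complex_ofReal]
  exact setIntegral_congr_fun measurableSet_Ioi fun u hu => ofReal_mellin_integrand hu k

lemma integrableOn_logGammaMoment {a : ℝ} (ha : 0 < a) (k : ℕ) :
    IntegrableOn (fun u : ℝ => u ^ (a - 1) * Real.exp (-u) * Real.log u ^ k) (Set.Ioi 0) := by
  have h := mellinConvergent_log_pow_mul_exp k (s := (a : ℂ)) (by simpa using ha)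
  have h2 := (integrableOn_congr_fun (fun u (hu : u ∈ Set.Ioi (0 : ℝ)) => ofReal_mellin_integrand hu k)
    measurableSet_Ioi).1 h
  have h3 := Integrable.re h2
  simp only [RCLike.re_to_complex, Complex.ofReal_re] at h3
  exact h3

lemma logGammaMoment_zero {a : ℝ} (ha : 0 < a) : logGammaMoment a 0 = Real.Gamma a := by
  rw [Real.Gamma_eq_integral ha, logGammaMoment]
  simp [mul_comm]

/-- Differentiating the Gamma integral twice under the integral sign turns the quotient rule for
`Γ'/Γ` into the variance of the logarithm of a Gamma variable of shape `a`. -/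
lemma trigamma_eq {a : ℝ} (ha : 0 < a) :
    trigamma a = logGammaMoment a 2 / Real.Gamma a - (logGammaMoment a 1 / Real.Gamma a) ^ 2 := by
  set M : ℕ → ℂ → ℂ := fun k => mellin (fun t : ℝ => ((Real.log t ^ k * Real.exp (-t) : ℝ) : ℂ))
  have hpos : 0 < (a : ℂ).re := by simpa using ha
  have hmem : ∀ᶠ z : ℂ in 𝓝 (a : ℂ), 0 < z.re :=
    (isOpen_lt continuous_const Complex.continuous_re).mem_nhds hpos
  have hG : ∀ z : ℂ, 0 < z.re → Complex.Gamma z = M 0 z := fun z hz => by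
    rw [Complex.Gamma_eq_integral hz, Complex.GammaIntegral_eq_mellin]
    simp [M]
  have hD : ∀ z : ℂ, 0 < z.re → HasDerivAt Complex.Gamma (M 1 z) z := fun z hz => by
    refine (hasDerivAt_mellin_log_pow_mul_exp 0 hz).2.congr_of_eventuallyEq ?_
    filter_upwards [(isOpen_lt continuous_const Complex.continuous_re).mem_nhds hz] with w hw
    exact hG w hw
  have h1 : Complex.digamma =ᶠ[𝓝 (a : ℂ)] fun z => M 1 z / M 0 z := by
    filter_upwards [hmem] with z hz
    rw [Complex.digamma_def, logDeriv_apply, (hD z hz).deriv, hG z hz]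
  have hne : M 0 a ≠ 0 := by
    rw [← hG _ hpos]
    exact Complex.Gamma_ne_zero_of_re_pos hpos
  have h2 := ((hasDerivAt_mellin_log_pow_mul_exp 1 hpos).2.div
    (hasDerivAt_mellin_log_pow_mul_exp 0 hpos).2 hne)
  have h3 := (h2.congr_of_eventuallyEq h1).deriv
  rw [trigamma, h3]
  simp only [mellin_log_pow_mul_exp]
  have hg : Real.Gamma a ≠ 0 := (Real.Gamma_pos_of_pos ha).ne'
  rw [logGammaMoment_zero ha]
  norm_cast
  field_simp

end LogGammaMoments

/-! ### The law of the squared norm of a standard Gaussian vector -/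

section StdGaussianNorm

variable {E : Type*} [NormedAddCommGroup E] [InnerProductSpace ℝ E] [FiniteDimensional ℝ E]
  [MeasurableSpace E] [BorelSpace E]

/-- The two measures are compared through their characteristic functions. The value of `K` can stay
hidden, since later the normalisation is recovered from the total mass. -/
lemma stdGaussian_eq_withDensity :
    ∃ K : ℝ, 0 < K ∧ stdGaussian E =
      (volume : Measure E).withDensity (fun x => ENNReal.ofReal (K * Real.exp (-(‖x‖ ^ 2 / 2)))) := by
  set K : ℝ := ((2 * Real.pi) ^ (Module.finrank ℝ E / 2 : ℝ))⁻¹ with hK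
  have hKpos : 0 < K := by positivity
  have hint : Integrable (fun x : E => K * Real.exp (-(‖x‖ ^ 2 / 2))) := by
    have := (GaussianFourier.integrable_cexp_neg_mul_sq_norm_add (V := E) (b := 1 / 2)
      (by norm_num) 0 0).norm
    refine (this.const_mul K).congr (Eventually.of_forall fun x => ?_)
    simp only [inner_zero_left, Complex.norm_exp]
    norm_num
    left
    norm_cast
    ring
  refine ⟨K, hKpos, ?_⟩
  have : IsFiniteMeasure ((volume : Measure E).withDensity
      (fun x => ENNReal.ofReal (K * Real.exp (-(‖x‖ ^ 2 / 2))))) :=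
    isFiniteMeasure_withDensity_ofReal hint.2
  refine Measure.ext_of_charFun ?_
  ext t
  rw [charFun_stdGaussian, charFun_apply, integral_withDensity_eq_integral_toReal_smul
    (by fun_prop) (Eventually.of_forall fun x => ENNReal.ofReal_lt_top)]
  have h := GaussianFourier.integral_cexp_neg_mul_sq_norm_add (V := E) (b := 1 / 2)
      (by norm_num) Complex.I t
  have e : ∀ x : E, (ENNReal.ofReal (K * Real.exp (-(‖x‖ ^ 2 / 2)))).toReal •
      Complex.exp ((inner ℝ x t : ℝ) * Complex.I) =
      (K : ℂ) * Complex.exp (-(1 / 2) * (‖x‖ : ℂ) ^ 2 + Complex.I * (inner ℝ t x : ℝ)) := fun x => by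
    rw [ENNReal.toReal_ofReal (by positivity), Complex.real_smul, Complex.exp_add,
      real_inner_comm]
    push_cast
    ring_nf
  rw [integral_congr_ae (Eventually.of_forall e), integral_const_mul, h, ← mul_assoc]
  have e2 : (K : ℂ) * (Real.pi / (1 / 2)) ^ (Module.finrank ℝ E / 2 : ℂ) = 1 := by
    have : ((Real.pi : ℂ) / (1 / 2)) = ((2 * Real.pi : ℝ) : ℂ) := by push_cast; ring
    rw [this, show (Module.finrank ℝ E / 2 : ℂ) = ((Module.finrank ℝ E / 2 : ℝ) : ℂ) by push_cast; rfl,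
      ← Complex.ofReal_cpow (by positivity), hK, ← Complex.ofReal_mul,
      inv_mul_cancel₀ (by positivity), Complex.ofReal_one]
  rw [e2, one_mul]
  congr 1
  rw [Complex.I_sq]
  ring

variable [Nontrivial E]

/-- Rewrites the radial integrand into the form required by the substitution `z = y²`. -/
lemma pow_finrank_smul_eq (φ : ℝ → ℝ) {y : ℝ} (hy : 0 < y) :
    y ^ (Module.finrank ℝ E - 1) • (Real.exp (-(y ^ 2 / 2)) * φ (y ^ 2)) =
      (|(2 : ℝ)| * y ^ ((2 : ℝ) - 1)) • ((fun z => 2⁻¹ * (z ^ ((Module.finrank ℝ E : ℝ) / 2 - 1) *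
        (Real.exp (-(2⁻¹ * z)) * φ z))) (y ^ (2 : ℝ))) := by
  have h1 : 1 ≤ Module.finrank ℝ E := Module.finrank_pos
  have h2 : y ^ (2 : ℝ) = y ^ 2 := by norm_cast
  have h3 : (y ^ 2) ^ ((Module.finrank ℝ E : ℝ) / 2 - 1) * y = y ^ (Module.finrank ℝ E - 1) := by
    rw [← h2, ← Real.rpow_mul hy.le, ← Real.rpow_natCast y (Module.finrank ℝ E - 1),
      ← Real.rpow_add_one hy.ne']
    congr 1
    push_cast [Nat.cast_sub h1]
    ring
  simp only [smul_eq_mul, h2]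
  rw [← h3, show (2 : ℝ) - 1 = 1 by norm_num, Real.rpow_one, abs_of_pos (by norm_num : (0 : ℝ) < 2),
    show y ^ 2 / 2 = 2⁻¹ * y ^ 2 by ring]
  ring

lemma half_mul_eq (a : ℝ) (φ : ℝ → ℝ) {u : ℝ} (hu : 0 < u) :
    (fun z => 2⁻¹ * (z ^ (a - 1) * (Real.exp (-(2⁻¹ * z)) * φ z))) (2 * u) =
      (2⁻¹ * 2 ^ (a - 1)) * (u ^ (a - 1) * Real.exp (-u) * φ (2 * u)) := by
  simp only
  rw [Real.mul_rpow (by norm_num) hu.le, show 2⁻¹ * (2 * u) = u by ring]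
  ring

/-- The squared norm of a standard Gaussian vector has twice a Gamma distribution. -/
lemma integral_stdGaussian_norm_sq (φ : ℝ → ℝ) :
    ∫ x, φ (‖x‖ ^ 2) ∂(stdGaussian E) = (Real.Gamma ((Module.finrank ℝ E : ℝ) / 2))⁻¹ *
      ∫ u in Set.Ioi 0, u ^ ((Module.finrank ℝ E : ℝ) / 2 - 1) * Real.exp (-u) * φ (2 * u) := by
  obtain ⟨K, hK, hd⟩ := stdGaussian_eq_withDensity (E := E)
  set a : ℝ := (Module.finrank ℝ E : ℝ) / 2 with ha
  have hapos : 0 < a := by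
    have : 0 < Module.finrank ℝ E := Module.finrank_pos
    positivity
  obtain ⟨K', hK'⟩ : ∃ K' : ℝ, ∀ φ : ℝ → ℝ, ∫ x, φ (‖x‖ ^ 2) ∂(stdGaussian E) =
      K' * ∫ u in Set.Ioi 0, u ^ (a - 1) * Real.exp (-u) * φ (2 * u) := by
    refine ⟨K * ((Module.finrank ℝ E : ℝ) * (volume : Measure E).real (Metric.ball 0 1)) *
      (2 * (2⁻¹ * 2 ^ (a - 1))), fun φ => ?_⟩
    rw [hd, integral_withDensity_eq_integral_toReal_smul
      (by fun_prop) (Eventually.of_forall fun x => ENNReal.ofReal_lt_top)]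
    have e : ∀ x : E, (ENNReal.ofReal (K * Real.exp (-(‖x‖ ^ 2 / 2)))).toReal • φ (‖x‖ ^ 2) =
        K * ((fun y => Real.exp (-(y ^ 2 / 2)) * φ (y ^ 2)) ‖x‖) := fun x => by
      rw [ENNReal.toReal_ofReal (by positivity), smul_eq_mul]
      ring
    rw [integral_congr_ae (Eventually.of_forall e), integral_const_mul,
      integral_fun_norm_addHaar (volume : Measure E) (fun y => Real.exp (-(y ^ 2 / 2)) * φ (y ^ 2)),
      setIntegral_congr_fun measurableSet_Ioi fun y hy => pow_finrank_smul_eq φ hy,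
      integral_comp_rpow_Ioi (fun z => 2⁻¹ * (z ^ (a - 1) *
        (Real.exp (-(2⁻¹ * z)) * φ z))) (two_ne_zero (α := ℝ))]
    have h2 := integral_comp_mul_left_Ioi' (fun z : ℝ => 2⁻¹ * (z ^ (a - 1) *
      (Real.exp (-(2⁻¹ * z)) * φ z))) 0 two_pos
    rw [mul_zero] at h2
    rw [← h2, setIntegral_congr_fun measurableSet_Ioi fun u hu => half_mul_eq a φ hu,
      integral_const_mul]
    simp only [smul_eq_mul, nsmul_eq_mul]
    ring
  -- The constant `K'` does not depend on `φ`; testing with `φ = 1` identifies it as `1 / Γ(a)`.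
  have h1 := hK' (fun _ => 1)
  have h0 := logGammaMoment_zero hapos
  simp only [logGammaMoment, pow_zero, mul_one] at h0
  simp only [mul_one, integral_const, probReal_univ, smul_eq_mul] at h1
  rw [h0] at h1
  rw [hK' φ, eq_inv_of_mul_eq_one_left h1.symm]

lemma integrable_stdGaussian_norm_sq {φ : ℝ → ℝ}
    (hφ : IntegrableOn (fun u => u ^ ((Module.finrank ℝ E : ℝ) / 2 - 1) * Real.exp (-u) * φ (2 * u))
      (Set.Ioi 0)) :
    Integrable (fun x => φ (‖x‖ ^ 2)) (stdGaussian E) := by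
  obtain ⟨K, hK, hd⟩ := stdGaussian_eq_withDensity (E := E)
  set a : ℝ := (Module.finrank ℝ E : ℝ) / 2 with ha
  rw [hd, integrable_withDensity_iff_integrable_smul'
      (by fun_prop) (Eventually.of_forall fun x => ENNReal.ofReal_lt_top)]
  have e : ∀ x : E, (ENNReal.ofReal (K * Real.exp (-(‖x‖ ^ 2 / 2)))).toReal • φ (‖x‖ ^ 2) =
      K * ((fun y => Real.exp (-(y ^ 2 / 2)) * φ (y ^ 2)) ‖x‖) := fun x => by
    rw [ENNReal.toReal_ofReal (by positivity), smul_eq_mul]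
    ring
  simp only [e]
  refine Integrable.const_mul ?_ K
  rw [integrable_fun_norm_addHaar (volume : Measure E)
      (f := fun y => Real.exp (-(y ^ 2 / 2)) * φ (y ^ 2)),
    integrableOn_congr_fun (g := fun y => (|(2 : ℝ)| * y ^ ((2 : ℝ) - 1)) • ((fun z => 2⁻¹ *
      (z ^ (a - 1) * (Real.exp (-(2⁻¹ * z)) * φ z))) (y ^ (2 : ℝ))))
      (fun y (hy : y ∈ Set.Ioi (0 : ℝ)) => pow_finrank_smul_eq φ hy) measurableSet_Ioi,
    integrableOn_Ioi_comp_rpow_iff (fun z => 2⁻¹ * (z ^ (a - 1) *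
        (Real.exp (-(2⁻¹ * z)) * φ z))) (two_ne_zero (α := ℝ))]
  have h2 := integrableOn_Ioi_comp_mul_left_iff (fun z : ℝ => 2⁻¹ * (z ^ (a - 1) *
      (Real.exp (-(2⁻¹ * z)) * φ z))) 0 two_pos
  rw [mul_zero] at h2
  rw [← h2, integrableOn_congr_fun (g := fun u => (2⁻¹ * 2 ^ (a - 1)) *
    (u ^ (a - 1) * Real.exp (-u) * φ (2 * u))) (fun u (hu : u ∈ Set.Ioi (0 : ℝ)) => half_mul_eq a φ hu) measurableSet_Ioi]
  exact hφ.const_mul _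

lemma integrable_log_norm_sq_pow (k : ℕ) :
    Integrable (fun x : E => Real.log (‖x‖ ^ 2 / 2) ^ k) (stdGaussian E) := by
  refine integrable_stdGaussian_norm_sq (φ := fun z => Real.log (z / 2) ^ k) ?_
  have hapos : 0 < (Module.finrank ℝ E : ℝ) / 2 := by
    have : 0 < Module.finrank ℝ E := Module.finrank_pos
    positivity
  simpa using integrableOn_logGammaMoment hapos k

lemma integral_log_norm_sq_pow (k : ℕ) :
    ∫ x : E, Real.log (‖x‖ ^ 2 / 2) ^ k ∂(stdGaussian E) =
      (Real.Gamma ((Module.finrank ℝ E : ℝ) / 2))⁻¹ *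
        logGammaMoment ((Module.finrank ℝ E : ℝ) / 2) k := by
  rw [integral_stdGaussian_norm_sq (fun z => Real.log (z / 2) ^ k), logGammaMoment]
  simp

lemma ae_ne_zero_stdGaussian : ∀ᵐ x ∂(stdGaussian E), x ≠ 0 := by
  obtain ⟨K, hK, hd⟩ := stdGaussian_eq_withDensity (E := E)
  have h : (volume : Measure E) {0} = 0 := measure_singleton 0
  have := withDensity_absolutelyContinuous (volume : Measure E)
    (fun x => ENNReal.ofReal (K * Real.exp (-(‖x‖ ^ 2 / 2)))) h
  rw [← hd] at this
  rw [ae_iff]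
  simpa using this

lemma log_norm_sq_ae_eq :
    (fun x : E => Real.log (‖x‖ ^ 2)) =ᵐ[stdGaussian E]
      fun x => Real.log (‖x‖ ^ 2 / 2) + Real.log 2 := by
  filter_upwards [ae_ne_zero_stdGaussian (E := E)] with x hx
  rw [Real.log_div (by positivity) two_ne_zero]
  ring

lemma memLp_log_norm_sq_stdGaussian :
    MemLp (fun x : E => Real.log (‖x‖ ^ 2)) 2 (stdGaussian E) := by
  rw [memLp_congr_ae log_norm_sq_ae_eq]
  refine MemLp.add ?_ (memLp_const _)
  rw [memLp_two_iff_integrable_sq (Measurable.aestronglyMeasurable (by measurability))]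
  exact integrable_log_norm_sq_pow 2

/-- The factor `1/2` that turns `‖x‖²` into a standard Gamma variable only shifts its logarithm,
hence does not affect the variance. -/
lemma variance_log_norm_sq_stdGaussian :
    Var[fun x : E => Real.log (‖x‖ ^ 2); stdGaussian E] =
      trigamma ((Module.finrank ℝ E : ℝ) / 2) := by
  have hapos : 0 < (Module.finrank ℝ E : ℝ) / 2 := by
    have : 0 < Module.finrank ℝ E := Module.finrank_pos
    positivity
  have hm : MemLp (fun x : E => Real.log (‖x‖ ^ 2 / 2)) 2 (stdGaussian E) := by
    rw [memLp_two_iff_integrable_sq (Measurable.aestronglyMeasurable (by measurability))]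
    exact integrable_log_norm_sq_pow 2
  rw [variance_congr log_norm_sq_ae_eq, variance_add_const hm.1, variance_eq_sub hm, trigamma_eq hapos]
  have h1 := integral_log_norm_sq_pow (E := E) 1
  simp only [pow_one] at h1
  simp only [Pi.pow_apply]
  rw [integral_log_norm_sq_pow, h1]
  ring

end StdGaussianNorm

/-! ### Cauchy–Schwarz for covariances -/

section SquareIntegrable

variable {Ω : Type*} [MeasurableSpace Ω] {P : Measure Ω} [IsProbabilityMeasure P]

/-- The quadratic polynomial `t ↦ Var (t U + V)` is nonnegative, so its discriminant is not
positive. -/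
lemma covariance_sq_le {U V : Ω → ℝ} (hU : MemLp U 2 P) (hV : MemLp V 2 P) :
    cov[U, V; P] ^ 2 ≤ Var[U; P] * Var[V; P] := by
  have h : ∀ t : ℝ, 0 ≤ Var[U; P] * (t * t) + (2 * cov[U, V; P]) * t + Var[V; P] := fun t => by
    have h1 := variance_nonneg (fun ω => t * U ω + V ω) P
    rw [variance_fun_add (hU.const_mul t) hV, variance_const_mul, covariance_const_mul_left] at h1
    linarith
  have := discrim_le_zero h
  rw [discrim] at this
  linarith

lemma abs_covariance_le_of_variance_le {U V : Ω → ℝ} (hU : MemLp U 2 P) (hV : MemLp V 2 P)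
    {a b : ℝ} (ha : 0 ≤ a) (hb : 0 ≤ b) (h1 : Var[U; P] ≤ a ^ 2) (h2 : Var[V; P] ≤ b ^ 2) :
    |cov[U, V; P]| ≤ a * b := by
  refine abs_le_of_sq_le_sq ?_ (by positivity)
  calc cov[U, V; P] ^ 2 ≤ Var[U; P] * Var[V; P] := covariance_sq_le hU hV
    _ ≤ a ^ 2 * b ^ 2 := mul_le_mul h1 h2 (variance_nonneg _ _) (by positivity)
    _ = (a * b) ^ 2 := by ring

lemma variance_le_sq_of_abs_le {U : Ω → ℝ} (hU : AEMeasurable U P) {a : ℝ}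
    (h : ∀ᵐ ω ∂P, |U ω| ≤ a) : Var[U; P] ≤ a ^ 2 := by
  have h1 := variance_le_sq_of_bounded (a := -a) (b := a) (X := U) (μ := P)
    (h.mono fun ω hω => abs_le.1 hω) hU
  calc _ ≤ _ := h1
    _ = a ^ 2 := by ring

end SquareIntegrable

/-! ### Logarithm of the squared norm of a general Gaussian vector -/

section GaussianVector

variable {ι : Type*} [Fintype ι] [DecidableEq ι]
  {Ω : Type*} [MeasurableSpace Ω] {P : Measure Ω} [IsProbabilityMeasure P]

lemma variance_inner_eq {Y : Ω → EuclideanSpace ℝ ι} (hY : HasGaussianLaw Y P)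
    (x : EuclideanSpace ℝ ι) :
    Var[fun ω => inner ℝ x (Y ω); P] =
      ∑ i, ∑ j, x i * x j * cov[fun ω => Y ω i, fun ω => Y ω j; P] := by
  have hL : ∀ i, MemLp (fun ω => Y ω i) 2 P := fun i =>
    (hY.map_fun (EuclideanSpace.proj (𝕜 := ℝ) i)).memLp_two
  have e : (fun ω => inner ℝ x (Y ω)) = fun ω => ∑ i, x i * Y ω i := by
    ext ω; simp [PiLp.inner_apply, mul_comm]
  have hae : AEMeasurable (fun ω => ∑ i, x i * Y ω i) P :=
    (memLp_finsetSum _ fun i _ => (hL i).const_mul (x i)).1.aemeasurable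
  rw [e, ← covariance_self hae, covariance_fun_sum_fun_sum (fun i => (hL i).const_mul _)
    (fun i => (hL i).const_mul _)]
  simp only [covariance_const_mul_left, covariance_const_mul_right]
  refine Finset.sum_congr rfl fun i _ => Finset.sum_congr rfl fun j _ => by ring

open scoped MatrixOrder in
/-- A centred Gaussian vector is a linear image of a standard one. -/
lemma exists_map_stdGaussian {Y : Ω → EuclideanSpace ℝ ι} (hY : HasGaussianLaw Y P)
    (hmean : ∀ x, ∫ ω, inner ℝ x (Y ω) ∂P = 0) :
    ∃ T : EuclideanSpace ℝ ι →L[ℝ] EuclideanSpace ℝ ι,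
      P.map Y = (stdGaussian (EuclideanSpace ℝ ι)).map T ∧
      ∀ x, ‖T x‖ ^ 2 = Var[fun ω => inner ℝ x (Y ω); P] := by
  set S : Matrix ι ι ℝ := Matrix.of fun i j => cov[fun ω => Y ω i, fun ω => Y ω j; P] with hS
  have hquad : ∀ x : EuclideanSpace ℝ ι, x.ofLp ⬝ᵥ S.mulVec x.ofLp = Var[fun ω => inner ℝ x (Y ω); P] :=
    fun x => by
      rw [variance_inner_eq hY]
      simp only [dotProduct, Matrix.mulVec, hS, Finset.mul_sum, Matrix.of_apply]
      refine Finset.sum_congr rfl fun i _ => Finset.sum_congr rfl fun j _ => by ring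
  have hpsd : S.PosSemidef := by
    refine Matrix.PosSemidef.of_dotProduct_mulVec_nonneg ?_ fun x => ?_
    · ext i j
      rw [Matrix.conjTranspose_apply, hS, Matrix.of_apply, Matrix.of_apply, covariance_comm,
        star_trivial]
    · have := hquad (WithLp.toLp 2 x)
      simp only [star_trivial]
      rw [this]
      exact variance_nonneg _ _
  -- The square root of the covariance matrix is self-adjoint, so `‖T x‖²` is the variance form
  -- itself. A bound on that form then compares `‖T x‖²` with `‖x‖²` point by point.
  refine ⟨Matrix.toEuclideanCLM (𝕜 := ℝ) (CFC.sqrt S), ?_, fun x => ?_⟩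
  · have : (stdGaussian (EuclideanSpace ℝ ι)).map (Matrix.toEuclideanCLM (𝕜 := ℝ) (CFC.sqrt S)) =
        multivariateGaussian 0 S := by
      simp [multivariateGaussian]
    rw [this]
    have := hY.isGaussian_map
    refine Measure.ext_of_charFun ?_
    ext t
    rw [hY.charFun_map_eq, charFun_multivariateGaussian hpsd, hmean, hquad]
    simp
  · have hsa : IsSelfAdjoint (Matrix.toEuclideanCLM (𝕜 := ℝ) (CFC.sqrt S)) :=
      (CFC.sqrt_nonneg S).isSelfAdjoint.map _
    rw [← real_inner_self_eq_norm_sq, ← hquad, ← ContinuousLinearMap.adjoint_inner_right,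
      hsa.adjoint_eq, ← ContinuousLinearMap.comp_apply, ← ContinuousLinearMap.mul_def, ← map_mul,
      CFC.sqrt_mul_sqrt_self _ hpsd.nonneg, Matrix.inner_toEuclideanCLM]

variable [Nonempty ι]

/-- The mean of the logarithm of the squared norm of a standard Gaussian vector. -/
noncomputable def meanLogNormSq (ι : Type*) [Fintype ι] : ℝ :=
  ∫ x, Real.log (‖x‖ ^ 2) ∂(stdGaussian (EuclideanSpace ℝ ι))

/-- Both directions use `log t ≤ t - 1`; the condition `ρ ≤ 1/2` gives `a / b ≤ 1 / (1 - ρ) ≤ 1 +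
2ρ`. -/
lemma abs_log_sub_log_le {ρ a b : ℝ} (hρ : ρ ≤ 1 / 2) (ha : 0 < a) (h : |b - a| ≤ ρ * a) :
    0 < b ∧ |Real.log b - Real.log a| ≤ 2 * ρ := by
  have hρ0 : 0 ≤ ρ := by
    by_contra hneg
    push Not at hneg
    have := abs_nonneg (b - a)
    nlinarith
  obtain ⟨h1, h2⟩ := abs_le.1 h
  have hb : 0 < b := by nlinarith
  refine ⟨hb, abs_le.2 ⟨?_, ?_⟩⟩
  · have h3 := Real.log_le_sub_one_of_pos (div_pos ha hb)
    rw [Real.log_div ha.ne' hb.ne'] at h3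
    have h4 : a / b ≤ 1 + 2 * ρ := by
      rw [div_le_iff₀ hb]
      nlinarith
    linarith
  · have h3 := Real.log_le_sub_one_of_pos (div_pos hb ha)
    rw [Real.log_div hb.ne' ha.ne'] at h3
    have h4 : b / a ≤ 1 + ρ := by
      rw [div_le_iff₀ ha]
      nlinarith
    linarith

/-- If the covariance matrix of a centred Gaussian vector is close to the identity, then the
logarithm of its squared norm has nearly the same mean and variance as for a standard one. -/
lemma log_norm_sq_of_variance_near {Y : Ω → EuclideanSpace ℝ ι} (hY : HasGaussianLaw Y P)
    (hmean : ∀ x, ∫ ω, inner ℝ x (Y ω) ∂P = 0) {ρ : ℝ} (hρ : ρ ≤ 1 / 2)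
    (hvar : ∀ x, |Var[fun ω => inner ℝ x (Y ω); P] - ‖x‖ ^ 2| ≤ ρ * ‖x‖ ^ 2) :
    (∀ᵐ ω ∂P, 0 < ‖Y ω‖ ^ 2) ∧
    MemLp (fun ω => Real.log (‖Y ω‖ ^ 2)) 2 P ∧
    |∫ ω, Real.log (‖Y ω‖ ^ 2) ∂P - meanLogNormSq ι| ≤ 2 * ρ ∧
    |Var[fun ω => Real.log (‖Y ω‖ ^ 2); P] - trigamma ((Fintype.card ι : ℝ) / 2)| ≤
      (4 * √(trigamma ((Fintype.card ι : ℝ) / 2)) + 2) * ρ := by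
  obtain ⟨T, hT, hTn⟩ := exists_map_stdGaussian hY hmean
  set γ := stdGaussian (EuclideanSpace ℝ ι)
  have hvarγ := variance_log_norm_sq_stdGaussian (E := EuclideanSpace ℝ ι)
  rw [finrank_euclideanSpace] at hvarγ
  have hLγ := memLp_log_norm_sq_stdGaussian (E := EuclideanSpace ℝ ι)
  have hYm : AEMeasurable Y P := hY.aemeasurable
  have hTm : Measurable T := T.continuous.measurable
  have hlm : Measurable fun x : EuclideanSpace ℝ ι => Real.log (‖x‖ ^ 2) := by measurability
  have hρ0 : 0 ≤ ρ := by
    obtain ⟨x, hx⟩ := exists_ne (0 : EuclideanSpace ℝ ι)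
    have h1 : 0 < ‖x‖ ^ 2 := by positivity
    have h2 := (abs_nonneg _).trans (hvar x)
    by_contra hneg
    push Not at hneg
    nlinarith
  -- A coupling: `Y` has the law of `T N`, and the logarithms for `T N` and for `N` differ by at
  -- most `2ρ` almost surely. Every conclusion follows from this.
  have hδ : ∀ᵐ x ∂γ, 0 < ‖T x‖ ^ 2 ∧
      |Real.log (‖T x‖ ^ 2) - Real.log (‖x‖ ^ 2)| ≤ 2 * ρ := by
    filter_upwards [ae_ne_zero_stdGaussian (E := EuclideanSpace ℝ ι)] with x hx
    refine abs_log_sub_log_le hρ (by positivity) ?_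
    rw [hTn]
    exact hvar x
  set δ : EuclideanSpace ℝ ι → ℝ := fun x => Real.log (‖T x‖ ^ 2) - Real.log (‖x‖ ^ 2) with hδdef
  have hδm : Measurable δ := (hlm.comp hTm).sub hlm
  have hδL : MemLp δ 2 γ := MemLp.of_bound hδm.aestronglyMeasurable (2 * ρ) (hδ.mono fun x hx => hx.2)
  have hsum : (fun x => Real.log (‖T x‖ ^ 2)) = fun x => Real.log (‖x‖ ^ 2) + δ x := by
    ext x; simp [hδdef]
  have hTL : MemLp (fun x => Real.log (‖T x‖ ^ 2)) 2 γ := by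
    rw [hsum]; exact hLγ.add hδL
  have hmem : MemLp (fun x => Real.log (‖x‖ ^ 2)) 2 (γ.map T) :=
    (memLp_map_measure_iff hlm.aestronglyMeasurable hTm.aemeasurable).2 hTL
  have hint : ∫ ω, Real.log (‖Y ω‖ ^ 2) ∂P = ∫ x, Real.log (‖T x‖ ^ 2) ∂γ := by
    rw [← integral_map hTm.aemeasurable hlm.aestronglyMeasurable, ← hT,
      integral_map hYm hlm.aestronglyMeasurable]
  have hV : Var[fun ω => Real.log (‖Y ω‖ ^ 2); P] = Var[fun x => Real.log (‖T x‖ ^ 2); γ] := by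
    have h1 := variance_map (μ := P) (Y := Y) (X := fun x => Real.log (‖x‖ ^ 2)) (by fun_prop) hYm
    have h2 := variance_map (μ := γ) (Y := T) (X := fun x => Real.log (‖x‖ ^ 2)) (by fun_prop)
      hTm.aemeasurable
    rw [hT, h2] at h1
    exact h1.symm
  refine ⟨?_, ?_, ?_, ?_⟩
  · have h1 : ∀ᵐ x ∂(γ.map T), 0 < ‖x‖ ^ 2 :=
      (ae_map_iff hTm.aemeasurable (measurableSet_lt measurable_const (by fun_prop))).2
        (hδ.mono fun x hx => hx.1)
    rw [← hT] at h1
    exact (ae_map_iff hYm (measurableSet_lt measurable_const (by fun_prop))).1 h1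
  · rw [← hT] at hmem
    exact (memLp_map_measure_iff hlm.aestronglyMeasurable hYm).1 hmem
  · rw [hint, hsum, integral_add (hLγ.integrable one_le_two) (hδL.integrable one_le_two),
      meanLogNormSq, add_sub_cancel_left, ← Real.norm_eq_abs]
    refine (norm_integral_le_of_norm_le_const (C := 2 * ρ) (hδ.mono fun x hx => hx.2)).trans ?_
    simp
  · have h0 := variance_nonneg (fun x : EuclideanSpace ℝ ι => Real.log (‖x‖ ^ 2)) γ
    rw [hvarγ] at h0
    have hδV : Var[δ; γ] ≤ (2 * ρ) ^ 2 :=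
      variance_le_sq_of_abs_le hδm.aemeasurable (hδ.mono fun x hx => hx.2)
    -- The variance changes by `2 cov + Var δ`. The first term is at most `4 √ψ' ρ` by
    -- Cauchy–Schwarz, with `ψ'` the trigamma value, and the second at most `4ρ² ≤ 2ρ`.
    have hcov := abs_covariance_le_of_variance_le hLγ hδL (Real.sqrt_nonneg _)
      (by positivity : (0 : ℝ) ≤ 2 * ρ) (by rw [hvarγ, Real.sq_sqrt h0]) hδV
    rw [hV, hsum, variance_fun_add hLγ hδL, hvarγ]
    have hδV0 := variance_nonneg δ γ
    have e : trigamma ((Fintype.card ι : ℝ) / 2) +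
        2 * cov[fun x : EuclideanSpace ℝ ι => Real.log (‖x‖ ^ 2), δ; γ] + Var[δ; γ] -
        trigamma ((Fintype.card ι : ℝ) / 2) =
        2 * cov[fun x : EuclideanSpace ℝ ι => Real.log (‖x‖ ^ 2), δ; γ] + Var[δ; γ] := by ring
    rw [e]
    refine (abs_add_le _ _).trans ?_
    rw [abs_mul, abs_of_pos (two_pos : (0 : ℝ) < 2), abs_of_nonneg hδV0]
    nlinarith

lemma stdGaussian_real : stdGaussian ℝ = gaussianReal 0 1 := by
  refine Measure.ext_of_charFun ?_
  ext t
  rw [charFun_stdGaussian, charFun_gaussianReal, Real.norm_eq_abs, ← Complex.ofReal_pow, sq_abs]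
  simp
  ring_nf

/-- Writing `U` in law as `σ N` splits its log square into `log σ²`, controlled by `c ≤ σ² ≤ B`, and
the fixed variable `log N²`. -/
lemma log_sq_of_hasGaussianLaw {U : Ω → ℝ} (hU : HasGaussianLaw U P) (hmean : ∫ ω, U ω ∂P = 0)
    {c B : ℝ} (hc : 0 < c) (hi : c ≤ Var[U; P]) (hB : Var[U; P] ≤ B) :
    (∀ᵐ ω ∂P, U ω ≠ 0) ∧ MemLp (fun ω => Real.log (U ω ^ 2)) 2 P ∧
      ∫ ω, Real.log (U ω ^ 2) ^ 2 ∂P ≤ 2 * (Real.log c ^ 2 + Real.log B ^ 2) +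
        2 * ∫ x : ℝ, Real.log (‖x‖ ^ 2) ^ 2 ∂(stdGaussian ℝ) := by
  set σ := √(Var[U; P]) with hσ
  have hV : 0 < Var[U; P] := hc.trans_le hi
  have hσpos : 0 < σ := Real.sqrt_pos.2 hV
  have hσ2 : σ ^ 2 = Var[U; P] := Real.sq_sqrt hV.le
  have hlaw : P.map U = (stdGaussian ℝ).map (fun x => σ * x) := by
    rw [hU.map_eq_gaussianReal, stdGaussian_real, gaussianReal_map_const_mul, hmean, mul_zero]
    congr 1
    rw [mul_one]
    ext
    rw [Real.coe_toNNReal _ hV.le]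
    exact hσ2.symm
  have hUm : AEMeasurable U P := hU.aemeasurable
  have hlm : Measurable fun x : ℝ => Real.log (x ^ 2) := by measurability
  have hLγ := memLp_log_norm_sq_stdGaussian (E := ℝ)
  have hae : ∀ᵐ x ∂(stdGaussian ℝ), Real.log ((σ * x) ^ 2) = Real.log (σ ^ 2) + Real.log (‖x‖ ^ 2) := by
    filter_upwards [ae_ne_zero_stdGaussian (E := ℝ)] with x hx
    rw [mul_pow, Real.log_mul (by positivity) (by positivity), Real.norm_eq_abs, sq_abs]
  have hσL : MemLp (fun x : ℝ => Real.log ((σ * x) ^ 2)) 2 (stdGaussian ℝ) := by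
    rw [memLp_congr_ae hae]
    have h1 : MemLp (fun _ : ℝ => Real.log (σ ^ 2)) 2 (stdGaussian ℝ) := memLp_const _
    exact h1.add hLγ
  have hmulm : Measurable fun x : ℝ => σ * x := by fun_prop
  refine ⟨?_, ?_, ?_⟩
  · have h1 : ∀ᵐ x ∂((stdGaussian ℝ).map (fun x => σ * x)), x ≠ 0 := by
      refine (ae_map_iff hmulm.aemeasurable (measurableSet_singleton (0 : ℝ)).compl).2 ?_
      filter_upwards [ae_ne_zero_stdGaussian (E := ℝ)] with x hx
      exact mul_ne_zero hσpos.ne' hx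
    rw [← hlaw] at h1
    exact (ae_map_iff hUm (measurableSet_singleton (0 : ℝ)).compl).1 h1
  · have h1 : MemLp (fun x : ℝ => Real.log (x ^ 2)) 2 ((stdGaussian ℝ).map (fun x => σ * x)) :=
      (memLp_map_measure_iff hlm.aestronglyMeasurable hmulm.aemeasurable).2 hσL
    rw [← hlaw] at h1
    exact (memLp_map_measure_iff hlm.aestronglyMeasurable hUm).1 h1
  · have hiI : ∫ ω, Real.log (U ω ^ 2) ^ 2 ∂P = ∫ x, Real.log ((σ * x) ^ 2) ^ 2 ∂(stdGaussian ℝ) := by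
      have hm2 : Measurable fun y : ℝ => Real.log (y ^ 2) ^ 2 := hlm.pow_const 2
      rw [← integral_map (φ := fun x => σ * x) hmulm.aemeasurable hm2.aestronglyMeasurable, ← hlaw,
        integral_map hUm hm2.aestronglyMeasurable]
    rw [hiI]
    have hlog : Real.log (σ ^ 2) ^ 2 ≤ Real.log c ^ 2 + Real.log B ^ 2 := by
      rw [hσ2]
      have h1 := Real.log_le_log hc hi
      have h2 := Real.log_le_log hV hB
      rcases le_total 0 (Real.log (Var[U; P])) with h | h
      · nlinarith [sq_nonneg (Real.log c)]
      · nlinarith [sq_nonneg (Real.log B)]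
    have hIsq := hLγ.integrable_sq
    calc ∫ x, Real.log ((σ * x) ^ 2) ^ 2 ∂(stdGaussian ℝ)
        ≤ ∫ x, (2 * (Real.log c ^ 2 + Real.log B ^ 2) + 2 * Real.log (‖x‖ ^ 2) ^ 2) ∂(stdGaussian ℝ) := by
          refine integral_mono_ae hσL.integrable_sq
            ((integrable_const _).add (hIsq.const_mul 2)) (hae.mono fun x hx => ?_)
          simp only
          rw [hx]
          nlinarith [sq_nonneg (Real.log (σ ^ 2) - Real.log (‖x‖ ^ 2))]
      _ = _ := by
          rw [integral_add (integrable_const _) (hIsq.const_mul 2), integral_const,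
            probReal_univ, one_smul, integral_const_mul]

/-- A bound for the second moment of the logarithm of the squared norm of a Gaussian vector having
one nondegenerate coordinate. -/
lemma exists_bound_log_norm_sq (ι : Type*) [Fintype ι] {c B : ℝ} (hc : 0 < c) :
    ∃ C : ℝ, ∀ (Y : Ω → EuclideanSpace ℝ ι), HasGaussianLaw Y P →
      (∀ i, ∫ ω, Y ω i ∂P = 0) → (∃ i, c ≤ Var[fun ω => Y ω i; P]) →
      (∀ i, Var[fun ω => Y ω i; P] ≤ B) →
      (∀ᵐ ω ∂P, 0 < ‖Y ω‖ ^ 2) ∧ MemLp (fun ω => Real.log (‖Y ω‖ ^ 2)) 2 P ∧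
      ∫ ω, Real.log (‖Y ω‖ ^ 2) ^ 2 ∂P ≤ C := by
  set M := ∫ x : ℝ, Real.log (‖x‖ ^ 2) ^ 2 ∂(stdGaussian ℝ) with hM
  refine ⟨2 * (Real.log c ^ 2 + Real.log B ^ 2) + 2 * M + 4 * (Fintype.card ι * B),
    fun Y hY hmean ⟨i, hi⟩ hB => ?_⟩
  have hYi : ∀ j, HasGaussianLaw (fun ω => Y ω j) P := fun j =>
    hY.map_fun (EuclideanSpace.proj (𝕜 := ℝ) j)
  have hYm : AEMeasurable Y P := hY.aemeasurable
  obtain ⟨hne, hiL, hiB⟩ := log_sq_of_hasGaussianLaw (hYi i) (hmean i) hc hi (hB i)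
  rw [← hM] at hiB
  have hle : ∀ ω, Y ω i ^ 2 ≤ ‖Y ω‖ ^ 2 := fun ω => by
    rw [EuclideanSpace.real_norm_sq_eq]
    exact Finset.single_le_sum (f := fun j => Y ω j ^ 2) (fun j _ => sq_nonneg _) (Finset.mem_univ i)
  -- When the logarithm is negative, the nondegenerate coordinate bounds it from below; when it is
  -- positive, it is at most `2 ‖Y‖`. The covariance matrix need not be near the identity.
  have hpt : ∀ᵐ ω ∂P, Real.log (‖Y ω‖ ^ 2) ^ 2 ≤ Real.log (Y ω i ^ 2) ^ 2 + 4 * ‖Y ω‖ ^ 2 := by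
    filter_upwards [hne] with ω hω
    have h0 : 0 < Y ω i ^ 2 := by positivity
    have h1 := Real.log_le_log h0 (hle ω)
    have hn : 0 < ‖Y ω‖ := by
      have := h0.trans_le (hle ω)
      by_contra hcon
      have : ‖Y ω‖ = 0 := le_antisymm (not_lt.1 hcon) (norm_nonneg _)
      simp [this] at *
    rcases le_total 0 (Real.log (‖Y ω‖ ^ 2)) with h | h
    · have h2 : Real.log (‖Y ω‖ ^ 2) = 2 * Real.log ‖Y ω‖ := by simp [Real.log_pow]
      have h3 := Real.log_le_sub_one_of_pos hn
      have h4 : Real.log (‖Y ω‖ ^ 2) ^ 2 ≤ (2 * ‖Y ω‖) ^ 2 :=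
        pow_le_pow_left₀ h (by linarith) 2
      nlinarith [sq_nonneg (Real.log (Y ω i ^ 2))]
    · nlinarith [sq_nonneg ‖Y ω‖]
  have hjL : ∀ j, MemLp (fun ω => Y ω j) 2 P := fun j => (hYi j).memLp_two
  have hnI : Integrable (fun ω => ‖Y ω‖ ^ 2) P := by
    simp only [EuclideanSpace.real_norm_sq_eq]
    exact integrable_finsetSum _ fun j _ => (hjL j).integrable_sq
  have hnB : ∫ ω, ‖Y ω‖ ^ 2 ∂P ≤ Fintype.card ι * B := by
    simp only [EuclideanSpace.real_norm_sq_eq]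
    rw [integral_finsetSum _ fun j _ => (hjL j).integrable_sq]
    calc ∑ j, ∫ ω, Y ω j ^ 2 ∂P ≤ ∑ _j : ι, B := by
          refine Finset.sum_le_sum fun j _ => ?_
          have := variance_of_integral_eq_zero (hYi j).aemeasurable (hmean j)
          exact this.symm.trans_le (hB j)
      _ = _ := by simp
  have hLm : AEStronglyMeasurable (fun ω => Real.log (‖Y ω‖ ^ 2)) P := by
    have : Measurable fun x : EuclideanSpace ℝ ι => Real.log (‖x‖ ^ 2) := by measurability
    exact (this.comp_aemeasurable hYm).aestronglyMeasurable
  have hdom : Integrable (fun ω => Real.log (Y ω i ^ 2) ^ 2 + 4 * ‖Y ω‖ ^ 2) P :=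
    hiL.integrable_sq.add (hnI.const_mul 4)
  have hLL : MemLp (fun ω => Real.log (‖Y ω‖ ^ 2)) 2 P := by
    rw [memLp_two_iff_integrable_sq hLm]
    refine hdom.mono' (hLm.pow 2) (hpt.mono fun ω hω => ?_)
    rw [Real.norm_eq_abs, abs_of_nonneg (sq_nonneg _)]
    exact hω
  refine ⟨hne.mono fun ω hω => lt_of_lt_of_le (by positivity) (hle ω), hLL, ?_⟩
  calc ∫ ω, Real.log (‖Y ω‖ ^ 2) ^ 2 ∂P
      ≤ ∫ ω, (Real.log (Y ω i ^ 2) ^ 2 + 4 * ‖Y ω‖ ^ 2) ∂P :=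
        integral_mono_ae hLL.integrable_sq hdom hpt
    _ = ∫ ω, Real.log (Y ω i ^ 2) ^ 2 ∂P + 4 * ∫ ω, ‖Y ω‖ ^ 2 ∂P := by
        rw [integral_add hiL.integrable_sq (hnI.const_mul 4), integral_const_mul]
    _ ≤ _ := by linarith

end GaussianVector

/-! ### Gaussian arrays with nearly orthonormal covariance -/

section NearOrthonormalArray

variable {ι : Type*} [Fintype ι] [DecidableEq ι]
  {Ω : Type*} [MeasurableSpace Ω] {P : Measure Ω} [IsProbabilityMeasure P]

lemma sum_abs_le_sqrt_card_mul_norm (x : EuclideanSpace ℝ ι) :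
    ∑ i, |x i| ≤ √(Fintype.card ι) * ‖x‖ := by
  refine abs_le_of_sq_le_sq' ?_ (by positivity) |>.2
  have := sq_sum_le_card_mul_sum_sq (s := Finset.univ) (f := fun i => |x i|)
  rw [mul_pow, Real.sq_sqrt (by positivity), EuclideanSpace.real_norm_sq_eq]
  simpa using this

/-- Passing from an entrywise bound to a bilinear form costs a factor `√card` in each variable, by
Cauchy–Schwarz. -/
lemma abs_sum_sum_le {a : ι → ι → ℝ} {r : ℝ} (ha : ∀ i j, |a i j| ≤ r)
    (x y : EuclideanSpace ℝ ι) :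
    |∑ i, ∑ j, x i * y j * a i j| ≤ Fintype.card ι * r * ‖x‖ * ‖y‖ := by
  by_cases hι : IsEmpty ι
  · simp
  have hr : 0 ≤ r := by
    rw [not_isEmpty_iff] at hι
    exact (abs_nonneg _).trans (ha hι.some hι.some)
  calc |∑ i, ∑ j, x i * y j * a i j| ≤ ∑ i, ∑ j, |x i| * |y j| * r := by
        refine (Finset.abs_sum_le_sum_abs _ _).trans (Finset.sum_le_sum fun i _ => ?_)
        refine (Finset.abs_sum_le_sum_abs _ _).trans (Finset.sum_le_sum fun j _ => ?_)
        rw [abs_mul, abs_mul]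
        exact mul_le_mul_of_nonneg_left (ha i j) (by positivity)
    _ = r * ((∑ i, |x i|) * ∑ j, |y j|) := by
        rw [Finset.sum_mul_sum, Finset.mul_sum]
        refine Finset.sum_congr rfl fun i _ => ?_
        rw [Finset.mul_sum]
        exact Finset.sum_congr rfl fun j _ => by ring
    _ ≤ r * ((√(Fintype.card ι) * ‖x‖) * (√(Fintype.card ι) * ‖y‖)) := by
        refine mul_le_mul_of_nonneg_left ?_ hr
        exact mul_le_mul (sum_abs_le_sqrt_card_mul_norm x) (sum_abs_le_sqrt_card_mul_norm y)
          (by positivity) (by positivity)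
    _ = (√(Fintype.card ι) * √(Fintype.card ι)) * r * ‖x‖ * ‖y‖ := by ring
    _ = _ := by rw [Real.mul_self_sqrt (by positivity)]

variable {κ : Type*} {Z : κ → ι → Ω → ℝ}

/-- The vector in Euclidean space with the coordinates `Z k i`, `i : ι`. -/
noncomputable def arrayVector (Z : κ → ι → Ω → ℝ) (k : κ) (ω : Ω) : EuclideanSpace ℝ ι :=
  WithLp.toLp 2 (fun i => Z k i ω)

lemma hasGaussianLaw_arrayVector (hZ : IsGaussianProcess (fun p : κ × ι => Z p.1 p.2) P) (k : κ) :
    HasGaussianLaw (arrayVector Z k) P := by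
  have h := hZ.comp_right (fun i : ι => (k, i))
  have h1 : HasGaussianLaw (fun ω => fun i : ι => Z k i ω) P := by
    have h2 := h.hasGaussianLaw Finset.univ
    exact h2.map_fun (ContinuousLinearMap.pi fun i : ι =>
      ContinuousLinearMap.proj (R := ℝ) (⟨i, Finset.mem_univ i⟩ : (Finset.univ : Finset ι)))
  exact h1.toLp_pi 2

lemma integral_inner_arrayVector (hZ : IsGaussianProcess (fun p : κ × ι => Z p.1 p.2) P)
    (hmean : ∀ k i, ∫ ω, Z k i ω ∂P = 0) (k : κ) (x : EuclideanSpace ℝ ι) :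
    ∫ ω, inner ℝ x (arrayVector Z k ω) ∂P = 0 := by
  have e : ∀ ω, inner ℝ x (arrayVector Z k ω) = ∑ i, x i * Z k i ω := fun ω => by
    simp [PiLp.inner_apply, arrayVector, mul_comm]
  simp only [e]
  rw [integral_finsetSum _ fun i _ => ((hZ.hasGaussianLaw_eval (k, i)).integrable).const_mul _]
  simp [integral_const_mul, hmean]

lemma abs_variance_inner_arrayVector_sub_le
    (hZ : IsGaussianProcess (fun p : κ × ι => Z p.1 p.2) P) {k : κ} {r : ℝ}
    (hcov : ∀ i i', |cov[Z k i, Z k i'; P] - (if i = i' then 1 else 0)| ≤ r)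
    (x : EuclideanSpace ℝ ι) :
    |Var[fun ω => inner ℝ x (arrayVector Z k ω); P] - ‖x‖ ^ 2| ≤ Fintype.card ι * r * ‖x‖ ^ 2 := by
  have e : ‖x‖ ^ 2 = ∑ i, ∑ j, x i * x j * (if i = j then (1 : ℝ) else 0) := by
    rw [EuclideanSpace.real_norm_sq_eq]
    simp [sq]
  rw [variance_inner_eq (hasGaussianLaw_arrayVector hZ k)]
  have h := abs_sum_sum_le hcov x x
  have e2 : ∑ i, ∑ j, x i * x j * cov[Z k i, Z k j; P] - ‖x‖ ^ 2 =
      ∑ i, ∑ j, x i * x j * (cov[Z k i, Z k j; P] - (if i = j then 1 else 0)) := by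
    rw [e, ← Finset.sum_sub_distrib]
    refine Finset.sum_congr rfl fun i _ => ?_
    rw [← Finset.sum_sub_distrib]
    exact Finset.sum_congr rfl fun j _ => by ring
  rw [← e2] at h
  calc _ ≤ _ := h
    _ = _ := by ring

lemma charFun_arrayVector_pair (hZ : IsGaussianProcess (fun p : κ × ι => Z p.1 p.2) P)
    (hmean : ∀ k i, ∫ ω, Z k i ω ∂P = 0) (j k : κ) (x y : EuclideanSpace ℝ ι) :
    ∫ ω, Complex.exp (((inner ℝ x (arrayVector Z j ω) + inner ℝ y (arrayVector Z k ω) : ℝ) : ℂ) *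
      Complex.I) ∂P =
    Complex.exp (-((Var[fun ω => inner ℝ x (arrayVector Z j ω); P] +
      Var[fun ω => inner ℝ y (arrayVector Z k ω); P]) / 2 +
      ∑ i, ∑ i', x i * y i' * cov[Z j i, Z k i'; P] : ℝ)) := by
  have hL : ∀ k i, MemLp (Z k i) 2 P := fun k i => (hZ.hasGaussianLaw_eval (k, i)).memLp_two
  have e : ∀ (x : EuclideanSpace ℝ ι) k, (fun ω => inner ℝ x (arrayVector Z k ω)) =
      fun ω => ∑ i, x i * Z k i ω := fun x k => by
    ext ω
    simp [PiLp.inner_apply, arrayVector, mul_comm]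
  have hLx : ∀ (x : EuclideanSpace ℝ ι) k, MemLp (fun ω => inner ℝ x (arrayVector Z k ω)) 2 P :=
    fun x k => by rw [e]; exact memLp_finsetSum _ fun i _ => (hL k i).const_mul (x i)
  set U : Ω → ℝ := fun ω => inner ℝ x (arrayVector Z j ω) + inner ℝ y (arrayVector Z k ω) with hU
  have hUg : HasGaussianLaw U P := by
    -- Indexing by `Bool × ι` merges the two vectors into one finite family, so that joint
    -- Gaussianity of the process applies to the sum of the two inner products.
    have h := ((hZ.comp_right (fun p : Bool × ι => (cond p.1 j k, p.2))).smul
      (fun p => cond p.1 (x p.2) (y p.2))).hasGaussianLaw_fun_sum (I := Finset.univ)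
    convert! h using 2
    rename_i ω
    rw [Fintype.sum_prod_type, Fintype.sum_bool]
    have e1 := congrFun (e x j) ω
    have e2 := congrFun (e y k) ω
    simp only at e1 e2
    rw [hU]
    simp only [e1, e2, cond_true, cond_false, Function.comp, smul_eq_mul]
  have hUmean : ∫ ω, U ω ∂P = 0 := by
    rw [hU, integral_add ((hLx x j).integrable one_le_two) ((hLx y k).integrable one_le_two),
      integral_inner_arrayVector hZ hmean, integral_inner_arrayVector hZ hmean, add_zero]
  have hUvar : Var[U; P] = Var[fun ω => inner ℝ x (arrayVector Z j ω); P] +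
      2 * ∑ i, ∑ i', x i * y i' * cov[Z j i, Z k i'; P] +
      Var[fun ω => inner ℝ y (arrayVector Z k ω); P] := by
    rw [hU, variance_fun_add (hLx x j) (hLx y k)]
    congr 2
    rw [e x j, e y k, covariance_fun_sum_fun_sum (fun i => (hL j i).const_mul _)
      (fun i => (hL k i).const_mul _)]
    simp only [covariance_const_mul_left, covariance_const_mul_right]
    congr 1
    refine Finset.sum_congr rfl fun i _ => Finset.sum_congr rfl fun j _ => by ring
  have h := hUg.charFun_map_eq 1
  rw [charFun_apply_real, integral_map hUg.aemeasurable (by fun_prop)] at h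
  simp only [Complex.ofReal_one, one_mul, RCLike.inner_apply, map_one, mul_one] at h
  rw [h, hUmean, hUvar]
  congr 1
  push_cast
  ring

/-- The logarithms of the squared norms of two vectors of a Gaussian array. -/
lemma abs_covariance_log_arrayVector_le [Nonempty ι]
    (hZ : IsGaussianProcess (fun p : κ × ι => Z p.1 p.2) P)
    (hmean : ∀ k i, ∫ ω, Z k i ω ∂P = 0) {j k : κ} {r₀ r : ℝ}
    (hr₀ : Fintype.card ι * r₀ ≤ 1 / 2) (hr : Fintype.card ι * r ≤ 1 / 4)
    (hj : ∀ i i', |cov[Z j i, Z j i'; P] - (if i = i' then 1 else 0)| ≤ r₀)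
    (hk : ∀ i i', |cov[Z k i, Z k i'; P] - (if i = i' then 1 else 0)| ≤ r₀)
    (hjk : ∀ i i', |cov[Z j i, Z k i'; P]| ≤ r) :
    |cov[fun ω => Real.log (‖arrayVector Z j ω‖ ^ 2),
      fun ω => Real.log (‖arrayVector Z k ω‖ ^ 2); P]| ≤ 32 * (Fintype.card ι * r) ^ 2 := by
  have hYj := hasGaussianLaw_arrayVector hZ j
  have hYk := hasGaussianLaw_arrayVector hZ k
  have vj := abs_variance_inner_arrayVector_sub_le hZ hj
  have vk := abs_variance_inner_arrayVector_sub_le hZ hk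
  have hr0 : 0 ≤ r := (abs_nonneg _).trans (hjk (Classical.arbitrary ι) (Classical.arbitrary ι))
  obtain ⟨pj, Lj, -, -⟩ := log_norm_sq_of_variance_near hYj (integral_inner_arrayVector hZ hmean j) hr₀ vj
  obtain ⟨pk, Lk, -, -⟩ := log_norm_sq_of_variance_near hYk (integral_inner_arrayVector hZ hmean k) hr₀ vk
  have lower : ∀ {l : κ}, (∀ x : EuclideanSpace ℝ ι,
      |Var[fun ω => inner ℝ x (arrayVector Z l ω); P] - ‖x‖ ^ 2| ≤ Fintype.card ι * r₀ * ‖x‖ ^ 2) →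
      ∀ x : EuclideanSpace ℝ ι, ‖x‖ ^ 2 / 2 ≤ Var[fun ω => inner ℝ x (arrayVector Z l ω); P] :=
    fun h x => by
      have h1 := (abs_le.1 (h x)).1
      nlinarith [sq_nonneg ‖x‖]
  have cont : ∀ l, Continuous fun x : EuclideanSpace ℝ ι =>
      Var[fun ω => inner ℝ x (arrayVector Z l ω); P] := fun l => by
    simp only [variance_inner_eq (hasGaussianLaw_arrayVector hZ l)]
    fun_prop
  have smulv : ∀ l (t : ℝ) (x : EuclideanSpace ℝ ι),
      Var[fun ω => inner ℝ (t • x) (arrayVector Z l ω); P] =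
        t ^ 2 * Var[fun ω => inner ℝ x (arrayVector Z l ω); P] := fun l t x => by
    simp only [inner_smul_left, conj_trivial]
    exact variance_const_mul t _ P
  have main : IsNearIndepGaussianPair P (arrayVector Z j) (arrayVector Z k)
      (fun x => Var[fun ω => inner ℝ x (arrayVector Z j ω); P])
      (fun x => Var[fun ω => inner ℝ x (arrayVector Z k ω); P])
      (fun x y => ∑ i, ∑ i', x i * y i' * cov[Z j i, Z k i'; P]) (Fintype.card ι * r) :=
    { aemeasurable_left := hYj.aemeasurable
      aemeasurable_right := hYk.aemeasurable
      charFun_eq := charFun_arrayVector_pair hZ hmean j k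
      continuous_left := cont j
      continuous_right := cont k
      continuous_cross := by fun_prop
      left_smul := smulv j
      right_smul := smulv k
      cross_smul := fun s t x y => by
        simp only [PiLp.smul_apply, smul_eq_mul, Finset.mul_sum]
        exact Finset.sum_congr rfl fun i _ => Finset.sum_congr rfl fun i' _ => by ring
      le_left := lower vj
      le_right := lower vk
      cross_le := abs_sum_sum_le hjk
      nonneg := by positivity
      le_quarter := hr }
  exact main.abs_covariance_log_norm_sq_le pj pk Lj Lk

end NearOrthonormalArray

/-! ### Bounds for the Dirichlet kernel -/

section DirichletSum

/-- The exponential sum `∑_{t=1}^n e^{i t x}`. -/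
noncomputable def dirichletSum (n : ℕ) (x : ℝ) : ℂ :=
  ∑ t ∈ Finset.Icc 1 n, Complex.exp (Complex.I * (t : ℂ) * (x : ℂ))

lemma continuous_dirichletSum (n : ℕ) : Continuous (dirichletSum n) := by
  unfold dirichletSum; fun_prop

lemma norm_dirichletSum_le (n : ℕ) (x : ℝ) : ‖dirichletSum n x‖ ≤ n := by
  refine (norm_sum_le _ _).trans ?_
  have : ∀ t ∈ Finset.Icc 1 n, ‖Complex.exp (Complex.I * (t : ℂ) * (x : ℂ))‖ = 1 := fun t _ => by
    rw [show Complex.I * (t : ℂ) * (x : ℂ) = ((t * x : ℝ) : ℂ) * Complex.I by push_cast; ring,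
      Complex.norm_exp_ofReal_mul_I]
  rw [Finset.sum_congr rfl this]
  simp

lemma dirichletSum_mul (n : ℕ) (x : ℝ) :
    dirichletSum n x * (1 - Complex.exp (Complex.I * x)) =
      Complex.exp (Complex.I * x) * (1 - Complex.exp (Complex.I * n * x)) := by
  induction n with
  | zero => simp [dirichletSum]
  | succ n ih =>
    have h : dirichletSum (n + 1) x =
        dirichletSum n x + Complex.exp (Complex.I * ((n + 1 : ℕ) : ℂ) * x) := by
      unfold dirichletSum
      rw [Finset.sum_Icc_succ_top (by omega)]
    have e : Complex.exp (Complex.I * ((n + 1 : ℕ) : ℂ) * x) =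
        Complex.exp (Complex.I * n * x) * Complex.exp (Complex.I * x) := by
      rw [← Complex.exp_add]; push_cast; ring_nf
    rw [h, add_mul, ih, e]
    ring

/-- The range is that of `x - u` with `|x| ≤ π` and `|u| ≤ π / 2`; it stays away from the zeros
`±2π` of `1 - exp (i x)`. -/
lemma abs_le_eight_mul_norm_one_sub_exp {x : ℝ} (hx : |x| ≤ 3 * Real.pi / 2) :
    |x| ≤ 8 * ‖1 - Complex.exp (Complex.I * x)‖ := by
  have h1 : ‖1 - Complex.exp (Complex.I * x)‖ = 2 * |Real.sin (x / 2)| := by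
    rw [← norm_neg, neg_sub, Complex.norm_exp_I_mul_ofReal_sub_one, Real.norm_eq_abs, abs_mul]
    simp
  rw [h1]
  have hpi := Real.pi_gt_three
  have hpi4 := Real.pi_lt_four
  have key : ∀ y : ℝ, 0 ≤ y → y ≤ 3 * Real.pi / 4 → y ≤ 8 * Real.sin y := by
    intro y hy0 hy
    rcases le_total y (Real.pi / 2) with h | h
    · have h2 := Real.mul_le_sin hy0 h
      have h3 : y / 8 ≤ 2 / Real.pi * y := by
        rw [div_mul_eq_mul_div, div_le_div_iff₀ (by norm_num) Real.pi_pos]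
        nlinarith
      linarith
    · have h2 := Real.mul_le_sin (x := Real.pi - y) (by linarith) (by linarith)
      rw [Real.sin_pi_sub] at h2
      have h3 : 1 / 2 ≤ 2 / Real.pi * (Real.pi - y) := by
        rw [div_mul_eq_mul_div, div_le_div_iff₀ (by norm_num) Real.pi_pos]
        nlinarith
      linarith
  have h2 := key (|x| / 2) (by positivity) (by linarith)
  have h3 : Real.sin (|x| / 2) ≤ |Real.sin (x / 2)| := by
    rcases abs_cases x with ⟨h, _⟩ | ⟨h, _⟩ <;> rw [h]
    · exact le_abs_self _
    · rw [neg_div, Real.sin_neg]; exact neg_le_abs _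
  linarith

lemma norm_dirichletSum_mul_abs_le (n : ℕ) {x : ℝ} (hx : |x| ≤ 3 * Real.pi / 2) :
    ‖dirichletSum n x‖ * |x| ≤ 16 := by
  have h1 := abs_le_eight_mul_norm_one_sub_exp hx
  have h2 : ‖dirichletSum n x‖ * ‖1 - Complex.exp (Complex.I * x)‖ ≤ 2 := by
    rw [← norm_mul, dirichletSum_mul, norm_mul, mul_comm Complex.I (x : ℂ),
      Complex.norm_exp_ofReal_mul_I, one_mul,
      show Complex.I * (n : ℂ) * (x : ℂ) = ((n * x : ℝ) : ℂ) * Complex.I by push_cast; ring]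
    refine (norm_sub_le _ _).trans ?_
    rw [Complex.norm_exp_ofReal_mul_I, norm_one]
    norm_num
  have := norm_nonneg (dirichletSum n x)
  nlinarith

/-- The trivial bound `n` and the decay bound `16 / |x|` are added: `‖D‖ (1 + n |x|) ≤ n + 16 n`. -/
lemma norm_dirichletSum_le_div (n : ℕ) {x : ℝ} (hx : |x| ≤ 3 * Real.pi / 2) :
    ‖dirichletSum n x‖ ≤ 17 * (n / (1 + n * |x|)) := by
  rw [mul_div_assoc', le_div_iff₀ (by positivity)]
  have h1 := norm_dirichletSum_mul_abs_le n hx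
  have h2 := norm_dirichletSum_le n x
  have h3 : (0 : ℝ) ≤ n := Nat.cast_nonneg n
  nlinarith

/-- A lower bound near the origin. -/
lemma half_le_norm_dirichletSum (n : ℕ) {x : ℝ} (hx : n * |x| ≤ 1) :
    (n : ℝ) / 2 ≤ ‖dirichletSum n x‖ := by
  refine le_trans ?_ (Complex.re_le_norm _)
  unfold dirichletSum
  rw [Complex.re_sum]
  have : ∀ t ∈ Finset.Icc 1 n, (1 : ℝ) / 2 ≤ (Complex.exp (Complex.I * (t : ℂ) * (x : ℂ))).re := by
    intro t ht
    rw [show Complex.I * (t : ℂ) * (x : ℂ) = ((t * x : ℝ) : ℂ) * Complex.I by push_cast; ring,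
      Complex.exp_ofReal_mul_I_re]
    have h1 := Real.one_sub_sq_div_two_le_cos (x := t * x)
    have h2 : |(t : ℝ) * x| ≤ 1 := by
      rw [abs_mul, Nat.abs_cast]
      refine le_trans ?_ hx
      have : (t : ℝ) ≤ n := by exact_mod_cast (Finset.mem_Icc.1 ht).2
      exact mul_le_mul_of_nonneg_right this (abs_nonneg _)
    have h3 := sq_abs ((t : ℝ) * x)
    nlinarith [abs_nonneg ((t : ℝ) * x)]
  calc (n : ℝ) / 2 = ∑ _t ∈ Finset.Icc 1 n, (1 : ℝ) / 2 := by simp; ring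
    _ ≤ _ := Finset.sum_le_sum this

end DirichletSum

/-! ### Integral of the majorant: below `b / 2`, up to `2a`, and beyond -/

section KernelIntegral

lemma integral_div_one_add_mul {n A : ℝ} (hn : 0 ≤ n) (hA : 0 ≤ A) :
    ∫ u in (0 : ℝ)..A, n / (1 + n * u) = Real.log (1 + n * A) := by
  have h : ∀ u ∈ Set.uIcc 0 A, HasDerivAt (fun u => Real.log (1 + n * u)) (n / (1 + n * u)) u := by
    intro u hu
    rw [Set.uIcc_of_le hA] at hu
    have hpos : 0 < 1 + n * u := by have := mul_nonneg hn hu.1; linarith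
    have h1 : HasDerivAt (fun u : ℝ => 1 + n * u) n u := by
      simpa using ((hasDerivAt_id u).const_mul n).const_add 1
    exact h1.log hpos.ne'
  rw [intervalIntegral.integral_eq_sub_of_hasDerivAt h]
  · simp
  · refine ContinuousOn.intervalIntegrable ?_
    rw [Set.uIcc_of_le hA]
    refine ContinuousOn.div (by fun_prop) (by fun_prop) fun u hu => ?_
    have := mul_nonneg hn hu.1
    linarith

lemma integral_div_one_add_mul_abs_sub_le {n a b : ℝ} (hn : 0 ≤ n) (hb : 0 ≤ b) (hba : b ≤ a) :
    ∫ x in (b / 2)..(2 * a), n / (1 + n * |x - b|) ≤ 2 * Real.log (1 + n * (2 * a)) := by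
  have hc : Continuous fun x : ℝ => n / (1 + n * |x - b|) := by
    refine Continuous.div (by fun_prop) (by fun_prop) fun x => ?_
    positivity
  rw [← intervalIntegral.integral_add_adjacent_intervals (b := b) (hc.intervalIntegrable _ _)
    (hc.intervalIntegrable _ _)]
  have e1 : ∫ x in (b / 2)..b, n / (1 + n * |x - b|) = Real.log (1 + n * (b / 2)) := by
    have h1 := intervalIntegral.integral_comp_sub_left (a := b / 2) (b := b)
      (fun u : ℝ => n / (1 + n * |u|)) b
    simp only [sub_self] at h1
    simp only [abs_sub_comm _ b]
    rw [h1, show b - b / 2 = b / 2 by ring, ← integral_div_one_add_mul hn (by positivity)]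
    refine intervalIntegral.integral_congr fun u hu => ?_
    rw [Set.uIcc_of_le (by positivity)] at hu
    simp only [abs_of_nonneg hu.1]
  have e2 : ∫ x in b..(2 * a), n / (1 + n * |x - b|) = Real.log (1 + n * (2 * a - b)) := by
    have h1 := intervalIntegral.integral_comp_sub_right (a := b) (b := 2 * a)
      (fun u : ℝ => n / (1 + n * |u|)) b
    simp only [sub_self] at h1
    rw [h1, ← integral_div_one_add_mul hn (by linarith)]
    refine intervalIntegral.integral_congr fun u hu => ?_
    rw [Set.uIcc_of_le (by linarith)] at hu
    simp only [abs_of_nonneg hu.1]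
  rw [e1, e2, two_mul (Real.log _)]
  refine add_le_add (Real.log_le_log (by positivity) ?_) (Real.log_le_log ?_ ?_)
  · gcongr; linarith
  · have := mul_nonneg hn (by linarith : 0 ≤ 2 * a - b); linarith
  · gcongr; linarith

/-- The function dominating the products of a spectral increment and two Dirichlet sums. -/
noncomputable def kernelMajorant (p n a b x : ℝ) : ℝ :=
  (x ^ p + a ^ p) * ((max x a)⁻¹ * (n / (1 + n * |x - b|)))

variable {p n a b : ℝ}

lemma intervalIntegrable_kernelMajorant (hp : -1 < p) (hn : 0 ≤ n) (ha : 0 < a) (s t : ℝ) :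
    IntervalIntegrable (kernelMajorant p n a b) volume s t := by
  unfold kernelMajorant
  refine IntervalIntegrable.mul_continuousOn
    ((intervalIntegral.intervalIntegrable_rpow' hp).add intervalIntegrable_const)
    (Continuous.continuousOn ?_)
  refine Continuous.mul (Continuous.inv₀ (by fun_prop) fun x => (lt_max_of_lt_right ha).ne') ?_
  refine Continuous.div (by fun_prop) (by fun_prop) fun x => ?_
  positivity

lemma div_one_add_mul_le_inv {u : ℝ} (hn : 0 ≤ n) (hu : 0 < u) : n / (1 + n * u) ≤ u⁻¹ := by
  rw [div_le_iff₀ (by positivity), inv_mul_eq_div, le_div_iff₀ hu]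
  linarith

/-- On this range `|x - b| ≥ b / 2` and the maximum is at least `a`, so only the singularity `x ^ p`
remains; it is integrable because `p > -1`, and the length of the interval cancels the factor `1 /
b`. -/
lemma integral_kernelMajorant_near_zero (hp : -1 < p) (hn : 0 ≤ n) (hb : 0 < b) (hba : b ≤ a) :
    ∫ x in (0 : ℝ)..(b / 2), kernelMajorant p n a b x ≤
      (2 / (p + 1) + 1) * (a ^ p + b ^ p) / a := by
  have ha : 0 < a := hb.trans_le hba
  have hp1 : 0 < p + 1 := by linarith
  calc ∫ x in (0 : ℝ)..(b / 2), kernelMajorant p n a b x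
      ≤ ∫ x in (0 : ℝ)..(b / 2), (x ^ p + a ^ p) * (a⁻¹ * (b / 2)⁻¹) := by
        refine intervalIntegral.integral_mono_on_of_le_Ioo (by positivity)
          (intervalIntegrable_kernelMajorant hp hn ha _ _)
          (((intervalIntegral.intervalIntegrable_rpow' hp).add intervalIntegrable_const).mul_const _)
          fun x hx => ?_
        unfold kernelMajorant
        have hx0 : 0 < x := hx.1
        have h1 : (max x a)⁻¹ ≤ a⁻¹ := inv_anti₀ ha (le_max_right _ _)
        have habs : b / 2 ≤ |x - b| := by
          rw [abs_sub_comm]; exact le_trans (by linarith [hx.2]) (le_abs_self _)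
        have h2 : n / (1 + n * |x - b|) ≤ (b / 2)⁻¹ :=
          (div_one_add_mul_le_inv hn (by linarith)).trans (inv_anti₀ (by positivity) habs)
        gcongr
    _ = ((b / 2) ^ (p + 1) / (p + 1) + (b / 2) * a ^ p) * (a⁻¹ * (b / 2)⁻¹) := by
        rw [intervalIntegral.integral_mul_const, intervalIntegral.integral_add
          (intervalIntegral.intervalIntegrable_rpow' hp) intervalIntegrable_const,
          integral_rpow (Or.inl hp), Real.zero_rpow hp1.ne']
        simp
    _ = ((b / 2) ^ p / (p + 1) + a ^ p) / a := by
        rw [Real.rpow_add_one (by positivity)]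
        field_simp
    _ ≤ _ := by
        have h1 : (b / 2) ^ p ≤ 2 * b ^ p := by
          rw [Real.div_rpow hb.le (by norm_num), div_le_iff₀ (by positivity)]
          have h2 : (2 : ℝ)⁻¹ ≤ 2 ^ p := by
            rw [← Real.rpow_neg_one]
            exact Real.rpow_le_rpow_of_exponent_le (by norm_num) hp.le
          have h3 : 0 < b ^ p := by positivity
          nlinarith
        refine div_le_div_of_nonneg_right ?_ ha.le
        have h3 : 0 < b ^ p := by positivity
        have h4 : 0 < a ^ p := by positivity
        have h5 : (b / 2) ^ p / (p + 1) ≤ 2 / (p + 1) * b ^ p := by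
          rw [div_mul_eq_mul_div]; gcongr
        have h6 : 0 < 2 / (p + 1) := by positivity
        nlinarith

/-- The power is bounded by its values at the two frequencies, and the integral of the remaining
kernel around `b` is where the logarithm comes from. -/
lemma integral_kernelMajorant_middle (hp : -1 < p) (hp' : p < 1) (hn : 0 ≤ n) (hb : 0 < b)
    (hba : b ≤ a) :
    ∫ x in (b / 2)..(2 * a), kernelMajorant p n a b x ≤
      6 * (a ^ p + b ^ p) / a * Real.log (1 + n * (2 * a)) := by
  have ha : 0 < a := hb.trans_le hba
  have hap : 0 < a ^ p := by positivity
  have hbp : 0 < b ^ p := by positivity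
  have hc : Continuous fun x : ℝ => n / (1 + n * |x - b|) := by
    refine Continuous.div (by fun_prop) (by fun_prop) fun x => ?_
    positivity
  calc ∫ x in (b / 2)..(2 * a), kernelMajorant p n a b x
      ≤ ∫ x in (b / 2)..(2 * a), (3 * (a ^ p + b ^ p) / a) * (n / (1 + n * |x - b|)) := by
        refine intervalIntegral.integral_mono_on_of_le_Ioo (by linarith)
          (intervalIntegrable_kernelMajorant hp hn ha _ _)
          ((hc.intervalIntegrable _ _).const_mul _) fun x hx => ?_
        have hx0 : 0 < x := lt_trans (by positivity) hx.1
        have h1 : (max x a)⁻¹ ≤ a⁻¹ := inv_anti₀ ha (le_max_right _ _)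
        have h2 : x ^ p ≤ 2 * (a ^ p + b ^ p) := by
          rcases le_total 0 p with h | h
          · have h3 : x ^ p ≤ (2 * a) ^ p := Real.rpow_le_rpow hx0.le hx.2.le h
            rw [Real.mul_rpow (by norm_num) ha.le] at h3
            have h4 : (2 : ℝ) ^ p ≤ 2 := by
              conv_rhs => rw [← Real.rpow_one 2]
              exact Real.rpow_le_rpow_of_exponent_le (by norm_num) hp'.le
            nlinarith
          · have h3 : x ^ p ≤ (b / 2) ^ p :=
              Real.rpow_le_rpow_of_nonpos (by positivity) hx.1.le h
            rw [Real.div_rpow hb.le (by norm_num)] at h3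
            have h4 : (2 : ℝ)⁻¹ ≤ 2 ^ p := by
              rw [← Real.rpow_neg_one]
              exact Real.rpow_le_rpow_of_exponent_le (by norm_num) hp.le
            have h5 : b ^ p / 2 ^ p ≤ 2 * b ^ p := by
              rw [div_le_iff₀ (by positivity)]
              nlinarith
            nlinarith
        unfold kernelMajorant
        rw [← mul_assoc]
        refine mul_le_mul_of_nonneg_right ?_ (by positivity)
        rw [div_eq_mul_inv]
        have h3 : x ^ p + a ^ p ≤ 3 * (a ^ p + b ^ p) := by linarith
        gcongr
    _ = (3 * (a ^ p + b ^ p) / a) * ∫ x in (b / 2)..(2 * a), n / (1 + n * |x - b|) := by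
        rw [intervalIntegral.integral_const_mul]
    _ ≤ (3 * (a ^ p + b ^ p) / a) * (2 * Real.log (1 + n * (2 * a))) := by
        refine mul_le_mul_of_nonneg_left
          (integral_div_one_add_mul_abs_sub_le hn hb.le hba) (by positivity)
    _ = _ := by ring

/-- Here `|x - b| ≥ x / 2`, so the integrand decays like `x ^ (p - 2)` and `x ^ (-2)`. Since `p <
1`, the integral is bounded uniformly in `L`. -/
lemma integral_kernelMajorant_far (hp : -1 < p) (hp' : p < 1) (hn : 0 ≤ n) (hb : 0 < b)
    (hba : b ≤ a) {L : ℝ} (hL : 2 * a ≤ L) :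
    ∫ x in (2 * a)..L, kernelMajorant p n a b x ≤ (2 / (1 - p) + 1) * (a ^ p + b ^ p) / a := by
  have ha : 0 < a := hb.trans_le hba
  have hap : 0 < a ^ p := by positivity
  have hbp : 0 < b ^ p := by positivity
  have hp2 : 0 < 1 - p := by linarith
  have h0 : (0 : ℝ) ∉ Set.uIcc (2 * a) L := by
    rw [Set.uIcc_of_le hL]; intro h; linarith [h.1]
  have I1 : IntervalIntegrable (fun x : ℝ => x ^ (p - 2)) volume (2 * a) L :=
    intervalIntegral.intervalIntegrable_rpow (Or.inr h0)
  have I2 : IntervalIntegrable (fun x : ℝ => x ^ (-2 : ℝ)) volume (2 * a) L :=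
    intervalIntegral.intervalIntegrable_rpow (Or.inr h0)
  calc ∫ x in (2 * a)..L, kernelMajorant p n a b x
      ≤ ∫ x in (2 * a)..L, 2 * (x ^ (p - 2) + a ^ p * x ^ (-2 : ℝ)) := by
        refine intervalIntegral.integral_mono_on_of_le_Ioo hL
          (intervalIntegrable_kernelMajorant hp hn ha _ _)
          ((I1.add (I2.const_mul _)).const_mul _) fun x hx => ?_
        have hx0 : 0 < x := lt_trans (by positivity) hx.1
        have h1 : (max x a)⁻¹ ≤ x⁻¹ := inv_anti₀ hx0 (le_max_left _ _)
        have habs : x / 2 ≤ |x - b| := le_trans (by linarith [hx.1]) (le_abs_self _)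
        have h2 : n / (1 + n * |x - b|) ≤ (x / 2)⁻¹ :=
          (div_one_add_mul_le_inv hn (by linarith)).trans (inv_anti₀ (by positivity) habs)
        have h3 : x ^ p * (x⁻¹ * (x / 2)⁻¹) = 2 * x ^ (p - 2) := by
          rw [Real.rpow_sub hx0]
          norm_cast
          field_simp
        have h4 : x⁻¹ * (x / 2)⁻¹ = 2 * x ^ (-2 : ℝ) := by
          rw [Real.rpow_neg hx0.le]
          norm_cast
          field_simp
        calc kernelMajorant p n a b x ≤ (x ^ p + a ^ p) * (x⁻¹ * (x / 2)⁻¹) := by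
              unfold kernelMajorant; gcongr
          _ = _ := by rw [add_mul, h3, h4]; ring
    _ = 2 * ((L ^ (p - 1) - (2 * a) ^ (p - 1)) / (p - 1) +
          a ^ p * ((L ^ (-1 : ℝ) - (2 * a) ^ (-1 : ℝ)) / (-1))) := by
        rw [intervalIntegral.integral_const_mul, intervalIntegral.integral_add I1 (I2.const_mul _),
          intervalIntegral.integral_const_mul, integral_rpow (Or.inr ⟨by linarith, h0⟩),
          integral_rpow (Or.inr ⟨by norm_num, h0⟩)]
        norm_num
        ring_nf
    _ ≤ 2 * ((2 * a) ^ (p - 1) / (1 - p) + a ^ p * (2 * a) ^ (-1 : ℝ)) := by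
        have hL0 : 0 < L := by linarith
        have h1 : 0 < L ^ (p - 1) := by positivity
        have h2 : 0 < L ^ (-1 : ℝ) := by positivity
        have e1 : (L ^ (p - 1) - (2 * a) ^ (p - 1)) / (p - 1) =
            ((2 * a) ^ (p - 1) - L ^ (p - 1)) / (1 - p) := by
          rw [← neg_sub 1 p, div_neg, ← neg_div, neg_sub]
        have e2 : (L ^ (-1 : ℝ) - (2 * a) ^ (-1 : ℝ)) / (-1) = (2 * a) ^ (-1 : ℝ) - L ^ (-1 : ℝ) := by
          ring
        rw [e1, e2]
        gcongr <;> linarith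
    _ ≤ 2 * (a ^ p / a / (1 - p) + a ^ p / (2 * a)) := by
        have h1 : (2 * a) ^ (p - 1) ≤ a ^ (p - 1) :=
          Real.rpow_le_rpow_of_nonpos ha (by linarith) (by linarith)
        rw [Real.rpow_sub_one ha.ne'] at h1
        rw [Real.rpow_neg_one, ← div_eq_mul_inv]
        gcongr
    _ = (2 / (1 - p) + 1) * a ^ p / a := by field_simp
    _ ≤ _ := by
        refine div_le_div_of_nonneg_right ?_ ha.le
        exact mul_le_mul_of_nonneg_left (by linarith) (by positivity)

lemma integral_kernelMajorant_le (hp : -1 < p) (hp' : p < 1) (hn : 0 ≤ n) (hb : 0 < b)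
    (hba : b ≤ a) {L : ℝ} (hL : 2 * a ≤ L) :
    ∫ x in (0 : ℝ)..L, kernelMajorant p n a b x ≤
      (2 / (p + 1) + 2 / (1 - p) + 6) * (a ^ p + b ^ p) / a * (1 + Real.log (1 + n * (2 * a))) := by
  have ha : 0 < a := hb.trans_le hba
  have hI := fun s t => intervalIntegrable_kernelMajorant (b := b) hp hn ha s t
  rw [← intervalIntegral.integral_add_adjacent_intervals (hI 0 (b / 2)) (hI (b / 2) L),
    ← intervalIntegral.integral_add_adjacent_intervals (hI (b / 2) (2 * a)) (hI (2 * a) L)]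
  have h1 := integral_kernelMajorant_near_zero hp hn hb hba
  have h2 := integral_kernelMajorant_middle hp hp' hn hb hba
  have h3 := integral_kernelMajorant_far hp hp' hn hb hba hL
  have hlog : 0 ≤ Real.log (1 + n * (2 * a)) := by
    refine Real.log_nonneg ?_
    have := mul_nonneg hn (by positivity : 0 ≤ 2 * a)
    linarith
  set Λ := Real.log (1 + n * (2 * a))
  have hp1 : 0 < p + 1 := by linarith
  have hp2 : 0 < 1 - p := by linarith
  set S := (a ^ p + b ^ p) / a with hS
  have hS0 : 0 < S := by positivity
  set u := 2 / (p + 1) with hu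
  set v := 2 / (1 - p) with hv
  have hu0 : 0 < u := by positivity
  have hv0 : 0 < v := by positivity
  rw [mul_div_assoc, ← hS] at h1 h2 h3 ⊢
  have h4 : 0 ≤ (u + v) * S * Λ := by positivity
  nlinarith

end KernelIntegral

/-! ### Increments of the spectral density against Dirichlet kernels -/

section SpectralIncrement

/-- With `r = x / a ≥ 1` everything reduces to `r ^ |p| - 1 ≤ r - 1`, after factoring out the
smaller of the two powers. -/
lemma abs_rpow_sub_rpow_le {p a x : ℝ} (hp : |p| ≤ 1) (ha : 0 < a) (hax : a ≤ x) :
    |x ^ p - a ^ p| ≤ (x ^ p + a ^ p) * ((x - a) / a) := by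
  have hx : 0 < x := ha.trans_le hax
  have hap : 0 < a ^ p := by positivity
  have hxp : 0 < x ^ p := by positivity
  have hr : 1 ≤ x / a := (one_le_div ha).2 hax
  have hda : 0 ≤ (x - a) / a := div_nonneg (by linarith) ha.le
  have hra : x / a - 1 = (x - a) / a := by field_simp
  obtain ⟨hp1, hp2⟩ := abs_le.1 hp
  rcases le_total 0 p with h | h
  · have h1 : a ^ p ≤ x ^ p := Real.rpow_le_rpow ha.le hax h
    have h2 : (x / a) ^ p ≤ x / a := by
      conv_rhs => rw [← Real.rpow_one (x / a)]
      exact Real.rpow_le_rpow_of_exponent_le hr hp2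
    have h3 : x ^ p = a ^ p * (x / a) ^ p := by
      rw [← Real.mul_rpow ha.le (by positivity), mul_div_cancel₀ _ ha.ne']
    rw [abs_of_nonneg (by linarith)]
    calc x ^ p - a ^ p = a ^ p * ((x / a) ^ p - 1) := by rw [h3]; ring
      _ ≤ a ^ p * ((x - a) / a) := by rw [← hra]; gcongr
      _ ≤ _ := mul_le_mul_of_nonneg_right (by linarith) hda
  · have h1 : x ^ p ≤ a ^ p := Real.rpow_le_rpow_of_nonpos ha hax h
    have h2 : (x / a) ^ (-p) ≤ x / a := by
      conv_rhs => rw [← Real.rpow_one (x / a)]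
      exact Real.rpow_le_rpow_of_exponent_le hr (by linarith)
    have h3 : a ^ p = x ^ p * (x / a) ^ (-p) := by
      rw [Real.rpow_neg (by positivity), Real.div_rpow hx.le ha.le]
      field_simp
    rw [abs_sub_comm, abs_of_nonneg (by linarith)]
    calc a ^ p - x ^ p = x ^ p * ((x / a) ^ (-p) - 1) := by rw [h3]; ring
      _ ≤ x ^ p * ((x - a) / a) := by rw [← hra]; gcongr
      _ ≤ _ := mul_le_mul_of_nonneg_right (by linarith) hda

variable {d μ ν : ℝ} {fstar : ℝ → ℝ}

/-- The Hölder condition involves only `|ω|` and `|ω'|`, so its right side vanishes at `ω' = -ω`. -/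
lemma LocalLipschitz.even (hL : LocalLipschitz μ ν fstar) (hν : 0 < ν) {x : ℝ}
    (hx : x ∈ Set.Icc (-Real.pi) Real.pi) : fstar (-x) = fstar x := by
  by_cases h0 : x = 0
  · simp [h0]
  have h := hL.holder (-x) ⟨by linarith [hx.2], by linarith [hx.1]⟩ x hx (neg_ne_zero.2 h0) h0
  rw [abs_neg, sub_self, abs_zero, Real.zero_rpow hν.ne', mul_zero] at h
  exact sub_eq_zero.1 (abs_eq_zero.1 (le_antisymm h (abs_nonneg _)))

lemma memorySpectralDensity_abs (hL : LocalLipschitz μ ν fstar) (hν : 0 < ν) {x : ℝ}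
    (hx : x ∈ Set.Icc (-Real.pi) Real.pi) :
    memorySpectralDensity d fstar |x| = memorySpectralDensity d fstar x := by
  unfold memorySpectralDensity
  rw [abs_abs]
  rcases abs_cases x with ⟨h, _⟩ | ⟨h, _⟩ <;> rw [h]
  rw [hL.even hν hx]

/-- For `x ≤ 2a` the increments of the power and of `f⋆` are treated separately; for `x ≥ 2a` the
ratio `(x - a) / x` is at least one half, and crude bounds suffice. The larger point in the
denominator provides the decay in `x` used far from the origin. -/
lemma abs_memorySpectralDensity_sub_le_of_le (hL : LocalLipschitz μ ν fstar) (hd : |2 * d| ≤ 1)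
    {a x : ℝ} (ha : 0 < a) (hax : a ≤ x) (hx : x ≤ Real.pi) :
    |memorySpectralDensity d fstar x - memorySpectralDensity d fstar a| ≤
      4 * (μ * fstar 0) * (x ^ (-2 * d) + a ^ (-2 * d)) * ((x - a) / x) := by
  have hx0 : 0 < x := ha.trans_le hax
  have hxI : x ∈ Set.Icc (-Real.pi) Real.pi := ⟨by linarith [Real.pi_pos], hx⟩
  have haI : a ∈ Set.Icc (-Real.pi) Real.pi := ⟨by linarith [Real.pi_pos], by linarith⟩
  have hM := hL.bound a haI
  have hMx := hL.bound x hxI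
  have hna := hL.nonneg a haI
  have hnx := hL.nonneg x hxI
  have hM0 : 0 ≤ μ * fstar 0 := hna.trans hM
  unfold memorySpectralDensity
  rw [abs_of_pos hx0, abs_of_pos ha]
  set p := -2 * d with hp
  have hp' : |p| ≤ 1 := by rw [hp, neg_mul, abs_neg]; exact hd
  have hap : 0 < a ^ p := by positivity
  have hxp : 0 < x ^ p := by positivity
  rcases le_total x (2 * a) with h | h
  · have h1 := abs_rpow_sub_rpow_le hp' ha hax
    have h2 := hL.lipschitz x hxI a haI hx0.ne' ha.ne'
    rw [abs_of_pos hx0, abs_of_pos ha, min_eq_right hax, abs_of_nonneg (by linarith : 0 ≤ x - a)] at h2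
    have h3 : (x - a) / a ≤ 2 * ((x - a) / x) := by
      rw [mul_div_assoc', div_le_div_iff₀ ha hx0]
      nlinarith
    calc |x ^ p * fstar x - a ^ p * fstar a|
        = |(x ^ p - a ^ p) * fstar a + x ^ p * (fstar x - fstar a)| := by ring_nf
      _ ≤ |x ^ p - a ^ p| * fstar a + x ^ p * |fstar x - fstar a| := by
          refine (abs_add_le _ _).trans ?_
          rw [abs_mul, abs_mul, abs_of_nonneg hna, abs_of_pos hxp]
      _ ≤ (x ^ p + a ^ p) * ((x - a) / a) * (μ * fstar 0) +
          x ^ p * (μ * fstar 0 * ((x - a) / a)) := by gcongr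
      _ = (μ * fstar 0) * (x ^ p + a ^ p + x ^ p) * ((x - a) / a) := by ring
      _ ≤ (μ * fstar 0) * (2 * (x ^ p + a ^ p)) * (2 * ((x - a) / x)) := by
          gcongr
          linarith
      _ = _ := by ring
  · have h3 : 1 / 2 ≤ (x - a) / x := by
      rw [div_le_div_iff₀ two_pos hx0]; linarith
    have hS : 0 ≤ (μ * fstar 0) * (x ^ p + a ^ p) := by positivity
    calc |x ^ p * fstar x - a ^ p * fstar a| ≤ x ^ p * (μ * fstar 0) + a ^ p * (μ * fstar 0) := by
          refine (abs_sub _ _).trans ?_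
          rw [abs_of_nonneg (by positivity), abs_of_nonneg (by positivity)]
          gcongr
      _ = (μ * fstar 0) * (x ^ p + a ^ p) := by ring
      _ ≤ _ := by nlinarith

lemma abs_memorySpectralDensity_sub_le (hL : LocalLipschitz μ ν fstar) (hd : |2 * d| ≤ 1)
    {a x : ℝ} (ha : 0 < a) (haπ : a ≤ Real.pi) (hx0 : 0 < x) (hx : x ≤ Real.pi) :
    |memorySpectralDensity d fstar x - memorySpectralDensity d fstar a| ≤
      4 * (μ * fstar 0) * (x ^ (-2 * d) + a ^ (-2 * d)) * (|x - a| / max x a) := by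
  rcases le_total a x with h | h
  · rw [max_eq_left h, abs_of_nonneg (by linarith : 0 ≤ x - a)]
    exact abs_memorySpectralDensity_sub_le_of_le hL hd ha h hx
  · rw [max_eq_right h, abs_sub_comm, abs_sub_comm x a, abs_of_nonneg (by linarith : 0 ≤ a - x),
      add_comm (x ^ (-2 * d))]
    exact abs_memorySpectralDensity_sub_le_of_le hL hd hx0 h haπ

/-- The spectral increment times two Dirichlet sums is dominated by `kernelMajorant`. -/
lemma abs_sub_mul_norm_mul_norm_le (hL : LocalLipschitz μ ν fstar) (hν : 0 < ν) (hd : |2 * d| ≤ 1)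
    (n : ℕ) {x u w : ℝ} (hx : x ∈ Set.Icc (-Real.pi) Real.pi) (hx0 : x ≠ 0)
    (hu0 : u ≠ 0) (hu : |u| ≤ Real.pi / 2) (hw : |w| ≤ Real.pi / 2) :
    |memorySpectralDensity d fstar x - memorySpectralDensity d fstar (|u|)| *
      ‖dirichletSum n (x - u)‖ * ‖dirichletSum n (x - w)‖ ≤
      1088 * (μ * fstar 0) * kernelMajorant (-2 * d) n |u| |w| |x| := by
  have hpi := Real.pi_pos
  have hxa : |x| ≤ Real.pi := abs_le.2 hx
  have hx' : 0 < |x| := abs_pos.2 hx0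
  have hu' : 0 < |u| := abs_pos.2 hu0
  have h1 := abs_memorySpectralDensity_sub_le hL hd hu' (by linarith) hx' hxa
  rw [memorySpectralDensity_abs hL hν hx] at h1
  have hM : 0 ≤ μ * fstar 0 := (hL.nonneg x hx).trans (hL.bound x hx)
  -- The kernel at `u` is spent on the factor `||x| - |u||` of the increment; only the kernel at `w`
  -- is left to integrate. The constant is `1088 = 4 * 17 * 16`.
  have h2 : ‖dirichletSum n (x - u)‖ * |(|x| - |u|)| ≤ 16 := by
    refine le_trans ?_ (norm_dirichletSum_mul_abs_le n (x := x - u) ?_)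
    · exact mul_le_mul_of_nonneg_left (abs_abs_sub_abs_le x u) (norm_nonneg _)
    · exact (abs_sub _ _).trans (by linarith)
  have h3 : ‖dirichletSum n (x - w)‖ ≤ 17 * (n / (1 + n * |(|x| - |w|)|)) := by
    refine (norm_dirichletSum_le_div n (x := x - w) ((abs_sub _ _).trans (by linarith))).trans ?_
    have := abs_abs_sub_abs_le x w
    gcongr
  have hmax : 0 < max |x| |u| := lt_max_of_lt_left hx'
  have hS : 0 ≤ |x| ^ (-2 * d) + |u| ^ (-2 * d) := by positivity
  calc _ ≤ (4 * (μ * fstar 0) * (|x| ^ (-2 * d) + |u| ^ (-2 * d)) * (|(|x| - |u|)| / max |x| |u|)) *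
        ‖dirichletSum n (x - u)‖ * (17 * (n / (1 + n * |(|x| - |w|)|))) := by gcongr
    _ = 68 * (μ * fstar 0) * (|x| ^ (-2 * d) + |u| ^ (-2 * d)) *
        (‖dirichletSum n (x - u)‖ * |(|x| - |u|)|) * (max |x| |u|)⁻¹ *
        (n / (1 + n * |(|x| - |w|)|)) := by rw [div_eq_mul_inv]; ring
    _ ≤ 68 * (μ * fstar 0) * (|x| ^ (-2 * d) + |u| ^ (-2 * d)) * 16 * (max |x| |u|)⁻¹ *
        (n / (1 + n * |(|x| - |w|)|)) := by gcongr
    _ = _ := by unfold kernelMajorant; ring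

lemma integral_comp_abs_symm {F : ℝ → ℝ} {L : ℝ} (hF : IntervalIntegrable F volume 0 L)
    (hL : 0 ≤ L) :
    IntervalIntegrable (fun x => F |x|) volume (-L) L ∧
      ∫ x in (-L)..L, F |x| = 2 * ∫ x in (0 : ℝ)..L, F x := by
  have i1 : IntervalIntegrable (fun x => F |x|) volume 0 L := by
    refine hF.congr fun x hx => ?_
    rw [Set.uIoc_of_le hL] at hx
    simp only [abs_of_pos hx.1]
  have i2 : IntervalIntegrable (fun x => F |x|) volume (-L) 0 := by
    have := ((IntervalIntegrable.iff_comp_neg (by finiteness)).1 i1).symm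
    simpa using this
  refine ⟨i2.trans i1, ?_⟩
  rw [← intervalIntegral.integral_add_adjacent_intervals i2 i1]
  have e1 : ∫ x in (0 : ℝ)..L, F |x| = ∫ x in (0 : ℝ)..L, F x := by
    refine intervalIntegral.integral_congr fun x hx => ?_
    rw [Set.uIcc_of_le hL] at hx
    simp only [abs_of_nonneg hx.1]
  have e2 : ∫ x in (-L)..0, F |x| = ∫ x in (0 : ℝ)..L, F |x| := by
    have := intervalIntegral.integral_comp_neg (a := 0) (b := L) (fun x => F |x|)
    simpa using this.symm
  rw [e2, e1]; ring

lemma integral_spectral_increment_le (hL : LocalLipschitz μ ν fstar) (hν : 0 < ν)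
    (hd : |2 * d| < 1)
    (hf : IntervalIntegrable (memorySpectralDensity d fstar) volume (-Real.pi) Real.pi)
    (n : ℕ) {u w : ℝ} (hw0 : w ≠ 0) (hu : |u| ≤ Real.pi / 2) (hwu : |w| ≤ |u|) :
    ∫ x in (-Real.pi)..Real.pi,
      |memorySpectralDensity d fstar x - memorySpectralDensity d fstar (|u|)| *
        ‖dirichletSum n (x - u)‖ * ‖dirichletSum n (x - w)‖ ≤
      2176 * (μ * fstar 0) * ((2 / (-2 * d + 1) + 2 / (1 - -2 * d) + 6) *
        (|u| ^ (-2 * d) + |w| ^ (-2 * d)) / |u| * (1 + Real.log (1 + n * (2 * |u|)))) := by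
  have hpi := Real.pi_pos
  have hw' : 0 < |w| := abs_pos.2 hw0
  have hu' : 0 < |u| := hw'.trans_le hwu
  obtain ⟨hd1, hd2⟩ := abs_lt.1 hd
  have hM : 0 ≤ μ * fstar 0 :=
    (hL.nonneg 0 ⟨by linarith, hpi.le⟩).trans (hL.bound 0 ⟨by linarith, hpi.le⟩)
  have hK := intervalIntegrable_kernelMajorant (p := -2 * d) (n := n) (b := |w|) (by linarith)
    (Nat.cast_nonneg n) hu' 0 Real.pi
  obtain ⟨hKi, hKe⟩ := integral_comp_abs_symm hK hpi.le
  have hc1 := (continuous_dirichletSum n)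
  calc _ ≤ ∫ x in (-Real.pi)..Real.pi,
        1088 * (μ * fstar 0) * kernelMajorant (-2 * d) n |u| |w| |x| := by
        refine intervalIntegral.integral_mono_ae_restrict (by linarith) ?_ (hKi.const_mul _) ?_
        · refine IntervalIntegrable.mul_continuousOn (IntervalIntegrable.mul_continuousOn
            ((hf.sub intervalIntegrable_const).abs) ?_) ?_
          · exact (Continuous.norm (by fun_prop)).continuousOn
          · exact (Continuous.norm (by fun_prop)).continuousOn
        · have h0 : ∀ᵐ x ∂(volume : Measure ℝ), x ≠ 0 := by
            rw [ae_iff]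
            simp
          filter_upwards [ae_restrict_of_ae h0, ae_restrict_mem measurableSet_Icc] with x hx hxI
          exact abs_sub_mul_norm_mul_norm_le hL hν hd.le n hxI hx (abs_pos.1 hu') hu (hwu.trans hu)
    _ = 2176 * (μ * fstar 0) * ∫ x in (0 : ℝ)..Real.pi, kernelMajorant (-2 * d) n |u| |w| x := by
        rw [intervalIntegral.integral_const_mul, hKe]; ring
    _ ≤ _ := by
        refine mul_le_mul_of_nonneg_left ?_ (by positivity)
        exact integral_kernelMajorant_le (by linarith) (by linarith) (Nat.cast_nonneg n) hw' hwu
          (by linarith)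

end SpectralIncrement

/-! ### Orthogonality of the trigonometric polynomials -/

section TrigonometricSums

/-- The cosine (`false`) and the sine (`true`). -/
noncomputable def trigFn (α : Bool) (x : ℝ) : ℝ := cond α (Real.sin x) (Real.cos x)

lemma dirichletSum_int_mul_eq_zero {n : ℕ} {l : ℤ} (hl : ¬ (n : ℤ) ∣ l) :
    dirichletSum n (2 * Real.pi * l / n) = 0 := by
  rcases Nat.eq_zero_or_pos n with rfl | hn0
  · simp [dirichletSum]
  have hn : (n : ℂ) ≠ 0 := by exact_mod_cast hn0.ne'
  have h := dirichletSum_mul n (2 * Real.pi * l / n)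
  have e1 : Complex.exp (Complex.I * n * ((2 * Real.pi * l / n : ℝ) : ℂ)) = 1 := by
    rw [Complex.exp_eq_one_iff]
    exact ⟨l, by push_cast; field_simp⟩
  rw [e1, sub_self, mul_zero] at h
  refine (mul_eq_zero.1 h).resolve_right fun h0 => hl ?_
  have h1 := (sub_eq_zero.1 h0).symm
  rw [Complex.exp_eq_one_iff] at h1
  obtain ⟨q, hq⟩ := h1
  refine ⟨q, ?_⟩
  push_cast at hq
  have hpi : (Real.pi : ℂ) ≠ 0 := by exact_mod_cast Real.pi_ne_zero
  have hI := Complex.I_ne_zero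
  field_simp at hq
  exact_mod_cast hq

lemma sum_cos_eq (n : ℕ) (x : ℝ) :
    ∑ t ∈ Finset.Icc 1 n, Real.cos (t * x) = (dirichletSum n x).re := by
  rw [dirichletSum, Complex.re_sum]
  refine Finset.sum_congr rfl fun t _ => ?_
  rw [show Complex.I * (t : ℂ) * (x : ℂ) = ((t * x : ℝ) : ℂ) * Complex.I by push_cast; ring,
    Complex.exp_ofReal_mul_I_re]

lemma sum_sin_eq (n : ℕ) (x : ℝ) :
    ∑ t ∈ Finset.Icc 1 n, Real.sin (t * x) = (dirichletSum n x).im := by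
  rw [dirichletSum, Complex.im_sum]
  refine Finset.sum_congr rfl fun t _ => ?_
  rw [show Complex.I * (t : ℂ) * (x : ℂ) = ((t * x : ℝ) : ℂ) * Complex.I by push_cast; ring,
    Complex.exp_ofReal_mul_I_im]

lemma sum_trigFn_eq_zero {n k : ℕ} (hk : 1 ≤ k) (hkn : k < n) (α : Bool) :
    ∑ t ∈ Finset.Icc 1 n, trigFn α (t * fourierFreq n k) = 0 := by
  have h : dirichletSum n (fourierFreq n k) = 0 := by
    have := dirichletSum_int_mul_eq_zero (n := n) (l := k) (by
      intro h
      have := Nat.le_of_dvd hk (Int.natCast_dvd_natCast.1 h)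
      omega)
    simpa [fourierFreq] using this
  cases α
  · simp only [trigFn, cond_false, sum_cos_eq, h, Complex.zero_re]
  · simp only [trigFn, cond_true, sum_sin_eq, h, Complex.zero_im]

/-- Product-to-sum formulas leave Dirichlet sums at `j + k` and `j - k`. The bound `j + k < n`
excludes aliasing: only `j - k = 0` is a multiple of `n`. -/
lemma sum_trigFn_mul_trigFn {n j k : ℕ} (hj : 1 ≤ j) (hk : 1 ≤ k) (hjk : j + k < n) (α β : Bool) :
    ∑ t ∈ Finset.Icc 1 n, trigFn α (t * fourierFreq n j) * trigFn β (t * fourierFreq n k) =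
      if α = β ∧ j = k then (n : ℝ) / 2 else 0 := by
  set x := fourierFreq n j
  set y := fourierFreq n k
  have hp : dirichletSum n (x + y) = 0 := by
    have := dirichletSum_int_mul_eq_zero (n := n) (l := (j + k : ℕ)) (by
      intro h
      have := Nat.le_of_dvd (by omega) (Int.natCast_dvd_natCast.1 h)
      omega)
    convert this using 2
    simp only [x, y, fourierFreq]; push_cast; ring
  have hm : dirichletSum n (x - y) = if j = k then (n : ℂ) else 0 := by
    split_ifs with h
    · have : x - y = 0 := by simp [x, y, h]
      simp [this, dirichletSum]
    · have := dirichletSum_int_mul_eq_zero (n := n) (l := (j - k : ℤ)) (by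
        intro h'
        have := Int.eq_zero_of_abs_lt_dvd h' (by rw [abs_lt]; omega)
        omega)
      convert this using 2
      simp only [x, y, fourierFreq]; push_cast; ring
  have cp : ∑ t ∈ Finset.Icc 1 n, Real.cos (t * (x + y)) = 0 := by rw [sum_cos_eq, hp]; simp
  have sp : ∑ t ∈ Finset.Icc 1 n, Real.sin (t * (x + y)) = 0 := by rw [sum_sin_eq, hp]; simp
  have cm : ∑ t ∈ Finset.Icc 1 n, Real.cos (t * (x - y)) = if j = k then (n : ℝ) else 0 := by
    rw [sum_cos_eq, hm]; split_ifs <;> simp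
  have sm : ∑ t ∈ Finset.Icc 1 n, Real.sin (t * (x - y)) = 0 := by
    rw [sum_sin_eq, hm]; split_ifs <;> simp
  cases α <;> cases β <;> simp only [trigFn, cond_false, cond_true, true_and, reduceCtorEq,
    false_and, if_false]
  · have e : ∀ t : ℕ, Real.cos (t * x) * Real.cos (t * y) =
        (Real.cos (t * (x - y)) + Real.cos (t * (x + y))) / 2 := fun t => by
      rw [mul_sub, mul_add, Real.cos_sub, Real.cos_add]; ring
    simp only [e, ← Finset.sum_div, Finset.sum_add_distrib, cp, cm]
    split_ifs <;> simp
  · have e : ∀ t : ℕ, Real.cos (t * x) * Real.sin (t * y) =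
        (Real.sin (t * (x + y)) - Real.sin (t * (x - y))) / 2 := fun t => by
      rw [mul_sub, mul_add, Real.sin_sub, Real.sin_add]; ring
    simp only [e, ← Finset.sum_div, Finset.sum_sub_distrib, sp, sm]
    simp
  · have e : ∀ t : ℕ, Real.sin (t * x) * Real.cos (t * y) =
        (Real.sin (t * (x + y)) + Real.sin (t * (x - y))) / 2 := fun t => by
      rw [mul_sub, mul_add, Real.sin_sub, Real.sin_add]; ring
    simp only [e, ← Finset.sum_div, Finset.sum_add_distrib, sp, sm]
    simp
  · have e : ∀ t : ℕ, Real.sin (t * x) * Real.sin (t * y) =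
        (Real.cos (t * (x - y)) - Real.cos (t * (x + y))) / 2 := fun t => by
      rw [mul_sub, mul_add, Real.cos_sub, Real.cos_add]; ring
    simp only [e, ← Finset.sum_div, Finset.sum_sub_distrib, cp, cm]
    split_ifs <;> simp

/-- The trigonometric polynomial `∑_{t=1}^n trig (t θ) e^{i (t + ℓ n) x}`. -/
noncomputable def trigPolynomial (n ℓ : ℕ) (α : Bool) (θ x : ℝ) : ℂ :=
  ∑ t ∈ Finset.Icc 1 n, (trigFn α (t * θ) : ℂ) *
    Complex.exp (Complex.I * (((t : ℤ) + (ℓ : ℤ) * (n : ℤ) : ℤ) : ℂ) * x)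

/-- The epoch enters through a factor of modulus one, so every bound on absolute values is uniform
in `ℓ`. -/
lemma trigPolynomial_false (n ℓ : ℕ) (θ x : ℝ) :
    trigPolynomial n ℓ false θ x = Complex.exp (Complex.I * ((ℓ * n * x : ℝ) : ℂ)) *
      ((dirichletSum n (x + θ) + dirichletSum n (x - θ)) / 2) := by
  unfold trigPolynomial dirichletSum trigFn
  rw [← Finset.sum_add_distrib, Finset.sum_div, Finset.mul_sum]
  refine Finset.sum_congr rfl fun t _ => ?_
  rw [cond_false, Complex.ofReal_cos, Complex.cos]
  rw [← mul_div_assoc, mul_add, ← Complex.exp_add, ← Complex.exp_add, div_mul_eq_mul_div, add_mul,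
    ← Complex.exp_add, ← Complex.exp_add]
  push_cast
  ring_nf

lemma trigPolynomial_true (n ℓ : ℕ) (θ x : ℝ) :
    trigPolynomial n ℓ true θ x = Complex.exp (Complex.I * ((ℓ * n * x : ℝ) : ℂ)) *
      ((dirichletSum n (x - θ) - dirichletSum n (x + θ)) * Complex.I / 2) := by
  unfold trigPolynomial dirichletSum trigFn
  rw [← Finset.sum_sub_distrib, Finset.sum_mul, Finset.sum_div, Finset.mul_sum]
  refine Finset.sum_congr rfl fun t _ => ?_
  rw [cond_true, Complex.ofReal_sin, Complex.sin]
  rw [← mul_div_assoc, ← mul_assoc, mul_sub, ← Complex.exp_add, ← Complex.exp_add,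
    div_mul_eq_mul_div, mul_right_comm, sub_mul (Complex.exp _),
    ← Complex.exp_add, ← Complex.exp_add]
  push_cast
  ring_nf

lemma norm_exp_I_mul_ofReal_eq_one (x : ℝ) : ‖Complex.exp (Complex.I * (x : ℂ))‖ = 1 := by
  rw [mul_comm, Complex.norm_exp_ofReal_mul_I]

lemma norm_trigPolynomial_le (n ℓ : ℕ) (α : Bool) (θ x : ℝ) :
    ‖trigPolynomial n ℓ α θ x‖ ≤ (‖dirichletSum n (x - θ)‖ + ‖dirichletSum n (x - -θ)‖) / 2 := by
  rw [sub_neg_eq_add]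
  cases α
  · rw [trigPolynomial_false, norm_mul, norm_exp_I_mul_ofReal_eq_one, one_mul, norm_div, add_comm]
    simpa using div_le_div_of_nonneg_right (norm_add_le _ _) two_pos.le
  · rw [trigPolynomial_true, norm_mul, norm_exp_I_mul_ofReal_eq_one, one_mul, norm_div, norm_mul,
      Complex.norm_I, mul_one]
    simpa using div_le_div_of_nonneg_right (norm_sub_le _ _) two_pos.le

/-- The parallelogram law removes the interference between the kernels at `θ` and `-θ`, which could
spoil a lower bound for the cosine or the sine alone. -/
lemma norm_sq_trigPolynomial_add (n ℓ : ℕ) (θ x : ℝ) :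
    ‖trigPolynomial n ℓ false θ x‖ ^ 2 + ‖trigPolynomial n ℓ true θ x‖ ^ 2 =
      (‖dirichletSum n (x + θ)‖ ^ 2 + ‖dirichletSum n (x - θ)‖ ^ 2) / 2 := by
  rw [trigPolynomial_false, trigPolynomial_true]
  simp only [norm_mul, norm_exp_I_mul_ofReal_eq_one, one_mul, norm_div, Complex.norm_I, mul_one,
    Complex.norm_ofNat]
  have h := parallelogram_law_with_norm ℝ (dirichletSum n (x + θ)) (dirichletSum n (x - θ))
  rw [norm_sub_rev (dirichletSum n (x - θ))]
  linarith

lemma continuous_trigPolynomial (n ℓ : ℕ) (α : Bool) (θ : ℝ) :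
    Continuous (trigPolynomial n ℓ α θ) := by
  unfold trigPolynomial; fun_prop

lemma integral_exp_int_mul (l : ℤ) :
    ∫ x in (-Real.pi)..Real.pi, Complex.exp (Complex.I * (l : ℂ) * (x : ℂ)) =
      if l = 0 then 2 * (Real.pi : ℂ) else 0 := by
  split_ifs with h
  · simp [h]; ring
  · have hc : Complex.I * (l : ℂ) ≠ 0 :=
      mul_ne_zero Complex.I_ne_zero (by exact_mod_cast h)
    rw [integral_exp_mul_complex hc, div_eq_zero_iff, sub_eq_zero]
    left
    rw [Complex.exp_eq_exp_iff_exists_int]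
    exact ⟨l, by push_cast; ring⟩

lemma conj_trigPolynomial (n ℓ : ℕ) (α : Bool) (θ x : ℝ) :
    (starRingEnd ℂ) (trigPolynomial n ℓ α θ x) = ∑ t ∈ Finset.Icc 1 n, (trigFn α (t * θ) : ℂ) *
      Complex.exp (-(Complex.I * (((t : ℤ) + (ℓ : ℤ) * (n : ℤ) : ℤ) : ℂ) * x)) := by
  unfold trigPolynomial
  rw [map_sum]
  refine Finset.sum_congr rfl fun t _ => ?_
  rw [map_mul, Complex.conj_ofReal, ← Complex.exp_conj]
  congr 2
  simp

/-- Only equal times survive integration over a period. Distinct epochs share no time, and within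
one epoch the discrete orthogonality of cosines and sines takes over. -/
lemma integral_trigPolynomial_mul_conj {n j k : ℕ} (hj : 1 ≤ j) (hk : 1 ≤ k) (hjk : j + k < n)
    (ℓ ℓ' : ℕ) (α β : Bool) :
    ∫ x in (-Real.pi)..Real.pi, trigPolynomial n ℓ α (fourierFreq n j) x *
        (starRingEnd ℂ) (trigPolynomial n ℓ' β (fourierFreq n k) x) =
      if ℓ = ℓ' ∧ α = β ∧ j = k then (Real.pi * n : ℂ) else 0 := by
  have e : ∀ x : ℝ, trigPolynomial n ℓ α (fourierFreq n j) x *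
        (starRingEnd ℂ) (trigPolynomial n ℓ' β (fourierFreq n k) x) =
      ∑ s ∈ Finset.Icc 1 n, ∑ t ∈ Finset.Icc 1 n,
        ((trigFn α (s * fourierFreq n j) * trigFn β (t * fourierFreq n k) : ℝ) : ℂ) *
        Complex.exp (Complex.I * (((s + ℓ * n) - (t + ℓ' * n) : ℤ) : ℂ) * x) := fun x => by
    rw [conj_trigPolynomial, trigPolynomial, Finset.sum_mul_sum]
    refine Finset.sum_congr rfl fun s _ => Finset.sum_congr rfl fun t _ => ?_
    rw [mul_mul_mul_comm, ← Complex.exp_add]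
    push_cast
    ring_nf
  simp only [e]
  rw [intervalIntegral.integral_finsetSum fun s _ =>
    Continuous.intervalIntegrable (by fun_prop) _ _]
  have e2 : ∀ s ∈ Finset.Icc 1 n, ∫ x in (-Real.pi)..Real.pi, ∑ t ∈ Finset.Icc 1 n,
        ((trigFn α (s * fourierFreq n j) * trigFn β (t * fourierFreq n k) : ℝ) : ℂ) *
        Complex.exp (Complex.I * (((s + ℓ * n) - (t + ℓ' * n) : ℤ) : ℂ) * x) =
      if ℓ = ℓ' then (2 * Real.pi *
        (trigFn α (s * fourierFreq n j) * trigFn β (s * fourierFreq n k) : ℝ) : ℂ) else 0 := by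
    intro s hs
    rw [intervalIntegral.integral_finsetSum fun t _ =>
      Continuous.intervalIntegrable (by fun_prop) _ _]
    simp only [intervalIntegral.integral_const_mul, integral_exp_int_mul]
    rw [Finset.sum_eq_single_of_mem s hs]
    · by_cases h : ℓ = ℓ'
      · subst h; simp; ring
      · have : ((s : ℤ) + ℓ * n - (s + ℓ' * n)) ≠ 0 := by
          have h2 : ((ℓ : ℤ) - ℓ') * n ≠ 0 :=
            mul_ne_zero (by omega) (by omega)
          intro h3; apply h2; linarith
        rw [if_neg this, if_neg h, mul_zero]
    · intro t ht hts
      rw [if_neg, mul_zero]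
      intro h
      rw [Finset.mem_Icc] at hs ht
      have h1 : (n : ℤ) ∣ (s : ℤ) - t := ⟨ℓ' - ℓ, by linarith⟩
      have := Int.eq_zero_of_abs_lt_dvd h1 (by rw [abs_lt]; omega)
      omega
  rw [Finset.sum_congr rfl e2]
  by_cases h : ℓ = ℓ'
  · simp only [h, if_true, true_and]
    rw [← Finset.mul_sum, ← Complex.ofReal_sum, sum_trigFn_mul_trigFn hj hk hjk]
    split_ifs
    · push_cast; ring
    · simp
  · simp [h]

end TrigonometricSums

/-! ### Covariances of the cosine and sine transforms -/

section TrigonometricTransform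

variable {Ω : Type*} [MeasurableSpace Ω] {P : Measure Ω} [IsProbabilityMeasure P] {X : ℤ → Ω → ℝ}
  {f : ℝ → ℝ}

/-- The cosine or sine transform of the epoch `ℓ` of length `n` at the frequency `θ`. -/
noncomputable def trigSum (X : ℤ → Ω → ℝ) (n ℓ : ℕ) (α : Bool) (θ : ℝ) (ω : Ω) : ℝ :=
  ∑ t ∈ Finset.Icc 1 n, trigFn α (t * θ) * X ((t : ℤ) + (ℓ : ℤ) * (n : ℤ)) ω

lemma memLp_trigSum (hX : ∀ t, MemLp (X t) 2 P) (n ℓ : ℕ) (α : Bool) (θ : ℝ) :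
    MemLp (trigSum X n ℓ α θ) 2 P :=
  memLp_finsetSum _ fun _ _ => (hX _).const_mul _

/-- The process need not be centred: its constant mean is annihilated at every nonzero Fourier
frequency. -/
lemma integral_trigSum (hstat : IsCovarianceStationary X P) {n k : ℕ} (hk : 1 ≤ k) (hkn : k < n)
    (ℓ : ℕ) (α : Bool) : ∫ ω, trigSum X n ℓ α (fourierFreq n k) ω ∂P = 0 := by
  unfold trigSum
  rw [integral_finsetSum _ fun t _ => ((hstat.memLp _).integrable one_le_two).const_mul _]
  simp only [integral_const_mul]
  rw [Finset.sum_congr rfl fun t _ => by rw [hstat.mean_eq _ 0], ← Finset.sum_mul,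
    sum_trigFn_eq_zero hk hkn, zero_mul]

lemma HasSpectralDensity.intervalIntegrable (hf : HasSpectralDensity X P f) :
    IntervalIntegrable f volume (-Real.pi) Real.pi := by
  rw [intervalIntegrable_iff_integrableOn_Icc_of_le (by linarith [Real.pi_pos])]
  exact hf.integrable

lemma HasSpectralDensity.intervalIntegrable_mul (hf : HasSpectralDensity X P f) {F : ℝ → ℂ}
    (hF : Continuous F) :
    IntervalIntegrable (fun x => F x * (f x : ℂ)) volume (-Real.pi) Real.pi :=
  IntervalIntegrable.continuousOn_mul (f := fun x => (f x : ℂ))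
    ⟨hf.intervalIntegrable.1.ofReal, hf.intervalIntegrable.2.ofReal⟩ hF.continuousOn

lemma covariance_trigSum (hf : HasSpectralDensity X P f) (hX : ∀ t, MemLp (X t) 2 P)
    (n ℓ ℓ' : ℕ) (α β : Bool) (θ θ' : ℝ) :
    ((cov[trigSum X n ℓ α θ, trigSum X n ℓ' β θ'; P] : ℝ) : ℂ) =
      ∫ x in (-Real.pi)..Real.pi, trigPolynomial n ℓ α θ x *
        (starRingEnd ℂ) (trigPolynomial n ℓ' β θ' x) * (f x : ℂ) := by
  have e : ∀ x : ℝ, trigPolynomial n ℓ α θ x *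
        (starRingEnd ℂ) (trigPolynomial n ℓ' β θ' x) * (f x : ℂ) =
      ∑ s ∈ Finset.Icc 1 n, ∑ t ∈ Finset.Icc 1 n,
        ((trigFn α (s * θ) * trigFn β (t * θ') : ℝ) : ℂ) *
        (Complex.exp (Complex.I * ((((s : ℤ) + ℓ * n : ℤ) : ℂ) - (((t : ℤ) + ℓ' * n : ℤ) : ℂ)) * x)
          * (f x : ℂ)) := fun x => by
    rw [conj_trigPolynomial, trigPolynomial, Finset.sum_mul_sum, Finset.sum_mul]
    refine Finset.sum_congr rfl fun s _ => ?_
    rw [Finset.sum_mul]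
    refine Finset.sum_congr rfl fun t _ => ?_
    rw [mul_mul_mul_comm, ← Complex.exp_add, mul_assoc]
    push_cast
    ring_nf
  have hi : ∀ s t : ℕ, IntervalIntegrable (fun x : ℝ =>
      ((trigFn α (s * θ) * trigFn β (t * θ') : ℝ) : ℂ) *
        (Complex.exp (Complex.I * ((((s : ℤ) + ℓ * n : ℤ) : ℂ) - (((t : ℤ) + ℓ' * n : ℤ) : ℂ)) * x)
          * (f x : ℂ))) volume (-Real.pi) Real.pi := fun s t =>
    (hf.intervalIntegrable_mul (by fun_prop)).const_mul _
  simp only [e]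
  rw [intervalIntegral.integral_finsetSum fun s _ => by
    have h := IntervalIntegrable.sum (Finset.Icc 1 n) fun t _ => hi s t
    rwa [Finset.sum_fn] at h]
  unfold trigSum
  rw [covariance_fun_sum_fun_sum' (fun i _ => (hX _).const_mul _) (fun i _ => (hX _).const_mul _),
    Complex.ofReal_sum]
  refine Finset.sum_congr rfl fun s _ => ?_
  rw [intervalIntegral.integral_finsetSum fun t _ => hi s t, Complex.ofReal_sum]
  refine Finset.sum_congr rfl fun t _ => ?_
  rw [intervalIntegral.integral_const_mul, ← hf.cov_eq, covariance_const_mul_left,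
    covariance_const_mul_right]
  push_cast
  ring

lemma variance_trigSum_add (hf : HasSpectralDensity X P f) (hX : ∀ t, MemLp (X t) 2 P)
    (n ℓ : ℕ) (θ : ℝ) :
    Var[trigSum X n ℓ false θ; P] + Var[trigSum X n ℓ true θ; P] =
      ∫ x in (-Real.pi)..Real.pi,
        (‖dirichletSum n (x + θ)‖ ^ 2 + ‖dirichletSum n (x - θ)‖ ^ 2) / 2 * f x := by
  have h : ∀ α, Var[trigSum X n ℓ α θ; P] =
      ∫ x in (-Real.pi)..Real.pi, ‖trigPolynomial n ℓ α θ x‖ ^ 2 * f x := fun α => by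
    have h1 := covariance_trigSum hf hX n ℓ ℓ α α θ θ
    rw [covariance_self (memLp_trigSum hX n ℓ α θ).aemeasurable] at h1
    have h2 : ((∫ x in (-Real.pi)..Real.pi, ‖trigPolynomial n ℓ α θ x‖ ^ 2 * f x : ℝ) : ℂ) =
        ∫ x in (-Real.pi)..Real.pi, trigPolynomial n ℓ α θ x *
        (starRingEnd ℂ) (trigPolynomial n ℓ α θ x) * (f x : ℂ) := by
      rw [← intervalIntegral.integral_ofReal]
      refine intervalIntegral.integral_congr fun x _ => ?_
      simp only [Complex.mul_conj, Complex.normSq_eq_norm_sq]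
      push_cast
      rfl
    exact_mod_cast h1.trans h2.symm
  have hi : ∀ α, IntervalIntegrable (fun x => ‖trigPolynomial n ℓ α θ x‖ ^ 2 * f x) volume
      (-Real.pi) Real.pi := fun α =>
    hf.intervalIntegrable.continuousOn_mul
      ((continuous_trigPolynomial n ℓ α θ).norm.pow 2).continuousOn
  rw [h, h, ← intervalIntegral.integral_add (hi false) (hi true)]
  refine intervalIntegral.integral_congr fun x _ => ?_
  simp only [← add_mul, norm_sq_trigPolynomial_add]

/-- On an interval of length `1/n` starting at `θ` the Dirichlet kernel is at least `n / 2`; the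
rest of the integral is discarded by positivity. -/
lemma le_variance_trigSum_add (hf : HasSpectralDensity X P f) (hX : ∀ t, MemLp (X t) 2 P)
    {n : ℕ} (hn : 1 ≤ n) (ℓ : ℕ) {θ c : ℝ} (hθ : 0 ≤ θ) (hθn : θ + 1 / n ≤ Real.pi)
    (hc : 0 ≤ c) (hcf : ∀ x ∈ Set.Icc θ (θ + 1 / n), c ≤ f x) :
    c * n / 8 ≤ Var[trigSum X n ℓ false θ; P] + Var[trigSum X n ℓ true θ; P] := by
  have hpi := Real.pi_pos
  have hn' : (0 : ℝ) < n := by exact_mod_cast hn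
  have hn1 : (0 : ℝ) < 1 / n := by positivity
  rw [variance_trigSum_add hf hX]
  set F : ℝ → ℝ := fun x =>
    (‖dirichletSum n (x + θ)‖ ^ 2 + ‖dirichletSum n (x - θ)‖ ^ 2) / 2 * f x with hF
  have hcD := continuous_dirichletSum n
  have hFi : IntervalIntegrable F volume (-Real.pi) Real.pi :=
    hf.intervalIntegrable.continuousOn_mul (Continuous.continuousOn (by fun_prop))
  have hsub : Set.Icc θ (θ + 1 / n) ⊆ Set.Icc (-Real.pi) Real.pi :=
    Set.Icc_subset_Icc (by linarith) hθn
  have hF' : IntervalIntegrable F volume θ (θ + 1 / n) := by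
    refine hFi.mono_set ?_
    rwa [Set.uIcc_of_le (by linarith), Set.uIcc_of_le (by linarith)]
  calc c * n / 8 = ∫ _x in θ..(θ + 1 / n), c * n ^ 2 / 8 := by
        rw [intervalIntegral.integral_const, smul_eq_mul]; field_simp; ring
    _ ≤ ∫ x in θ..(θ + 1 / n), F x := by
        refine intervalIntegral.integral_mono_on (by linarith) (by simp) hF' fun x hx => ?_
        have h1 : (n : ℝ) / 2 ≤ ‖dirichletSum n (x - θ)‖ := by
          refine half_le_norm_dirichletSum n ?_
          rw [abs_of_nonneg (by linarith [hx.1])]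
          calc (n : ℝ) * (x - θ) ≤ n * (1 / n) := by gcongr; linarith [hx.2]
            _ = 1 := by field_simp
        have h2 : ((n : ℝ) / 2) ^ 2 ≤ ‖dirichletSum n (x - θ)‖ ^ 2 :=
          pow_le_pow_left₀ (by positivity) h1 2
        have h3 := hcf x hx
        calc c * n ^ 2 / 8 = ((n : ℝ) / 2) ^ 2 / 2 * c := by ring
          _ ≤ F x := by
            simp only [hF]
            refine mul_le_mul ?_ h3 hc (by positivity)
            linarith [sq_nonneg ‖dirichletSum n (x + θ)‖]
    _ ≤ _ := by
        refine intervalIntegral.integral_mono_interval (by linarith) (by linarith) hθn ?_ hFi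
        filter_upwards [ae_restrict_mem measurableSet_Ioc] with x hx
        exact mul_nonneg (by positivity) (hf.nonneg x ⟨hx.1.le, hx.2⟩)

lemma isGaussianProcess_trigSum (hX : IsGaussianProcess X P) {S : Type*} (c : S → ℝ) (n : ℕ)
    (ℓ : S → ℕ) (α : S → Bool) (θ : S → ℝ) :
    IsGaussianProcess (fun s ω => c s * trigSum X n (ℓ s) (α s) (θ s) ω) P := by
  classical
  refine hX.of_isGaussianProcess fun s =>
    ⟨(Finset.Icc 1 n).image fun t : ℕ => (t : ℤ) + (ℓ s : ℤ) * (n : ℤ),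
      c s • ∑ t : Finset.Icc 1 n, trigFn (α s) ((t : ℕ) * θ s) •
        ContinuousLinearMap.proj (R := ℝ) (⟨((t : ℕ) : ℤ) + (ℓ s : ℤ) * (n : ℤ),
          Finset.mem_image_of_mem _ t.2⟩ :
            ((Finset.Icc 1 n).image fun t : ℕ => (t : ℤ) + (ℓ s : ℤ) * (n : ℤ))), fun ω => ?_⟩
  simp only [trigSum, smul_apply, sum_apply,
    ContinuousLinearMap.proj_apply, Finset.restrict, smul_eq_mul]
  congr 1
  rw [← Finset.sum_coe_sort]

variable {d μ ν : ℝ} {fstar : ℝ → ℝ}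

lemma fourierFreq_pos {n k : ℕ} (hn : 1 ≤ n) (hk : 1 ≤ k) : 0 < fourierFreq n k := by
  have : (0 : ℝ) < n := by exact_mod_cast hn
  have : (0 : ℝ) < k := by exact_mod_cast hk
  have := Real.pi_pos
  unfold fourierFreq; positivity

lemma fourierFreq_mono (n : ℕ) {j k : ℕ} (h : k ≤ j) : fourierFreq n k ≤ fourierFreq n j := by
  unfold fourierFreq
  have := Real.pi_pos
  gcongr

/-- By exact orthogonality the target value is the integral of the same product against the constant
`f(ω_j)`, so the error is an integral of an increment of `f`. The reference point is the larger of
the two frequencies, as the kernel estimate requires. -/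
lemma abs_covariance_trigSum_sub_le (hL : LocalLipschitz μ ν fstar) (hν : 0 < ν)
    (hd : |2 * d| < 1) (hf : HasSpectralDensity X P (memorySpectralDensity d fstar))
    (hX : ∀ t, MemLp (X t) 2 P) {n j k : ℕ} (hk : 1 ≤ k) (hkj : k ≤ j) (hjn : 4 * j ≤ n)
    (ℓ ℓ' : ℕ) (α β : Bool) :
    |cov[trigSum X n ℓ α (fourierFreq n j), trigSum X n ℓ' β (fourierFreq n k); P] -
      (if ℓ = ℓ' ∧ α = β ∧ j = k then
        memorySpectralDensity d fstar (fourierFreq n j) * (Real.pi * n) else 0)| ≤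
      2176 * (μ * fstar 0) * ((2 / (-2 * d + 1) + 2 / (1 - -2 * d) + 6) *
        (fourierFreq n j ^ (-2 * d) + fourierFreq n k ^ (-2 * d)) / fourierFreq n j *
        (1 + Real.log (1 + n * (2 * fourierFreq n j)))) := by
  have hpi := Real.pi_pos
  have hn : (0 : ℝ) < n := by exact_mod_cast (by omega : 0 < n)
  set a := fourierFreq n j with ha
  set b := fourierFreq n k with hb
  have ha0 : 0 < a := fourierFreq_pos (by omega) (by omega)
  have hb0 : 0 < b := fourierFreq_pos (by omega) hk
  have hba : b ≤ a := fourierFreq_mono n hkj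
  have haπ : a ≤ Real.pi / 2 := by
    have : (4 * j : ℝ) ≤ n := by exact_mod_cast hjn
    rw [ha, fourierFreq, div_le_div_iff₀ hn two_pos]
    nlinarith
  set f := memorySpectralDensity d fstar with hfdef
  set E := 2176 * (μ * fstar 0) * ((2 / (-2 * d + 1) + 2 / (1 - -2 * d) + 6) *
        (a ^ (-2 * d) + b ^ (-2 * d)) / a * (1 + Real.log (1 + n * (2 * a)))) with hE
  have hbound : ∀ u w : ℝ, |u| = a → |w| = b → ∫ x in (-Real.pi)..Real.pi,
      |f x - f a| * ‖dirichletSum n (x - u)‖ * ‖dirichletSum n (x - w)‖ ≤ E := by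
    intro u w hu hw
    have h := integral_spectral_increment_le hL hν hd hf.intervalIntegrable n (u := u) (w := w)
      (abs_pos.1 (hw ▸ hb0)) (by rw [hu]; exact haπ) (by rw [hu, hw]; exact hba)
    rwa [hu, hw] at h
  have hcD := continuous_dirichletSum n
  have hint : ∀ u w : ℝ, IntervalIntegrable (fun x => |f x - f a| * ‖dirichletSum n (x - u)‖ *
      ‖dirichletSum n (x - w)‖) volume (-Real.pi) Real.pi := fun u w =>
    IntervalIntegrable.mul_continuousOn (IntervalIntegrable.mul_continuousOn
      ((hf.intervalIntegrable.sub intervalIntegrable_const).abs)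
        (Continuous.continuousOn (by fun_prop))) (Continuous.continuousOn (by fun_prop))
  set A := trigPolynomial n ℓ α a
  set B := trigPolynomial n ℓ' β b
  have hcA : Continuous A := continuous_trigPolynomial n ℓ α a
  have hcB : Continuous B := continuous_trigPolynomial n ℓ' β b
  have hcAB : Continuous fun x => A x * (starRingEnd ℂ) (B x) :=
    hcA.mul (Complex.continuous_conj.comp hcB)
  have key : ((cov[trigSum X n ℓ α a, trigSum X n ℓ' β b; P] -
      (if ℓ = ℓ' ∧ α = β ∧ j = k then f a * (Real.pi * n) else 0) : ℝ) : ℂ) =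
      ∫ x in (-Real.pi)..Real.pi, A x * (starRingEnd ℂ) (B x) * ((f x - f a : ℝ) : ℂ) := by
    have h1 := covariance_trigSum hf hX n ℓ ℓ' α β a b
    have h2 := integral_trigPolynomial_mul_conj (n := n) (j := j) (k := k) (by omega) hk (by omega)
      ℓ ℓ' α β
    have h3 : (((if ℓ = ℓ' ∧ α = β ∧ j = k then f a * (Real.pi * n) else 0 : ℝ)) : ℂ) =
        ∫ x in (-Real.pi)..Real.pi, A x * (starRingEnd ℂ) (B x) * (f a : ℂ) := by
      rw [intervalIntegral.integral_mul_const]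
      simp only [A, B, ha, hb] at h2 ⊢
      rw [h2]
      split_ifs <;> push_cast <;> ring
    rw [Complex.ofReal_sub, h1, h3, ← intervalIntegral.integral_sub
      (hf.intervalIntegrable_mul hcAB) (Continuous.intervalIntegrable (by fun_prop) _ _)]
    refine intervalIntegral.integral_congr fun x _ => ?_
    simp only [A, B]
    push_cast
    ring
  rw [← Real.norm_eq_abs, ← Complex.norm_real, key]
  have i1 := hint a b
  have i2 := hint a (-b)
  have i3 := hint (-a) b
  have i4 := hint (-a) (-b)
  -- Each polynomial is bounded by half the sum of two kernels, at plus and minus its frequency. The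
  -- four products of kernels obey the same bound `E`, and the factor `1/4` makes up for their
  -- number.
  calc _ ≤ ∫ x in (-Real.pi)..Real.pi,
        ‖A x * (starRingEnd ℂ) (B x) * ((f x - f a : ℝ) : ℂ)‖ :=
        intervalIntegral.norm_integral_le_integral_norm (by linarith)
    _ ≤ ∫ x in (-Real.pi)..Real.pi,
        (|f x - f a| * ‖dirichletSum n (x - a)‖ * ‖dirichletSum n (x - b)‖ +
        |f x - f a| * ‖dirichletSum n (x - a)‖ * ‖dirichletSum n (x - -b)‖ +
        |f x - f a| * ‖dirichletSum n (x - -a)‖ * ‖dirichletSum n (x - b)‖ +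
        |f x - f a| * ‖dirichletSum n (x - -a)‖ * ‖dirichletSum n (x - -b)‖) * (1 / 4) := by
        refine intervalIntegral.integral_mono_on (by linarith) ?_
          ((((i1.add i2).add i3).add i4).mul_const _) fun x _ => ?_
        · have := (hf.intervalIntegrable.sub (intervalIntegrable_const (c := f a))).abs
          have h := this.continuousOn_mul (g := fun x => ‖A x * (starRingEnd ℂ) (B x)‖)
            hcAB.norm.continuousOn
          refine h.congr fun x _ => ?_
          simp only [norm_mul, Complex.norm_real, Real.norm_eq_abs]
        · rw [norm_mul, norm_mul, Complex.norm_real, Real.norm_eq_abs, RCLike.norm_conj]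
          have h1 := norm_trigPolynomial_le n ℓ α a x
          have h2 := norm_trigPolynomial_le n ℓ' β b x
          calc ‖A x‖ * ‖B x‖ * |f x - f a| ≤
              ((‖dirichletSum n (x - a)‖ + ‖dirichletSum n (x - -a)‖) / 2) *
              ((‖dirichletSum n (x - b)‖ + ‖dirichletSum n (x - -b)‖) / 2) * |f x - f a| := by
                gcongr
            _ = _ := by ring
    _ ≤ (E + E + E + E) * (1 / 4) := by
        rw [intervalIntegral.integral_mul_const,
          intervalIntegral.integral_add ((i1.add i2).add i3) i4,
          intervalIntegral.integral_add (i1.add i2) i3, intervalIntegral.integral_add i1 i2]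
        have ea : |a| = a := abs_of_pos ha0
        have eb : |b| = b := abs_of_pos hb0
        gcongr
        · exact hbound _ _ ea eb
        · exact hbound _ _ ea (by rw [abs_neg, eb])
        · exact hbound _ _ (by rw [abs_neg, ea]) eb
        · exact hbound _ _ (by rw [abs_neg, ea]) (by rw [abs_neg, eb])
    _ = E := by ring

end TrigonometricTransform

/-! ### The normalised array and the averaged periodogram -/

section NormalisedTransforms

variable {Ω : Type*} [MeasurableSpace Ω] {P : Measure Ω} [IsProbabilityMeasure P] {X : ℤ → Ω → ℝ}
  {d μ ν : ℝ} {fstar : ℝ → ℝ}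

/-- With `r = a / b ≥ 1` this is `r ^ p + 1 ≤ 2 r ^ ((1 + p) / 2)`: for `|p| ≤ 1` the exponent on
the right dominates both `p` and `0`. -/
lemma rpow_add_rpow_le {p a b : ℝ} (hp : |p| ≤ 1) (hb : 0 < b) (hba : b ≤ a) :
    a ^ p + b ^ p ≤ 2 * (√(a / b) * √(a ^ p * b ^ p)) := by
  obtain ⟨hp1, hp2⟩ := abs_le.1 hp
  have ha : 0 < a := hb.trans_le hba
  set r := a / b with hr
  have hr1 : 1 ≤ r := (one_le_div hb).2 hba
  have hr0 : 0 < r := by positivity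
  have har : a ^ p = r ^ p * b ^ p := by
    rw [hr, Real.div_rpow ha.le hb.le]; field_simp
  have hbp : 0 < b ^ p := by positivity
  have e : √r * √(a ^ p * b ^ p) = r ^ ((1 + p) / 2) * b ^ p := by
    rw [har, mul_assoc, Real.sqrt_mul (by positivity), Real.sqrt_mul_self hbp.le, ← mul_assoc]
    congr 1
    rw [Real.sqrt_eq_rpow, Real.sqrt_eq_rpow, ← Real.rpow_mul hr0.le, ← Real.rpow_add hr0]
    congr 1; ring
  rw [e, har]
  have h1 : r ^ p ≤ r ^ ((1 + p) / 2) := Real.rpow_le_rpow_of_exponent_le hr1 (by linarith)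
  have h2 : 1 ≤ r ^ ((1 + p) / 2) := Real.one_le_rpow hr1 (by linarith)
  nlinarith

lemma half_rpow_le_rpow {p θ x : ℝ} (hp : |p| ≤ 1) (hθ : 0 < θ) (h1 : θ ≤ x) (h2 : x ≤ 2 * θ) :
    θ ^ p / 2 ≤ x ^ p := by
  obtain ⟨hp1, hp2⟩ := abs_le.1 hp
  have hθp : 0 < θ ^ p := by positivity
  rcases le_total 0 p with h | h
  · have := Real.rpow_le_rpow hθ.le h1 h
    linarith
  · have h3 : (2 * θ) ^ p ≤ x ^ p := Real.rpow_le_rpow_of_nonpos (hθ.trans_le h1) h2 h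
    have h4 : (2 : ℝ) ^ (-1 : ℝ) ≤ 2 ^ p := Real.rpow_le_rpow_of_exponent_le one_le_two hp1
    rw [Real.mul_rpow two_pos.le hθ.le] at h3
    rw [Real.rpow_neg_one] at h4
    nlinarith

lemma one_add_log_one_add_four_pi_mul_le {j : ℕ} (hj : 1 ≤ j) :
    1 + Real.log (1 + 4 * Real.pi * j) ≤ 4 * (1 + Real.log j) := by
  have hj' : (1 : ℝ) ≤ j := by exact_mod_cast hj
  have h0 : 0 ≤ Real.log j := Real.log_nonneg hj'
  have hpi := Real.pi_lt_d2
  have hpi0 := Real.pi_pos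
  have h1 : Real.log (1 + 4 * Real.pi * j) ≤ Real.log (2 ^ 4 * j) :=
    Real.log_le_log (by positivity) (by nlinarith)
  rw [Real.log_mul (by positivity) (by positivity), Real.log_pow] at h1
  have := Real.log_two_lt_d9
  push_cast at h1
  linarith

/-- The array of the cosine and sine transforms of the epochs, divided by `(π n f(ω_k))^{1/2}`. -/
noncomputable def normalisedTrig (X : ℤ → Ω → ℝ) (f : ℝ → ℝ) (g n M k : ℕ) (i : Fin g × Bool)
    (ω : Ω) : ℝ :=
  (if k ∈ Finset.Icc 1 M then (√(Real.pi * n * f (fourierFreq n k)))⁻¹ else 0) *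
    trigSum X n i.1 i.2 (fourierFreq n k) ω

lemma isGaussianProcess_normalisedTrig (hX : IsGaussianProcess X P) (f : ℝ → ℝ) (g n M : ℕ) :
    IsGaussianProcess
      (fun p : ℕ × (Fin g × Bool) => normalisedTrig X f g n M p.1 p.2) P :=
  isGaussianProcess_trigSum hX _ n _ _ _

/-- The value zero outside `1, …, M` makes the whole array centred, as `exists_isWeaklyCorrelated`
asks; at `k = 0` the mean of the process would otherwise survive. -/
lemma integral_normalisedTrig (hstat : IsCovarianceStationary X P) (f : ℝ → ℝ) {g n M : ℕ}
    (hM : M < n) (k : ℕ) (i : Fin g × Bool) : ∫ ω, normalisedTrig X f g n M k i ω ∂P = 0 := by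
  unfold normalisedTrig
  rw [integral_const_mul]
  split_ifs with h
  · rw [Finset.mem_Icc] at h
    rw [integral_trigSum hstat h.1 (by omega), mul_zero]
  · rw [zero_mul]

lemma covariance_normalisedTrig (f : ℝ → ℝ) {g n M j k : ℕ}
    (hj : j ∈ Finset.Icc 1 M) (hk : k ∈ Finset.Icc 1 M) (i i' : Fin g × Bool) :
    cov[normalisedTrig X f g n M j i, normalisedTrig X f g n M k i'; P] =
      (√(Real.pi * n * f (fourierFreq n j)))⁻¹ * ((√(Real.pi * n * f (fourierFreq n k)))⁻¹ *
      cov[trigSum X n i.1 i.2 (fourierFreq n j), trigSum X n i'.1 i'.2 (fourierFreq n k); P]) := by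
  unfold normalisedTrig
  rw [if_pos hj, if_pos hk, covariance_const_mul_left, covariance_const_mul_right]

/-- The constant in the approximate orthonormality of the normalised transforms. -/
noncomputable def orthonormalityConst (d μ : ℝ) : ℝ :=
  2176 * μ * (2 / (-2 * d + 1) + 2 / (1 - -2 * d) + 6) * 8 / Real.pi ^ 2

lemma orthonormalityConst_nonneg (hμ : 0 ≤ μ) (hd : |2 * d| < 1) : 0 ≤ orthonormalityConst d μ := by
  obtain ⟨h1, h2⟩ := abs_lt.1 hd
  have : 0 < -2 * d + 1 := by linarith
  have : 0 < 1 - -2 * d := by linarith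
  have := Real.pi_pos
  unfold orthonormalityConst
  positivity

lemma memorySpectralDensity_pos {θ : ℝ} (hθ : 0 < θ) (h : 0 < fstar θ) :
    0 < memorySpectralDensity d fstar θ := by
  unfold memorySpectralDensity
  have := abs_pos.2 hθ.ne'
  positivity

/-- After division by the standard deviations the two powers contribute at most `2 √(j / k)`, and
the remaining factor `1 / (n ω_j)` is `1 / (2π j)`; their product has order `1 / √(jk)`. The
logarithm is of order `1 + log j` because `n ω_j = 2π j`. -/
lemma abs_covariance_normalisedTrig_sub_le (hL : LocalLipschitz μ ν fstar) (hν : 0 < ν)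
    (hμ : 0 ≤ μ) (hd : |2 * d| < 1) (hf : HasSpectralDensity X P (memorySpectralDensity d fstar))
    (hX : ∀ t, MemLp (X t) 2 P) (hf0 : 0 < fstar 0) {g n M j k : ℕ} (hMn : 4 * M ≤ n)
    (hlow : ∀ x, 0 ≤ x → x ≤ fourierFreq n M → fstar 0 / 2 ≤ fstar x)
    (hk : 1 ≤ k) (hkj : k ≤ j) (hj : j ≤ M) (i i' : Fin g × Bool) :
    |cov[normalisedTrig X (memorySpectralDensity d fstar) g n M j i,
        normalisedTrig X (memorySpectralDensity d fstar) g n M k i'; P] -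
      (if j = k ∧ i = i' then 1 else 0)| ≤
      orthonormalityConst d μ * (1 + Real.log j) / √(j * k) := by
  obtain ⟨hd1, hd2⟩ := abs_lt.1 hd
  have hpi := Real.pi_pos
  have hn : (0 : ℝ) < n := by exact_mod_cast (by omega : 0 < n)
  have hj0 : (0 : ℝ) < j := by exact_mod_cast (by omega : 0 < j)
  have hk0 : (0 : ℝ) < k := by exact_mod_cast (by omega : 0 < k)
  have main := abs_covariance_trigSum_sub_le hL hν hd hf hX hk hkj (by omega : 4 * j ≤ n)
    i.1 i'.1 i.2 i'.2
  rw [covariance_normalisedTrig _ (Finset.mem_Icc.2 ⟨by omega, hj⟩)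
    (Finset.mem_Icc.2 ⟨hk, by omega⟩)]
  set a := fourierFreq n j with ha
  set b := fourierFreq n k with hb
  set f := memorySpectralDensity d fstar with hfdef
  have ha0 : 0 < a := fourierFreq_pos (by omega) (by omega)
  have hb0 : 0 < b := fourierFreq_pos (by omega) hk
  have hba : b ≤ a := fourierFreq_mono n hkj
  have haM : a ≤ fourierFreq n M := fourierFreq_mono n hj
  have hfa := hlow a ha0.le haM
  have hfb := hlow b hb0.le (hba.trans haM)
  have hfa0 : 0 < f a := memorySpectralDensity_pos ha0 (by linarith)
  have hfb0 : 0 < f b := memorySpectralDensity_pos hb0 (by linarith)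
  set p := -2 * d with hp
  have hp1 : |p| ≤ 1 := by rw [hp, neg_mul, abs_neg]; exact hd.le
  set S := √(a ^ p * b ^ p) with hS
  have hap : 0 < a ^ p := by positivity
  have hbp : 0 < b ^ p := by positivity
  have hS0 : 0 < S := Real.sqrt_pos.2 (by positivity)
  set N := √(Real.pi * n * f a) * √(Real.pi * n * f b) with hN
  have hN0 : 0 < N := by positivity
  have hNlow : Real.pi * n * (S * (fstar 0 / 2)) ≤ N := by
    rw [hN, ← Real.sqrt_mul (by positivity)]
    refine Real.le_sqrt_of_sq_le ?_
    have e : (Real.pi * n * (S * (fstar 0 / 2))) ^ 2 =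
        (Real.pi * n) ^ 2 * ((a ^ p * (fstar 0 / 2)) * (b ^ p * (fstar 0 / 2))) := by
      rw [mul_pow, mul_pow S, hS, Real.sq_sqrt (by positivity)]; ring
    rw [e]
    have h1 : a ^ p * (fstar 0 / 2) ≤ f a := by
      rw [hfdef, memorySpectralDensity, abs_of_pos ha0]; gcongr
    have h2 : b ^ p * (fstar 0 / 2) ≤ f b := by
      rw [hfdef, memorySpectralDensity, abs_of_pos hb0]; gcongr
    calc _ ≤ (Real.pi * n) ^ 2 * (f a * f b) := by gcongr
      _ = _ := by ring
  set V := cov[trigSum X n i.1 i.2 a, trigSum X n i'.1 i'.2 b; P]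
  have e1 : (√(Real.pi * n * f a))⁻¹ * ((√(Real.pi * n * f b))⁻¹ * V) -
      (if j = k ∧ i = i' then 1 else 0) = N⁻¹ * (V - if (i.1 : ℕ) = i'.1 ∧ i.2 = i'.2 ∧ j = k then
        f a * (Real.pi * n) else 0) := by
    have hiff : ((i.1 : ℕ) = i'.1 ∧ i.2 = i'.2 ∧ j = k) ↔ (j = k ∧ i = i') := by
      rw [Prod.ext_iff, Fin.ext_iff]; tauto
    simp only [hiff]
    rw [hN, mul_inv]
    split_ifs with h
    · have hab : b = a := by rw [ha, hb, h.1]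
      have hs : √(Real.pi * n * f a) * √(Real.pi * n * f a) = Real.pi * n * f a :=
        Real.mul_self_sqrt (by positivity)
      rw [hab, mul_sub, ← mul_inv, ← mul_assoc, ← mul_inv, hs]
      congr 1
      field_simp
    · ring
  rw [e1, abs_mul, abs_of_pos (inv_pos.2 hN0), inv_mul_le_iff₀ hN0]
  refine main.trans ?_
  have hna : n * (2 * a) = 4 * Real.pi * j := by
    rw [ha, fourierFreq]; field_simp; ring
  have hlog := one_add_log_one_add_four_pi_mul_le (by omega : 1 ≤ j)
  have hlog0 : 0 ≤ 1 + Real.log j := by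
    have := Real.log_nonneg (show (1 : ℝ) ≤ j by exact_mod_cast (by omega : 1 ≤ j)); linarith
  have hsum := rpow_add_rpow_le hp1 hb0 hba
  have hab : a / b = j / k := by rw [ha, hb, fourierFreq, fourierFreq]; field_simp
  rw [hab, ← hS] at hsum
  have hjk : √((j : ℝ) / k) = j / √(j * k) := by
    rw [Real.sqrt_div hj0.le, Real.sqrt_mul hj0.le, div_eq_div_iff (by positivity) (by positivity)]
    rw [← mul_assoc, Real.mul_self_sqrt hj0.le]
  rw [hna]
  set K := 2 / (p + 1) + 2 / (1 - p) + 6 with hK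
  have hK0 : 0 ≤ K := by
    have : 0 < p + 1 := by linarith
    have : 0 < 1 - p := by linarith
    positivity
  have hlog1 : 0 ≤ 1 + Real.log (1 + 4 * Real.pi * j) := by
    have := Real.log_nonneg (show (1 : ℝ) ≤ 1 + 4 * Real.pi * j by
      have : 0 ≤ 4 * Real.pi * j := by positivity
      linarith)
    linarith
  calc 2176 * (μ * fstar 0) * (K * (a ^ p + b ^ p) / a * (1 + Real.log (1 + 4 * Real.pi * j)))
      ≤ 2176 * (μ * fstar 0) * (K * (2 * (√((j : ℝ) / k) * S)) / a * (4 * (1 + Real.log j))) := by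
        gcongr
    _ = (Real.pi * n * (S * (fstar 0 / 2))) *
        (orthonormalityConst d μ * (1 + Real.log j) / √(j * k)) := by
        rw [orthonormalityConst, ← hp, ← hK, hjk, ha, fourierFreq]
        field_simp
        ring
    _ ≤ _ := by
        refine mul_le_mul_of_nonneg_right hNlow ?_
        have := orthonormalityConst_nonneg hμ hd
        positivity

/-- This nondegeneracy serves the lowest frequencies, where near orthonormality says nothing. Since
`1/n ≤ ω_k`, the interval `[ω_k, ω_k + 1/n]` lies in `[ω_k, 2 ω_k]`, where `f` is comparable to its
value at `ω_k`. The two variances have a sum bounded below, so one of them is at least half of that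
bound. -/
lemma exists_le_variance_normalisedTrig (hL : LocalLipschitz μ ν fstar)
    (hμ : 0 < μ) (hd : |2 * d| < 1) (hf : HasSpectralDensity X P (memorySpectralDensity d fstar))
    (hX : ∀ t, MemLp (X t) 2 P) (hf0 : 0 < fstar 0) {g n M k : ℕ} (hg : 1 ≤ g) (hMn : 4 * M ≤ n)
    (hlow : ∀ x, 0 ≤ x → x ≤ 2 * fourierFreq n M → fstar 0 / 2 ≤ fstar x)
    (hk : 1 ≤ k) (hkM : k ≤ M) :
    ∃ i : Fin g × Bool, 1 / (64 * Real.pi * μ) ≤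
      Var[normalisedTrig X (memorySpectralDensity d fstar) g n M k i; P] := by
  obtain ⟨hd1, hd2⟩ := abs_lt.1 hd
  have hpi := Real.pi_pos
  have hn : (0 : ℝ) < n := by exact_mod_cast (by omega : 0 < n)
  have hk0 : (1 : ℝ) ≤ k := by exact_mod_cast hk
  set θ := fourierFreq n k with hθdef
  set f := memorySpectralDensity d fstar with hfdef
  have hθ : 0 < θ := fourierFreq_pos (by omega) hk
  have hθM : θ ≤ fourierFreq n M := fourierFreq_mono n hkM
  have hθn : 1 / (n : ℝ) ≤ θ := by
    rw [hθdef, fourierFreq]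
    gcongr
    nlinarith [Real.pi_gt_three]
  have hθπ : 2 * θ ≤ Real.pi := by
    have : (4 * k : ℝ) ≤ n := by exact_mod_cast (by omega : 4 * k ≤ n)
    rw [hθdef, fourierFreq, ← mul_div_assoc, div_le_iff₀ hn]
    nlinarith
  set p := -2 * d with hp
  have hp1 : |p| ≤ 1 := by rw [hp, neg_mul, abs_neg]; exact hd.le
  have hθp : 0 < θ ^ p := by positivity
  have hfθ0 : 0 < f θ := memorySpectralDensity_pos hθ (by linarith [hlow θ hθ.le (by linarith)])
  have hfθ : f θ ≤ θ ^ p * (μ * fstar 0) := by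
    rw [hfdef, memorySpectralDensity, abs_of_pos hθ]
    gcongr
    exact hL.bound θ ⟨by linarith, by linarith⟩
  have hlb : ∀ x ∈ Set.Icc θ (θ + 1 / n), θ ^ p / 2 * (fstar 0 / 2) ≤ f x := fun x hx => by
    have hx0 : 0 < x := hθ.trans_le hx.1
    rw [hfdef, memorySpectralDensity, abs_of_pos hx0]
    refine mul_le_mul (half_rpow_le_rpow hp1 hθ hx.1 (by linarith [hx.2]))
      (hlow x hx0.le (by linarith [hx.2])) (by positivity) (by positivity)
  have hsum := le_variance_trigSum_add hf hX (by omega : 1 ≤ n) 0 hθ.le (by linarith)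
    (by positivity) hlb
  have hvar : ∀ α, Var[normalisedTrig X f g n M k (⟨0, hg⟩, α); P] =
      (Real.pi * n * f θ)⁻¹ * Var[trigSum X n 0 α θ; P] := fun α => by
    rw [← covariance_self (by
      exact ((memLp_trigSum hX _ _ _ _).const_mul _).aemeasurable),
      covariance_normalisedTrig _ (Finset.mem_Icc.2 ⟨hk, hkM⟩) (Finset.mem_Icc.2 ⟨hk, hkM⟩),
      ← mul_assoc, ← mul_inv, Real.mul_self_sqrt (by positivity),
      covariance_self (memLp_trigSum hX _ _ _ _).aemeasurable]
  have hW : 0 < Real.pi * n * f θ := by positivity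
  have htot : 1 / (32 * Real.pi * μ) ≤ Var[normalisedTrig X f g n M k (⟨0, hg⟩, false); P] +
      Var[normalisedTrig X f g n M k (⟨0, hg⟩, true); P] := by
    rw [hvar, hvar, ← mul_add, le_inv_mul_iff₀ hW]
    refine le_trans ?_ hsum
    rw [mul_one_div, div_le_iff₀ (by positivity)]
    calc Real.pi * n * f θ ≤ Real.pi * n * (θ ^ p * (μ * fstar 0)) := by gcongr
      _ = _ := by ring
  have e : 1 / (32 * Real.pi * μ) = 1 / (64 * Real.pi * μ) + 1 / (64 * Real.pi * μ) := by
    field_simp; norm_num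
  by_contra! hcon
  have h1 := hcon (⟨0, hg⟩, false)
  have h2 := hcon (⟨0, hg⟩, true)
  linarith

lemma norm_sq_sum_trig (x : ℤ → ℝ) (n ℓ : ℕ) (θ : ℝ) :
    ‖∑ t ∈ Finset.Icc 1 n, ((x ((t : ℤ) + (ℓ : ℤ) * (n : ℤ)) : ℝ) : ℂ) *
      Complex.exp (Complex.I * (t : ℂ) * (θ : ℂ))‖ ^ 2 =
      (∑ t ∈ Finset.Icc 1 n, trigFn false (t * θ) * x ((t : ℤ) + (ℓ : ℤ) * (n : ℤ))) ^ 2 +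
      (∑ t ∈ Finset.Icc 1 n, trigFn true (t * θ) * x ((t : ℤ) + (ℓ : ℤ) * (n : ℤ))) ^ 2 := by
  rw [← Complex.normSq_eq_norm_sq, Complex.normSq_apply, ← sq, ← sq, Complex.re_sum, Complex.im_sum]
  have e : ∀ t : ℕ, Complex.I * (t : ℂ) * (θ : ℂ) = ((t * θ : ℝ) : ℂ) * Complex.I := fun t => by
    push_cast; ring
  congr 2
  · refine Finset.sum_congr rfl fun t _ => ?_
    rw [Complex.re_ofReal_mul, e, Complex.exp_ofReal_mul_I_re, trigFn, cond_false, mul_comm]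
  · refine Finset.sum_congr rfl fun t _ => ?_
    rw [Complex.im_ofReal_mul, e, Complex.exp_ofReal_mul_I_im, trigFn, cond_true, mul_comm]

/-- The periodogram divides by `2 π n` and the array by `π n f(ω_k)`; together with the average over
epochs this gives the factor `f(ω_k) / (2g)`. -/
lemma norm_sq_arrayVector_normalisedTrig {f : ℝ → ℝ} {g n M k : ℕ} (hg : 1 ≤ g) (hn : 1 ≤ n)
    (hk : k ∈ Finset.Icc 1 M) (hf : 0 < f (fourierFreq n k)) (ω : Ω) :
    averagedPeriodogram (fun t => X t ω) g n k =
      f (fourierFreq n k) * (2 * (g : ℝ))⁻¹ * ‖arrayVector (normalisedTrig X f g n M) k ω‖ ^ 2 := by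
  have hpi := Real.pi_pos
  have hn' : (0 : ℝ) < n := by exact_mod_cast hn
  have hg' : (0 : ℝ) < g := by exact_mod_cast hg
  rw [EuclideanSpace.real_norm_sq_eq]
  unfold arrayVector normalisedTrig averagedPeriodogram epochPeriodogram epochDFT
  simp only [if_pos hk, norm_mul, mul_pow, norm_sq_sum_trig (fun t => X t ω)]
  rw [Fintype.sum_prod_type, ← Fin.sum_univ_eq_sum_range]
  simp only [Fintype.sum_bool, ← mul_add]
  rw [← Finset.mul_sum, ← Finset.mul_sum, inv_pow, Real.sq_sqrt (by positivity)]
  have h1 : ‖(((2 * Real.pi * n) ^ (-(1 / 2) : ℝ) : ℝ) : ℂ)‖ ^ 2 = (2 * Real.pi * n)⁻¹ := by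
    rw [Complex.norm_real, Real.norm_eq_abs, sq_abs, ← Real.rpow_natCast, ← Real.rpow_mul
      (by positivity), ← Real.rpow_neg_one]
    norm_num
  rw [h1]
  have h2 : ∀ i : Fin g, (trigSum X n i true (fourierFreq n k) ω ^ 2 +
      trigSum X n i false (fourierFreq n k) ω ^ 2) =
      ((∑ t ∈ Finset.Icc 1 n, trigFn false (t * fourierFreq n k) *
        X ((t : ℤ) + ((i : ℕ) : ℤ) * (n : ℤ)) ω) ^ 2 +
      (∑ t ∈ Finset.Icc 1 n, trigFn true (t * fourierFreq n k) *
        X ((t : ℤ) + ((i : ℕ) : ℤ) * (n : ℤ)) ω) ^ 2) := fun i => add_comm _ _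
  simp only [h2]
  have h3 : ∀ T : ℝ, (g : ℝ)⁻¹ * ((2 * Real.pi * n)⁻¹ * T) = f (fourierFreq n k) *
      (2 * (g : ℝ))⁻¹ * ((Real.pi * n * f (fourierFreq n k))⁻¹ * T) := fun T => by
    field_simp
  exact h3 _

end NormalisedTransforms

/-! ### Asymptotics of the regression weights -/

section RegressionWeights

/-- Comparison of the sum of a monotone function with its primitive. -/
lemma abs_sum_sub_primitive_le {φ F : ℝ → ℝ} (hφ : MonotoneOn φ (Set.Ici 1)) (h1 : 0 ≤ φ 1)
    (hF : ∀ x, 1 ≤ x → HasDerivAt F (φ x) x) {m : ℕ} (hm : 1 ≤ m) :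
    |∑ k ∈ Finset.Icc 1 m, φ k - (F m - F 1)| ≤ φ m := by
  have step : ∀ k : ℕ, 1 ≤ k → φ k ≤ F (k + 1) - F k ∧ F (k + 1) - F k ≤ φ (k + 1) := by
    intro k hk
    have hk' : (1 : ℝ) ≤ k := by exact_mod_cast hk
    obtain ⟨c, hc, hc'⟩ := exists_hasDerivAt_eq_slope F φ (show (k : ℝ) < k + 1 by linarith)
      (fun x hx => (hF x (hk'.trans hx.1)).continuousAt.continuousWithinAt)
      (fun x hx => hF x (hk'.trans hx.1.le))
    rw [add_sub_cancel_left, div_one] at hc'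
    rw [← hc']
    exact ⟨hφ hk' (hk'.trans hc.1.le) hc.1.le,
      hφ (hk'.trans hc.1.le) (show (1 : ℝ) ≤ k + 1 by linarith) hc.2.le⟩
  have main : F m - F 1 + φ 1 ≤ ∑ k ∈ Finset.Icc 1 m, φ k ∧
      ∑ k ∈ Finset.Icc 1 m, φ k ≤ F m - F 1 + φ m := by
    induction m, hm using Nat.le_induction with
    | base => simp
    | succ m hm ih =>
      rw [Finset.sum_Icc_succ_top (by omega)]
      obtain ⟨s1, s2⟩ := step m hm
      push_cast
      exact ⟨by linarith [ih.1], by linarith [ih.2]⟩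
  rw [abs_le]
  have hm' : φ 1 ≤ φ m :=
    hφ (Set.mem_Ici.2 le_rfl) (Set.mem_Ici.2 (by exact_mod_cast hm)) (by exact_mod_cast hm)
  exact ⟨by linarith [main.1], by linarith [main.2]⟩

lemma abs_sum_log_sub_le {m : ℕ} (hm : 1 ≤ m) :
    |∑ k ∈ Finset.Icc 1 m, Real.log k - (m * Real.log m - m)| ≤ Real.log m + 1 := by
  have h := abs_sum_sub_primitive_le (φ := Real.log) (F := fun x => x * Real.log x - x)
    (fun x hx y _ hxy => Real.log_le_log (by linarith [Set.mem_Ici.1 hx]) hxy) (by simp)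
    (fun x hx => by
      have hx0 : x ≠ 0 := by positivity
      have := ((hasDerivAt_id x).mul (Real.hasDerivAt_log hx0)).sub (hasDerivAt_id x)
      convert! this using 1
      simp [hx0]) hm
  simp only [Real.log_one] at h
  rw [abs_le] at h ⊢
  constructor <;> linarith [h.1, h.2]

lemma abs_sum_log_sq_sub_le {m : ℕ} (hm : 1 ≤ m) :
    |∑ k ∈ Finset.Icc 1 m, Real.log k ^ 2 -
      (m * Real.log m ^ 2 - 2 * m * Real.log m + 2 * m)| ≤ Real.log m ^ 2 + 2 := by
  have h := abs_sum_sub_primitive_le (φ := fun x => Real.log x ^ 2)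
    (F := fun x => x * Real.log x ^ 2 - 2 * x * Real.log x + 2 * x)
    (fun x hx y _ hxy => pow_le_pow_left₀ (Real.log_nonneg hx)
      (Real.log_le_log (by linarith [Set.mem_Ici.1 hx]) hxy) 2) (by simp)
    (fun x hx => by
      have hx0 : x ≠ 0 := by positivity
      have := (((hasDerivAt_id x).mul ((Real.hasDerivAt_log hx0).pow 2)).sub
        (((hasDerivAt_id x).const_mul 2).mul (Real.hasDerivAt_log hx0))).add
        ((hasDerivAt_id x).const_mul 2)
      convert! this using 1
      simp
      field_simp
      ring) hm
  simp only [Real.log_one] at h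
  rw [abs_le] at h ⊢
  constructor <;> linarith [h.1, h.2]

lemma abs_sum_sq_sub_le {m : ℕ} (hm : 1 ≤ m) :
    |∑ k ∈ Finset.Icc 1 m, (k : ℝ) ^ 2 - (m : ℝ) ^ 3 / 3| ≤ 2 * (m : ℝ) ^ 2 := by
  have h := abs_sum_sub_primitive_le (φ := fun x => x ^ 2) (F := fun x => x ^ 3 / 3)
    (fun x hx y _ hxy => pow_le_pow_left₀ (by linarith [Set.mem_Ici.1 hx]) hxy 2) (by simp)
    (fun x hx => by
      have := (hasDerivAt_pow 3 x).div_const 3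
      convert! this using 1
      norm_num) hm
  have hm' : (1 : ℝ) ≤ (m : ℝ) ^ 2 := one_le_pow₀ (by exact_mod_cast hm)
  rw [abs_le] at h ⊢
  constructor <;> linarith [h.1, h.2]

lemma abs_sum_sq_mul_log_sub_le {m : ℕ} (hm : 1 ≤ m) :
    |∑ k ∈ Finset.Icc 1 m, (k : ℝ) ^ 2 * Real.log k -
      ((m : ℝ) ^ 3 / 3 * Real.log m - (m : ℝ) ^ 3 / 9)| ≤ (m : ℝ) ^ 2 * (Real.log m + 1) := by
  have h := abs_sum_sub_primitive_le (φ := fun x => x ^ 2 * Real.log x)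
    (F := fun x => x ^ 3 / 3 * Real.log x - x ^ 3 / 9)
    (fun x hx y _ hxy => mul_le_mul (pow_le_pow_left₀ (by linarith [Set.mem_Ici.1 hx]) hxy 2)
      (Real.log_le_log (by linarith [Set.mem_Ici.1 hx]) hxy) (Real.log_nonneg hx) (by positivity))
    (by simp)
    (fun x hx => by
      have hx0 : x ≠ 0 := by positivity
      have := (((hasDerivAt_pow 3 x).div_const 3).mul (Real.hasDerivAt_log hx0)).sub
        ((hasDerivAt_pow 3 x).div_const 9)
      convert! this using 1
      norm_num
      field_simp
      ring) hm
  have hm' : (1 : ℝ) ≤ (m : ℝ) ^ 2 := one_le_pow₀ (by exact_mod_cast hm)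
  simp only [Real.log_one] at h
  rw [abs_le] at h ⊢
  constructor <;> linarith [h.1, h.2]

lemma tendsto_log_pow_div_atTop (p : ℕ) :
    Tendsto (fun m : ℕ => Real.log m ^ p / m) atTop (𝓝 0) :=
  ((Real.isLittleO_pow_log_id_atTop (n := p)).tendsto_div_nhds_zero).comp tendsto_natCast_atTop_atTop

/-- The mean of `log 1, …, log m`. -/
noncomputable def meanLog (m : ℕ) : ℝ := (m : ℝ)⁻¹ * ∑ j ∈ Finset.Icc 1 m, Real.log j

lemma log_fourierFreq {n k : ℕ} (hn : 1 ≤ n) (hk : 1 ≤ k) :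
    Real.log (fourierFreq n k) = Real.log (2 * Real.pi / n) + Real.log k := by
  have : (n : ℝ) ≠ 0 := by positivity
  have : (k : ℝ) ≠ 0 := by positivity
  have := Real.pi_pos
  rw [fourierFreq, ← Real.log_mul (by positivity) (by positivity)]
  congr 1; ring

/-- Centring removes the common term `log (2π / n)`. The weights are therefore independent of `n`,
and they are studied at `n = 1`. -/
lemma centredRegressor_eq {n m k : ℕ} (hn : 1 ≤ n) (hm : 1 ≤ m) (hk : 1 ≤ k) :
    centredRegressor n m k = -2 * (Real.log k - meanLog m) := by
  unfold centredRegressor meanLog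
  rw [Finset.sum_congr rfl fun j hj => by
    rw [log_fourierFreq hn (Finset.mem_Icc.1 hj).1], log_fourierFreq hn hk, ← Finset.mul_sum,
    Finset.sum_add_distrib]
  have : (m : ℝ) ≠ 0 := by positivity
  simp
  field_simp
  ring

lemma sum_log_sub_meanLog {m : ℕ} (hm : 1 ≤ m) :
    ∑ k ∈ Finset.Icc 1 m, (Real.log k - meanLog m) = 0 := by
  have : (m : ℝ) ≠ 0 := by positivity
  rw [Finset.sum_sub_distrib, meanLog]
  simp
  field_simp
  ring

lemma sum_centredRegressor {n m : ℕ} (hn : 1 ≤ n) (hm : 1 ≤ m) :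
    ∑ k ∈ Finset.Icc 1 m, centredRegressor n m k = 0 := by
  rw [Finset.sum_congr rfl fun k hk => centredRegressor_eq hn hm (Finset.mem_Icc.1 hk).1,
    ← Finset.mul_sum, sum_log_sub_meanLog hm, mul_zero]

lemma regressionWeight_eq {n m k : ℕ} (hn : 1 ≤ n) (hm : 1 ≤ m) (hk : 1 ≤ k) :
    regressionWeight n m k = regressionWeight 1 m k := by
  unfold regressionWeight
  rw [centredRegressor_eq hn hm hk, centredRegressor_eq le_rfl hm hk]
  congr 1
  exact Finset.sum_congr rfl fun j hj => by
    rw [centredRegressor_eq hn hm (Finset.mem_Icc.1 hj).1,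
      centredRegressor_eq le_rfl hm (Finset.mem_Icc.1 hj).1]

lemma sum_regressionWeight {m : ℕ} (hm : 1 ≤ m) :
    ∑ k ∈ Finset.Icc 1 m, regressionWeight 1 m k = 0 := by
  unfold regressionWeight
  rw [← Finset.sum_div, sum_centredRegressor le_rfl hm, zero_div]

lemma sum_regressionWeight_sq (m : ℕ) :
    ∑ k ∈ Finset.Icc 1 m, regressionWeight 1 m k ^ 2 =
      (∑ k ∈ Finset.Icc 1 m, centredRegressor 1 m k ^ 2)⁻¹ := by
  unfold regressionWeight
  simp only [div_pow]
  rw [← Finset.sum_div]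
  set S := ∑ k ∈ Finset.Icc 1 m, centredRegressor 1 m k ^ 2
  by_cases h : S = 0
  · simp [h]
  · field_simp

lemma abs_meanLog_sub_le {m : ℕ} (hm : 1 ≤ m) :
    |meanLog m - (Real.log m - 1)| ≤ (Real.log m + 1) / m := by
  have hm0 : (0 : ℝ) < m := by positivity
  have h := abs_sum_log_sub_le hm
  have e : meanLog m - (Real.log m - 1) =
      (∑ k ∈ Finset.Icc 1 m, Real.log k - (m * Real.log m - m)) / m := by
    rw [meanLog]; field_simp
  rw [e, abs_div, abs_of_pos hm0]
  gcongr

/-- The extra factor is needed because `meanLog m` enters later through products with quantities of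
order `log m`. -/
lemma tendsto_log_mul_meanLog_sub :
    Tendsto (fun m : ℕ => (Real.log m + 1) * (meanLog m - (Real.log m - 1))) atTop (𝓝 0) := by
  have h : Tendsto (fun m : ℕ => Real.log m ^ 2 / m + 2 * (Real.log m ^ 1 / m) +
      Real.log m ^ 0 / m) atTop (𝓝 (0 + 2 * 0 + 0)) :=
    ((tendsto_log_pow_div_atTop 2).add ((tendsto_log_pow_div_atTop 1).const_mul 2)).add
      (tendsto_log_pow_div_atTop 0)
  rw [mul_zero, add_zero, add_zero] at h
  refine squeeze_zero_norm' ?_ h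
  filter_upwards [eventually_ge_atTop 1] with m hm
  have hl : 0 ≤ Real.log m := Real.log_nonneg (by exact_mod_cast hm)
  rw [norm_mul, Real.norm_eq_abs, Real.norm_eq_abs, abs_of_nonneg (by linarith)]
  calc (Real.log m + 1) * |meanLog m - (Real.log m - 1)|
      ≤ (Real.log m + 1) * ((Real.log m + 1) / m) := by gcongr; exact abs_meanLog_sub_le hm
    _ = _ := by ring

lemma tendsto_zero_of_log_mul {u : ℕ → ℝ}
    (h : Tendsto (fun m : ℕ => (Real.log m + 1) * u m) atTop (𝓝 0)) : Tendsto u atTop (𝓝 0) := by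
  refine squeeze_zero_norm' ?_ (tendsto_zero_iff_norm_tendsto_zero.1 h)
  filter_upwards [eventually_ge_atTop 1] with m hm
  have hl : 0 ≤ Real.log m := Real.log_nonneg (by exact_mod_cast hm)
  rw [norm_mul, Real.norm_of_nonneg (by linarith : 0 ≤ Real.log m + 1)]
  nlinarith [norm_nonneg (u m)]

lemma tendsto_meanLog_sub : Tendsto (fun m : ℕ => meanLog m - (Real.log m - 1)) atTop (𝓝 0) :=
  tendsto_zero_of_log_mul tendsto_log_mul_meanLog_sub

/-- The terms in `log² m` and `log m` cancel by centring. The limit is four times the variance of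
`log V` for `V` uniform on `(0, 1)`, which is `1`. -/
lemma tendsto_sum_centredRegressor_sq :
    Tendsto (fun m : ℕ => (∑ k ∈ Finset.Icc 1 m, centredRegressor 1 m k ^ 2) / m) atTop (𝓝 4) := by
  have hB : Tendsto (fun m : ℕ => (∑ k ∈ Finset.Icc 1 m, Real.log k ^ 2 -
      (m * Real.log m ^ 2 - 2 * m * Real.log m + 2 * m)) / m) atTop (𝓝 0) := by
    have h : Tendsto (fun m : ℕ => Real.log m ^ 2 / m + 2 * (Real.log m ^ 0 / m)) atTop
      (𝓝 (0 + 2 * 0)) := (tendsto_log_pow_div_atTop 2).add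
        ((tendsto_log_pow_div_atTop 0).const_mul 2)
    rw [mul_zero, add_zero] at h
    refine squeeze_zero_norm' ?_ h
    filter_upwards [eventually_ge_atTop 1] with m hm
    rw [norm_div, Real.norm_eq_abs, Real.norm_natCast]
    calc _ ≤ (Real.log m ^ 2 + 2) / m := by gcongr; exact abs_sum_log_sq_sub_le hm
      _ = _ := by ring
  have hlim : Tendsto (fun m : ℕ => 4 * (1 + (∑ k ∈ Finset.Icc 1 m, Real.log k ^ 2 -
      (m * Real.log m ^ 2 - 2 * m * Real.log m + 2 * m)) / m
      - 2 * ((Real.log m + 1) * (meanLog m - (Real.log m - 1)))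
      + 4 * (meanLog m - (Real.log m - 1)) - (meanLog m - (Real.log m - 1)) ^ 2)) atTop
      (𝓝 (4 * (1 + 0 - 2 * 0 + 4 * 0 - 0 ^ 2))) :=
    ((((hB.const_add 1).sub (tendsto_log_mul_meanLog_sub.const_mul 2)).add
      (tendsto_meanLog_sub.const_mul 4)).sub (tendsto_meanLog_sub.pow 2)).const_mul 4
  norm_num at hlim
  refine hlim.congr' ?_
  filter_upwards [eventually_ge_atTop 1] with m hm
  have hm0 : (m : ℝ) ≠ 0 := by positivity
  have e : ∑ k ∈ Finset.Icc 1 m, centredRegressor 1 m k ^ 2 =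
      4 * (∑ k ∈ Finset.Icc 1 m, Real.log k ^ 2 - m * meanLog m ^ 2) := by
    rw [Finset.sum_congr rfl fun k hk => by
      rw [centredRegressor_eq le_rfl hm (Finset.mem_Icc.1 hk).1,
        show (-2 * (Real.log k - meanLog m)) ^ 2 = 4 * (Real.log k ^ 2 - meanLog m ^ 2) -
          8 * meanLog m * (Real.log k - meanLog m) by ring]]
    rw [Finset.sum_sub_distrib, ← Finset.mul_sum, ← Finset.mul_sum, sum_log_sub_meanLog hm,
      Finset.sum_sub_distrib]
    simp
  rw [e]
  field_simp
  ring

/-- The limit is `-2` times the covariance of `log V` and `V²` for `V` uniform on `(0, 1)`, namely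
`-2 (-1/9 + 1/3)`. -/
lemma tendsto_sum_centredRegressor_mul_sq :
    Tendsto (fun m : ℕ => (∑ k ∈ Finset.Icc 1 m, centredRegressor 1 m k * (k : ℝ) ^ 2) /
      (m : ℝ) ^ 3) atTop (𝓝 (-(4 / 9))) := by
  have hD : Tendsto (fun m : ℕ => (∑ k ∈ Finset.Icc 1 m, (k : ℝ) ^ 2 * Real.log k -
      ((m : ℝ) ^ 3 / 3 * Real.log m - (m : ℝ) ^ 3 / 9)) / (m : ℝ) ^ 3) atTop (𝓝 0) := by
    have h : Tendsto (fun m : ℕ => Real.log m ^ 1 / m + Real.log m ^ 0 / m) atTop (𝓝 (0 + 0)) :=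
      (tendsto_log_pow_div_atTop 1).add (tendsto_log_pow_div_atTop 0)
    rw [add_zero] at h
    refine squeeze_zero_norm' ?_ h
    filter_upwards [eventually_ge_atTop 1] with m hm
    have hm0 : (m : ℝ) ≠ 0 := by positivity
    rw [norm_div, Real.norm_eq_abs, norm_pow, Real.norm_natCast]
    calc _ ≤ ((m : ℝ) ^ 2 * (Real.log m + 1)) / (m : ℝ) ^ 3 := by
          gcongr; exact abs_sum_sq_mul_log_sub_le hm
      _ = _ := by field_simp
  have hE : Tendsto (fun m : ℕ => (Real.log m + 1) * ((∑ k ∈ Finset.Icc 1 m, (k : ℝ) ^ 2 -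
      (m : ℝ) ^ 3 / 3) / (m : ℝ) ^ 3)) atTop (𝓝 0) := by
    have h : Tendsto (fun m : ℕ => 2 * (Real.log m ^ 1 / m + Real.log m ^ 0 / m)) atTop
      (𝓝 (2 * (0 + 0))) :=
      ((tendsto_log_pow_div_atTop 1).add (tendsto_log_pow_div_atTop 0)).const_mul 2
    rw [add_zero, mul_zero] at h
    refine squeeze_zero_norm' ?_ h
    filter_upwards [eventually_ge_atTop 1] with m hm
    have hm0 : (m : ℝ) ≠ 0 := by positivity
    have hl : 0 ≤ Real.log m := Real.log_nonneg (by exact_mod_cast hm)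
    rw [norm_mul, norm_div, Real.norm_eq_abs, Real.norm_eq_abs, norm_pow, Real.norm_natCast,
      abs_of_nonneg (by linarith)]
    calc _ ≤ (Real.log m + 1) * ((2 * (m : ℝ) ^ 2) / (m : ℝ) ^ 3) := by
          gcongr; exact abs_sum_sq_sub_le hm
      _ = _ := by field_simp
  have hE' := tendsto_zero_of_log_mul hE
  have hlim : Tendsto (fun m : ℕ => -2 * (2 / 9 + (∑ k ∈ Finset.Icc 1 m, (k : ℝ) ^ 2 * Real.log k -
      ((m : ℝ) ^ 3 / 3 * Real.log m - (m : ℝ) ^ 3 / 9)) / (m : ℝ) ^ 3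
      - (Real.log m + 1) * ((∑ k ∈ Finset.Icc 1 m, (k : ℝ) ^ 2 - (m : ℝ) ^ 3 / 3) / (m : ℝ) ^ 3)
      + 2 * ((∑ k ∈ Finset.Icc 1 m, (k : ℝ) ^ 2 - (m : ℝ) ^ 3 / 3) / (m : ℝ) ^ 3)
      - (1 / 3 + (∑ k ∈ Finset.Icc 1 m, (k : ℝ) ^ 2 - (m : ℝ) ^ 3 / 3) / (m : ℝ) ^ 3) *
        (meanLog m - (Real.log m - 1)))) atTop
      (𝓝 (-2 * (2 / 9 + 0 - 0 + 2 * 0 - (1 / 3 + 0) * 0))) :=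
    ((((hD.const_add _).sub hE).add (hE'.const_mul 2)).sub
      ((hE'.const_add _).mul tendsto_meanLog_sub)).const_mul (-2)
  rw [show (-2 * (2 / 9 + 0 - 0 + 2 * 0 - (1 / 3 + 0) * 0) : ℝ) = -(4 / 9) by norm_num] at hlim
  refine hlim.congr' ?_
  filter_upwards [eventually_ge_atTop 1] with m hm
  have hm0 : (m : ℝ) ≠ 0 := by positivity
  have e : ∑ k ∈ Finset.Icc 1 m, centredRegressor 1 m k * (k : ℝ) ^ 2 =
      -2 * (∑ k ∈ Finset.Icc 1 m, (k : ℝ) ^ 2 * Real.log k -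
        meanLog m * ∑ k ∈ Finset.Icc 1 m, (k : ℝ) ^ 2) := by
    rw [Finset.mul_sum, ← Finset.sum_sub_distrib, Finset.mul_sum]
    exact Finset.sum_congr rfl fun k hk => by
      rw [centredRegressor_eq le_rfl hm (Finset.mem_Icc.1 hk).1]; ring
  rw [e]
  field_simp
  ring

lemma tendsto_sum_regressionWeight_mul_sq :
    Tendsto (fun m : ℕ => (∑ k ∈ Finset.Icc 1 m, regressionWeight 1 m k * (k : ℝ) ^ 2) /
      (m : ℝ) ^ 2) atTop (𝓝 (-(1 / 9))) := by
  have h := tendsto_sum_centredRegressor_mul_sq.div tendsto_sum_centredRegressor_sq (by norm_num)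
  rw [show (-(4 / 9) / 4 : ℝ) = -(1 / 9) by norm_num] at h
  refine h.congr' ?_
  filter_upwards [eventually_ge_atTop 1] with m hm
  have hm0 : (m : ℝ) ≠ 0 := by positivity
  have e : ∑ k ∈ Finset.Icc 1 m, regressionWeight 1 m k * (k : ℝ) ^ 2 =
      (∑ k ∈ Finset.Icc 1 m, centredRegressor 1 m k * (k : ℝ) ^ 2) /
        ∑ k ∈ Finset.Icc 1 m, centredRegressor 1 m k ^ 2 := by
    rw [Finset.sum_div]
    exact Finset.sum_congr rfl fun k _ => by rw [regressionWeight]; ring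
  rw [e, Pi.div_apply]
  set S := ∑ k ∈ Finset.Icc 1 m, centredRegressor 1 m k ^ 2
  by_cases hS : S = 0
  · simp [hS]
  · field_simp

lemma eventually_le_sum_centredRegressor_sq :
    ∀ᶠ m : ℕ in atTop, (m : ℝ) ≤ ∑ k ∈ Finset.Icc 1 m, centredRegressor 1 m k ^ 2 := by
  filter_upwards [tendsto_sum_centredRegressor_sq.eventually (lt_mem_nhds (show (1 : ℝ) < 4 by
    norm_num)), eventually_ge_atTop 1] with m h hm
  have hm0 : (0 : ℝ) < m := by positivity
  exact ((one_lt_div hm0).1 h).le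

lemma abs_centredRegressor_le {m k : ℕ} (hk : 1 ≤ k) (hkm : k ≤ m) :
    |centredRegressor 1 m k| ≤ 2 * Real.log m := by
  have hm : 1 ≤ m := hk.trans hkm
  have hm0 : (0 : ℝ) < m := by positivity
  have hlog : ∀ j ∈ Finset.Icc 1 m, 0 ≤ Real.log j ∧ Real.log j ≤ Real.log m := fun j hj => by
    rw [Finset.mem_Icc] at hj
    have hj1 : (1 : ℝ) ≤ j := by exact_mod_cast hj.1
    exact ⟨Real.log_nonneg hj1, Real.log_le_log (by linarith) (by exact_mod_cast hj.2)⟩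
  have h1 : 0 ≤ meanLog m :=
    mul_nonneg (by positivity) (Finset.sum_nonneg fun j hj => (hlog j hj).1)
  have h2 : meanLog m ≤ Real.log m := by
    rw [meanLog, inv_mul_le_iff₀ hm0]
    simpa using Finset.sum_le_sum fun j hj => (hlog j hj).2
  have h3 := hlog k (Finset.mem_Icc.2 ⟨hk, hkm⟩)
  rw [centredRegressor_eq le_rfl hm hk, abs_mul]
  have : |Real.log k - meanLog m| ≤ Real.log m := abs_le.2 ⟨by linarith, by linarith⟩
  simpa using this

/-- The bound on the absolute sum is Cauchy–Schwarz, `(∑ |a_k|)² ≤ m ∑ a_k²`, with `∑ a_k² ≤ 1/m`.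
The last identity holds because the regressor and its centred version differ by a constant, which
weights of zero sum ignore. -/
lemma eventually_regressionWeight :
    ∀ᶠ m : ℕ in atTop,
      (∀ k, 1 ≤ k → k ≤ m → |regressionWeight 1 m k| ≤ 2 * Real.log m / m) ∧
      ∑ k ∈ Finset.Icc 1 m, |regressionWeight 1 m k| ≤ 1 ∧
      (∀ n, 1 ≤ n → ∑ k ∈ Finset.Icc 1 m,
        regressionWeight n m k * (-2 * Real.log (fourierFreq n k)) = 1) := by
  filter_upwards [eventually_le_sum_centredRegressor_sq, eventually_ge_atTop 1] with m hS hm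
  have hm0 : (0 : ℝ) < m := by positivity
  have hS0 := hm0.trans_le hS
  refine ⟨fun k hk hkm => ?_, ?_, fun n hn => ?_⟩
  · rw [regressionWeight, abs_div, abs_of_pos hS0]
    exact div_le_div₀ (by have := Real.log_nonneg (show (1 : ℝ) ≤ m by exact_mod_cast hm); positivity)
      (abs_centredRegressor_le hk hkm) hm0 hS
  · refine abs_le_of_sq_le_sq' (b := 1) ?_ zero_le_one |>.2
    have h := sq_sum_le_card_mul_sum_sq (s := Finset.Icc 1 m)
      (f := fun k => |regressionWeight 1 m k|)
    simp only [sq_abs, sum_regressionWeight_sq, Nat.card_Icc, add_tsub_cancel_right] at h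
    refine h.trans ?_
    rw [one_pow, ← div_eq_mul_inv, div_le_one hS0]
    exact hS
  · have e : ∀ k ∈ Finset.Icc 1 m, regressionWeight n m k * (-2 * Real.log (fourierFreq n k)) =
        regressionWeight 1 m k * centredRegressor 1 m k + regressionWeight 1 m k *
          ((m : ℝ)⁻¹ * ∑ j ∈ Finset.Icc 1 m, (-2 * Real.log (fourierFreq n j))) := fun k hk => by
      have hk1 := (Finset.mem_Icc.1 hk).1
      rw [regressionWeight_eq hn hm hk1, ← mul_add, centredRegressor_eq le_rfl hm hk1,
        ← centredRegressor_eq hn hm hk1, centredRegressor, sub_add_cancel]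
    rw [Finset.sum_congr rfl e, Finset.sum_add_distrib, ← Finset.sum_mul, sum_regressionWeight hm,
      zero_mul, add_zero]
    have e2 : ∀ k, regressionWeight 1 m k * centredRegressor 1 m k =
        centredRegressor 1 m k ^ 2 / ∑ j ∈ Finset.Icc 1 m, centredRegressor 1 m j ^ 2 := fun k => by
      rw [regressionWeight]; ring
    simp only [e2]
    rw [← Finset.sum_div, div_self hS0.ne']

end RegressionWeights

/-! ### Weak correlation of the log norms -/

section LogArray

variable {Ω : Type*} [MeasurableSpace Ω] {P : Measure Ω} [IsProbabilityMeasure P]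

/-- The variables `U 1, …, U M` have mean close to `κ`, variance close to `T`, and those with index
at least `K` are weakly correlated. -/
structure IsWeaklyCorrelated (P : Measure Ω) (U : ℕ → Ω → ℝ) (M K : ℕ) (A κ T : ℝ) : Prop where
  memLp : ∀ k, 1 ≤ k → k ≤ M → MemLp (U k) 2 P
  mean : ∀ k, 1 ≤ k → k ≤ M → |∫ ω, U k ω ∂P - κ| ≤ A * (1 + Real.log k) / k
  variance_le : ∀ k, 1 ≤ k → k ≤ M → Var[U k; P] ≤ A
  variance : ∀ k, 1 ≤ k → k ≤ M → |Var[U k; P] - T| ≤ A * (1 + Real.log k) / k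
  covariance : ∀ j k, 1 ≤ k → K ≤ k → k < j → j ≤ M →
    |cov[U j, U k; P]| ≤ A * (1 + Real.log j) ^ 2 / (j * k)

lemma one_add_log_le_two_mul_sqrt {x : ℝ} (hx : 1 ≤ x) : 1 + Real.log x ≤ 2 * √x := by
  have h0 : 0 < √x := Real.sqrt_pos.2 (by linarith)
  have h := Real.log_le_sub_one_of_pos h0
  rw [Real.log_sqrt (by linarith)] at h
  linarith

/-- The threshold `K` and the constant `A` depend on `C`, `c` and `ι` only, not on the array or its
length. Beyond `K` the perturbation results apply; below it there are finitely many indices, and the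
crude second moment bound is absorbed by enlarging `A`. -/
lemma exists_isWeaklyCorrelated {ι : Type*} [Fintype ι] [DecidableEq ι] [Nonempty ι] {C c : ℝ}
    (hC : 0 ≤ C) (hc : 0 < c) :
    ∃ (K : ℕ) (A : ℝ), 0 ≤ A ∧ ∀ (Z : ℕ → ι → Ω → ℝ) (M : ℕ),
      IsGaussianProcess (fun p : ℕ × ι => Z p.1 p.2) P → (∀ k i, ∫ ω, Z k i ω ∂P = 0) →
      (∀ j k i i', 1 ≤ k → k ≤ j → j ≤ M → |cov[Z j i, Z k i'; P] -
        (if j = k ∧ i = i' then 1 else 0)| ≤ C * (1 + Real.log j) / √(j * k)) →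
      (∀ k, 1 ≤ k → k ≤ M → ∃ i, c ≤ Var[Z k i; P]) →
      (∀ k, 1 ≤ k → k ≤ M → ∀ᵐ ω ∂P, 0 < ‖arrayVector Z k ω‖ ^ 2) ∧
      IsWeaklyCorrelated P (fun k ω => Real.log (‖arrayVector Z k ω‖ ^ 2)) M K A
        (meanLogNormSq ι) (trigamma ((Fintype.card ι : ℝ) / 2)) := by
  set q : ℝ := ((Fintype.card ι : ℕ) : ℝ) with hq
  have hq0 : 0 ≤ q := by positivity
  set T := trigamma (q / 2)
  set κ := meanLogNormSq ι
  obtain ⟨C', hC'⟩ := exists_bound_log_norm_sq (P := P) ι (B := 1 + C) hc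
  -- Chosen so that `2 q C / √K ≤ 1/4`, the smallness required of the cross covariance, and so that
  -- `K ≥ 1`.
  obtain ⟨K, hK⟩ := exists_nat_ge ((8 * (q * C)) ^ 2 + 1)
  have hK1 : (1 : ℝ) ≤ K := by nlinarith [sq_nonneg (8 * (q * C))]
  have hKs : q * (C * (2 / √K)) ≤ 1 / 4 := by
    have h1 : 8 * (q * C) ≤ √K := Real.le_sqrt_of_sq_le (by linarith)
    have h2 : 0 < √(K : ℝ) := Real.sqrt_pos.2 (by linarith)
    rw [show q * (C * (2 / √K)) = 2 * (q * C) / √K by ring, div_le_iff₀ h2]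
    linarith
  set D := 2 * q * C + (4 * √T + 2) * (q * C) + 32 * (q * C) ^ 2 with hD
  have hD0 : 0 ≤ D := by positivity
  -- `D` serves the indices from `K` on; the multiple of `K` ensures that `A / k` exceeds the crude
  -- deviations for `k < K`; the last term bounds every variance.
  set A := D + K * (|C'| + 1 + |κ| + |T|) + |C'| with hA
  have hA0 : 0 ≤ A := by positivity
  refine ⟨K, A, hA0, fun Z M hZ hmean hcov hlow => ?_⟩
  have hlog : ∀ k : ℕ, 1 ≤ k → 0 ≤ Real.log k := fun k hk =>
    Real.log_nonneg (by exact_mod_cast hk)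
  have hself : ∀ k, 1 ≤ k → k ≤ M → ∀ i i', |cov[Z k i, Z k i'; P] - (if i = i' then 1 else 0)| ≤
      C * ((1 + Real.log k) / k) := fun k hk hkM i i' => by
    have h := hcov k k i i' hk le_rfl hkM
    rw [Real.sqrt_mul_self (by positivity)] at h
    simpa [mul_div_assoc] using h
  have hZv : ∀ k i, Var[fun ω => arrayVector Z k ω i; P] = cov[Z k i, Z k i; P] := fun k i =>
    (covariance_self (hZ.hasGaussianLaw_eval (k, i)).aemeasurable).symm
  have hall : ∀ k, 1 ≤ k → k ≤ M → _ := fun k hk hkM => by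
    have h1 : (1 : ℝ) ≤ k := by exact_mod_cast hk
    refine hC' (arrayVector Z k) (hasGaussianLaw_arrayVector hZ k) (fun i => hmean k i) ?_ ?_
    · obtain ⟨i, hi⟩ := hlow k hk hkM
      exact ⟨i, hi⟩
    · intro i
      rw [hZv]
      have h2 := (abs_le.1 (hself k hk hkM i i)).2
      rw [if_pos rfl] at h2
      have h3 : (1 + Real.log k) / k ≤ 1 := by
        rw [div_le_one (by linarith)]
        linarith [Real.log_le_sub_one_of_pos (show (0 : ℝ) < k by linarith)]
      nlinarith
  have hsmall : ∀ j k : ℕ, K ≤ k → 1 ≤ j → (1 + Real.log j) / √(j * k) ≤ 2 / √K := by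
    intro j k hk hj
    have hj1 : (1 : ℝ) ≤ j := by exact_mod_cast hj
    have hkK : (K : ℝ) ≤ k := by exact_mod_cast hk
    rw [Real.sqrt_mul (by positivity), ← div_div]
    have h1 : (1 + Real.log j) / √j ≤ 2 := by
      rw [div_le_iff₀ (Real.sqrt_pos.2 (by linarith))]
      exact one_add_log_le_two_mul_sqrt hj1
    have h2 : 0 < √(K : ℝ) := Real.sqrt_pos.2 (by linarith)
    gcongr
  have hnear : ∀ k, K ≤ k → 1 ≤ k → k ≤ M → _ := fun k hKk hk hkM => by
    refine log_norm_sq_of_variance_near (ρ := q * (C * ((1 + Real.log k) / k)))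
      (hasGaussianLaw_arrayVector hZ k) (integral_inner_arrayVector hZ hmean k) ?_
      (abs_variance_inner_arrayVector_sub_le hZ (hself k hk hkM))
    have h := hsmall k k hKk hk
    rw [Real.sqrt_mul_self (by positivity)] at h
    calc q * (C * ((1 + Real.log k) / k)) ≤ q * (C * (2 / √K)) := by gcongr
      _ ≤ 1 / 2 := by linarith
  have hcrude : ∀ k, 1 ≤ k → k ≤ M →
      |∫ ω, Real.log (‖arrayVector Z k ω‖ ^ 2) ∂P - κ| ≤ |C'| + 1 + |κ| + |T| ∧
      Var[fun ω => Real.log (‖arrayVector Z k ω‖ ^ 2); P] ≤ |C'| ∧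
      |Var[fun ω => Real.log (‖arrayVector Z k ω‖ ^ 2); P] - T| ≤ |C'| + 1 + |κ| + |T| := by
    intro k hk hkM
    obtain ⟨-, hm, hb⟩ := hall k hk hkM
    have hv := variance_eq_sub hm
    have hv0 := variance_nonneg (fun ω => Real.log (‖arrayVector Z k ω‖ ^ 2)) P
    simp only [Pi.pow_apply] at hv
    set E := ∫ ω, Real.log (‖arrayVector Z k ω‖ ^ 2) ∂P
    have hC'a := le_abs_self C'
    have hE : |E| ≤ |C'| + 1 := by
      have : E ^ 2 ≤ |C'| := by linarith
      rw [← sq_abs] at this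
      nlinarith [abs_nonneg E]
    refine ⟨?_, by nlinarith [sq_nonneg E], ?_⟩
    · exact (abs_sub _ _).trans (by linarith [abs_nonneg T])
    · refine (abs_sub _ _).trans ?_
      rw [abs_of_nonneg hv0]
      nlinarith [sq_nonneg E, abs_nonneg κ]
  have hpass : ∀ k : ℕ, 1 ≤ k → k < K → |C'| + 1 + |κ| + |T| ≤ A * (1 + Real.log k) / k := by
    intro k hk hkK
    have h1 : (0 : ℝ) < k := by positivity
    have h2 : (k : ℝ) ≤ K := by exact_mod_cast hkK.le
    have h3 := hlog k hk
    have h4 : 0 ≤ |C'| + 1 + |κ| + |T| := by positivity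
    rw [le_div_iff₀ h1]
    calc (|C'| + 1 + |κ| + |T|) * k ≤ K * (|C'| + 1 + |κ| + |T|) := by nlinarith
      _ ≤ A := by rw [hA]; linarith [abs_nonneg C']
      _ ≤ A * (1 + Real.log k) := by nlinarith
  have hDA : D ≤ A := by
    have : 0 ≤ K * (|C'| + 1 + |κ| + |T|) := by positivity
    rw [hA]; linarith [abs_nonneg C']
  refine ⟨fun k hk hkM => (hall k hk hkM).1, fun k hk hkM => (hall k hk hkM).2.1,
    fun k hk hkM => ?_, fun k hk hkM => ?_, fun k hk hkM => ?_, fun j k hk hKk hkj hjM => ?_⟩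
  · rcases lt_or_ge k K with h | h
    · exact ((hcrude k hk hkM).1).trans (hpass k hk h)
    · refine ((hnear k h hk hkM).2.2.1).trans ?_
      have := hlog k hk
      rw [mul_div_assoc]
      calc 2 * (q * (C * ((1 + Real.log k) / k))) = (2 * q * C) * ((1 + Real.log k) / k) := by ring
        _ ≤ A * ((1 + Real.log k) / k) := by
          refine mul_le_mul_of_nonneg_right (le_trans ?_ hDA) (by positivity)
          rw [hD, add_assoc]
          exact le_add_of_nonneg_right (by positivity)
  · refine ((hcrude k hk hkM).2.1).trans ?_
    rw [hA]
    exact le_add_of_nonneg_left (by positivity)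
  · rcases lt_or_ge k K with h | h
    · exact ((hcrude k hk hkM).2.2).trans (hpass k hk h)
    · refine ((hnear k h hk hkM).2.2.2).trans ?_
      have := hlog k hk
      rw [mul_div_assoc]
      calc (4 * √T + 2) * (q * (C * ((1 + Real.log k) / k))) =
          ((4 * √T + 2) * (q * C)) * ((1 + Real.log k) / k) := by ring
        _ ≤ A * ((1 + Real.log k) / k) := by
          refine mul_le_mul_of_nonneg_right (le_trans ?_ hDA) (by positivity)
          have h1 : 0 ≤ 2 * q * C := by positivity
          have h2 : 0 ≤ 32 * (q * C) ^ 2 := by positivity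
          rw [hD]; linarith
  · have hj : 1 ≤ j := hk.trans hkj.le
    have hl := hlog j hj
    have hr₀ : q * (C * (2 / √K)) ≤ 1 / 2 := by linarith
    have hown : ∀ l, K ≤ l → 1 ≤ l → l ≤ M → ∀ i i',
        |cov[Z l i, Z l i'; P] - (if i = i' then 1 else 0)| ≤ C * (2 / √K) := fun l hKl hl hlM i i' => by
      refine (hself l hl hlM i i').trans ?_
      have h := hsmall l l hKl hl
      rw [Real.sqrt_mul_self (by positivity)] at h
      gcongr
    have hr : q * (C * ((1 + Real.log j) / √(j * k))) ≤ 1 / 4 := by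
      refine le_trans ?_ hKs
      have h := hsmall j k hKk hj
      gcongr
    have h := abs_covariance_log_arrayVector_le hZ hmean hr₀ hr
      (hown j (hKk.trans hkj.le) hj hjM) (hown k hKk hk (hkj.le.trans hjM)) (fun i i' => by
        have h := hcov j k i i' hk hkj.le hjM
        rw [if_neg (by omega), sub_zero, mul_div_assoc] at h
        exact h)
    refine h.trans ?_
    have hj0 : (0 : ℝ) < j := by positivity
    have hk0 : (0 : ℝ) < k := by positivity
    calc 32 * (q * (C * ((1 + Real.log j) / √(j * k)))) ^ 2 =
        (32 * (q * C) ^ 2) * ((1 + Real.log j) ^ 2 / (j * k)) := by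
          rw [mul_pow, mul_pow C, div_pow, Real.sq_sqrt (by positivity)]; ring
      _ ≤ A * ((1 + Real.log j) ^ 2 / (j * k)) := by
          refine mul_le_mul_of_nonneg_right (le_trans ?_ hDA) (by positivity)
          rw [hD]
          exact le_add_of_nonneg_left (by positivity)
      _ = _ := by ring

end LogArray

/-! ### Mean and variance of weighted sums -/

section WeightedSums

lemma sum_inv_le_one_add_log (m : ℕ) : ∑ k ∈ Finset.Icc 1 m, (k : ℝ)⁻¹ ≤ 1 + Real.log m := by
  have h := harmonic_le_one_add_log m
  rw [harmonic_eq_sum_Icc] at h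
  push_cast at h
  exact h

lemma tendsto_one_add_log_pow_div_atTop (p : ℕ) :
    Tendsto (fun m : ℕ => (1 + Real.log m) ^ p / m) atTop (𝓝 0) := by
  have h1 : Tendsto (fun m : ℕ => Real.exp 1 * (m : ℝ)) atTop atTop :=
    tendsto_natCast_atTop_atTop.const_mul_atTop (Real.exp_pos 1)
  have h2 := (((Real.isLittleO_pow_log_id_atTop (n := p)).tendsto_div_nhds_zero).comp h1).const_mul
    (Real.exp 1)
  rw [mul_zero] at h2
  refine h2.congr' ?_
  filter_upwards [eventually_ge_atTop 1] with m hm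
  have hm0 : (m : ℝ) ≠ 0 := by positivity
  simp only [Function.comp, id]
  rw [Real.log_mul (Real.exp_pos 1).ne' hm0, Real.log_exp]
  field_simp

variable {Ω : Type*} [MeasurableSpace Ω] {P : Measure Ω} [IsProbabilityMeasure P]
  {U : ℕ → Ω → ℝ} {M K : ℕ} {A κ T : ℝ} {a : ℕ → ℝ} {α : ℝ}

/-- Weights of zero sum allow the common mean `κ` to be subtracted; the remaining errors are summed
by the harmonic series, which supplies the second logarithm. -/
lemma IsWeaklyCorrelated.abs_sum_mul_integral_le (hU : IsWeaklyCorrelated P U M K A κ T)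
    (hA : 0 ≤ A) (ha0 : ∑ k ∈ Finset.Icc 1 M, a k = 0)
    (ha : ∀ k, 1 ≤ k → k ≤ M → |a k| ≤ α) (hα : 0 ≤ α) :
    |∑ k ∈ Finset.Icc 1 M, a k * ∫ ω, U k ω ∂P| ≤ α * A * (1 + Real.log M) ^ 2 := by
  have e : ∑ k ∈ Finset.Icc 1 M, a k * ∫ ω, U k ω ∂P =
      ∑ k ∈ Finset.Icc 1 M, a k * (∫ ω, U k ω ∂P - κ) := by
    simp only [mul_sub, Finset.sum_sub_distrib, ← Finset.sum_mul, ha0]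
    ring
  have hterm : ∀ k ∈ Finset.Icc 1 M, |a k * (∫ ω, U k ω ∂P - κ)| ≤
      α * A * (1 + Real.log M) * (k : ℝ)⁻¹ := fun k hk => by
    rw [Finset.mem_Icc] at hk
    have hk0 : (0 : ℝ) < k := by exact_mod_cast hk.1
    have hl : Real.log k ≤ Real.log M := Real.log_le_log hk0 (by exact_mod_cast hk.2)
    rw [abs_mul]
    calc |a k| * |∫ ω, U k ω ∂P - κ| ≤ α * (A * (1 + Real.log k) / k) :=
          mul_le_mul (ha k hk.1 hk.2) (hU.mean k hk.1 hk.2) (abs_nonneg _) hα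
      _ ≤ α * (A * (1 + Real.log M) / k) := by gcongr
      _ = _ := by ring
  rw [e]
  refine (Finset.abs_sum_le_sum_abs _ _).trans ((Finset.sum_le_sum hterm).trans ?_)
  rw [← Finset.mul_sum]
  have hl : 0 ≤ 1 + Real.log M := by have := Real.log_natCast_nonneg M; linarith
  calc _ ≤ α * A * (1 + Real.log M) * (1 + Real.log M) := by
        gcongr; exact sum_inv_le_one_add_log M
    _ = _ := by ring

lemma variance_weighted_sum {s : Finset ℕ} (hU : ∀ k ∈ s, MemLp (U k) 2 P) (a : ℕ → ℝ) :
    Var[fun ω => ∑ k ∈ s, a k * U k ω; P] =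
      ∑ j ∈ s, ∑ k ∈ s, a j * a k * cov[U j, U k; P] := by
  rw [← covariance_self (memLp_finsetSum _ fun k hk => (hU k hk).const_mul _).aemeasurable,
    covariance_fun_sum_fun_sum' (fun i hi => (hU i hi).const_mul _)
    (fun i hi => (hU i hi).const_mul _)]
  refine Finset.sum_congr rfl fun j _ => Finset.sum_congr rfl fun k _ => ?_
  rw [covariance_const_mul_left, covariance_const_mul_right, mul_assoc]

/-- No decorrelation is available here, but there are at most `K` terms, a number independent of
`M`. -/
lemma IsWeaklyCorrelated.variance_head_le (hU : IsWeaklyCorrelated P U M K A κ T)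
    (hA : 0 ≤ A) (ha : ∀ k, 1 ≤ k → k ≤ M → |a k| ≤ α) (hα : 0 ≤ α) :
    Var[fun ω => ∑ k ∈ (Finset.Icc 1 M).filter (· < K), a k * U k ω; P] ≤ (K * α * √A) ^ 2 := by
  set s := (Finset.Icc 1 M).filter (· < K) with hs
  have hmem : ∀ k ∈ s, 1 ≤ k ∧ k ≤ M := fun k hk => by
    rw [hs, Finset.mem_filter, Finset.mem_Icc] at hk; exact hk.1
  have hcard : (s.card : ℝ) ≤ K := by
    have : s ⊆ Finset.range K := fun k hk => by
      rw [hs, Finset.mem_filter] at hk; exact Finset.mem_range.2 hk.2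
    exact_mod_cast (Finset.card_le_card this).trans_eq (Finset.card_range K)
  rw [variance_weighted_sum (fun k hk => hU.memLp k (hmem k hk).1 (hmem k hk).2)]
  have hterm : ∀ j ∈ s, ∀ k ∈ s, a j * a k * cov[U j, U k; P] ≤ α * α * A := fun j hj k hk => by
    obtain ⟨hj1, hj2⟩ := hmem j hj
    obtain ⟨hk1, hk2⟩ := hmem k hk
    refine (le_abs_self _).trans ?_
    rw [abs_mul, abs_mul]
    have h := abs_covariance_le_of_variance_le (hU.memLp j hj1 hj2) (hU.memLp k hk1 hk2)
      (Real.sqrt_nonneg A) (Real.sqrt_nonneg A)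
      ((hU.variance_le j hj1 hj2).trans_eq (Real.sq_sqrt hA).symm)
      ((hU.variance_le k hk1 hk2).trans_eq (Real.sq_sqrt hA).symm)
    rw [Real.mul_self_sqrt hA] at h
    have := ha j hj1 hj2
    have := ha k hk1 hk2
    gcongr
  calc _ ≤ ∑ j ∈ s, ∑ k ∈ s, α * α * A :=
        Finset.sum_le_sum fun j hj => Finset.sum_le_sum fun k hk => hterm j hj k hk
    _ = (s.card : ℝ) ^ 2 * (α ^ 2 * A) := by simp; ring
    _ ≤ (K : ℝ) ^ 2 * (α ^ 2 * A) := by gcongr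
    _ = _ := by rw [mul_pow, Real.sq_sqrt hA]; ring

/-- The covariance bound factorises in `j` and `k`, so the off-diagonal part is at most the square
of a harmonic sum. With the squared logarithm already present, this makes the fourth power. -/
lemma IsWeaklyCorrelated.abs_variance_tail_sub_le (hU : IsWeaklyCorrelated P U M K A κ T)
    (hA : 0 ≤ A) (ha : ∀ k, 1 ≤ k → k ≤ M → |a k| ≤ α) (hα : 0 ≤ α) :
    |Var[fun ω => ∑ k ∈ (Finset.Icc 1 M).filter (fun k => ¬ k < K), a k * U k ω; P] -
      T * ∑ k ∈ (Finset.Icc 1 M).filter (fun k => ¬ k < K), a k ^ 2| ≤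
      2 * α ^ 2 * A * (1 + Real.log M) ^ 4 := by
  set s := (Finset.Icc 1 M).filter (fun k => ¬ k < K) with hs
  set Λ := 1 + Real.log M with hΛ
  have hΛ1 : 1 ≤ Λ := by have := Real.log_natCast_nonneg M; linarith
  have hmem : ∀ k ∈ s, 1 ≤ k ∧ k ≤ M ∧ K ≤ k := fun k hk => by
    rw [hs, Finset.mem_filter, Finset.mem_Icc, not_lt] at hk; exact ⟨hk.1.1, hk.1.2, hk.2⟩
  have hlog : ∀ k ∈ s, 0 ≤ 1 + Real.log k ∧ 1 + Real.log k ≤ Λ := fun k hk => by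
    obtain ⟨h1, h2, -⟩ := hmem k hk
    have hk0 : (0 : ℝ) < k := by exact_mod_cast h1
    have := Real.log_natCast_nonneg k
    have : Real.log k ≤ Real.log M := Real.log_le_log hk0 (by exact_mod_cast h2)
    constructor <;> linarith
  have hsum : ∑ k ∈ s, (k : ℝ)⁻¹ ≤ Λ :=
    (Finset.sum_le_sum_of_subset_of_nonneg (Finset.filter_subset _ _)
      fun _ _ _ => by positivity).trans (sum_inv_le_one_add_log M)
  have hsum0 : 0 ≤ ∑ k ∈ s, (k : ℝ)⁻¹ := Finset.sum_nonneg fun _ _ => by positivity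
  have hoff : ∀ j ∈ s, ∀ k ∈ s, k < j → |cov[U j, U k; P]| ≤ A * Λ ^ 2 * ((j : ℝ)⁻¹ * (k : ℝ)⁻¹) := by
    intro j hj k hk hkj
    have h := hU.covariance j k (hmem k hk).1 (hmem k hk).2.2 hkj (hmem j hj).2.1
    refine h.trans ?_
    have h1 := hlog j hj
    calc A * (1 + Real.log j) ^ 2 / (j * k) ≤ A * Λ ^ 2 / (j * k) := by
          gcongr
          exact h1.2
      _ = _ := by rw [div_eq_mul_inv, mul_inv]
  have hterm : ∀ j ∈ s, ∀ k ∈ s, |a j * a k * (cov[U j, U k; P] - if j = k then T else 0)| ≤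
      α ^ 2 * A * Λ ^ 2 * ((j : ℝ)⁻¹ * (k : ℝ)⁻¹) +
        (if j = k then α ^ 2 * A * Λ * (k : ℝ)⁻¹ else 0) := fun j hj k hk => by
    have haj := ha j (hmem j hj).1 (hmem j hj).2.1
    have hak := ha k (hmem k hk).1 (hmem k hk).2.1
    rw [abs_mul, abs_mul]
    have hcov : |cov[U j, U k; P] - if j = k then T else 0| ≤
        A * Λ ^ 2 * ((j : ℝ)⁻¹ * (k : ℝ)⁻¹) + (if j = k then A * Λ * (k : ℝ)⁻¹ else 0) := by
      rcases lt_trichotomy j k with h | h | h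
      · rw [if_neg h.ne, if_neg h.ne, sub_zero, add_zero, covariance_comm, mul_comm (j : ℝ)⁻¹]
        exact hoff k hk j hj h
      · subst h
        rw [if_pos rfl, if_pos rfl, covariance_self (hU.memLp j (hmem j hj).1
          (hmem j hj).2.1).aemeasurable]
        have h := hU.variance j (hmem j hj).1 (hmem j hj).2.1
        have h1 := hlog j hj
        calc _ ≤ A * (1 + Real.log j) / j := h
          _ ≤ A * Λ / j := by gcongr; exact h1.2
          _ = 0 + A * Λ * (j : ℝ)⁻¹ := by rw [zero_add, div_eq_mul_inv]
          _ ≤ _ := by gcongr; positivity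
      · rw [if_neg h.ne', if_neg h.ne', sub_zero, add_zero]
        exact hoff j hj k hk h
    calc |a j| * |a k| * |cov[U j, U k; P] - if j = k then T else 0| ≤ α * α *
          (A * Λ ^ 2 * ((j : ℝ)⁻¹ * (k : ℝ)⁻¹) + (if j = k then A * Λ * (k : ℝ)⁻¹ else 0)) := by
          gcongr
      _ = _ := by split_ifs <;> ring
  have e : Var[fun ω => ∑ k ∈ s, a k * U k ω; P] - T * ∑ k ∈ s, a k ^ 2 =
      ∑ j ∈ s, ∑ k ∈ s, a j * a k * (cov[U j, U k; P] - if j = k then T else 0) := by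
    rw [variance_weighted_sum (fun k hk => hU.memLp k (hmem k hk).1 (hmem k hk).2.1)]
    simp only [mul_sub, Finset.sum_sub_distrib]
    congr 1
    rw [Finset.mul_sum]
    refine Finset.sum_congr rfl fun j hj => ?_
    simp only [mul_ite, mul_zero, Finset.sum_ite_eq, if_pos hj]
    ring
  rw [e]
  calc _ ≤ ∑ j ∈ s, ∑ k ∈ s, (α ^ 2 * A * Λ ^ 2 * ((j : ℝ)⁻¹ * (k : ℝ)⁻¹) +
        (if j = k then α ^ 2 * A * Λ * (k : ℝ)⁻¹ else 0)) := by
        refine (Finset.abs_sum_le_sum_abs _ _).trans (Finset.sum_le_sum fun j hj => ?_)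
        exact (Finset.abs_sum_le_sum_abs _ _).trans (Finset.sum_le_sum fun k hk => hterm j hj k hk)
    _ = α ^ 2 * A * Λ ^ 2 * ((∑ k ∈ s, (k : ℝ)⁻¹) * ∑ k ∈ s, (k : ℝ)⁻¹) +
        α ^ 2 * A * Λ * ∑ k ∈ s, (k : ℝ)⁻¹ := by
        simp only [Finset.sum_add_distrib]
        congr 1
        · rw [Finset.sum_mul_sum, Finset.mul_sum]
          exact Finset.sum_congr rfl fun j _ => by rw [Finset.mul_sum]
        · rw [Finset.mul_sum]
          exact Finset.sum_congr rfl fun j hj => by rw [Finset.sum_ite_eq, if_pos hj]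
    _ ≤ α ^ 2 * A * Λ ^ 2 * (Λ * Λ) + α ^ 2 * A * Λ * Λ := by gcongr
    _ = α ^ 2 * A * (Λ ^ 4 + Λ ^ 2) := by ring
    _ ≤ α ^ 2 * A * (Λ ^ 4 + Λ ^ 4) := by
        have : Λ ^ 2 ≤ Λ ^ 4 := pow_le_pow_right₀ hΛ1 (by norm_num)
        gcongr
    _ = _ := by ring

/-- The sum is cut at `K`, and the covariance of head and tail is bounded by Cauchy–Schwarz. This
cross term is small because the head is, the tail having standard deviation of order `√b`. -/
lemma IsWeaklyCorrelated.abs_variance_sub_le (hU : IsWeaklyCorrelated P U M K A κ T)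
    (hA : 0 ≤ A) (ha : ∀ k, 1 ≤ k → k ≤ M → |a k| ≤ α) (hα : 0 ≤ α)
    {b : ℝ} (hb : ∑ k ∈ Finset.Icc 1 M, a k ^ 2 ≤ b) :
    |Var[fun ω => ∑ k ∈ Finset.Icc 1 M, a k * U k ω; P] - T * ∑ k ∈ Finset.Icc 1 M, a k ^ 2| ≤
      (K * α * √A) ^ 2 +
      2 * (K * α * √A) * √(|T| * b + 2 * α ^ 2 * A * (1 + Real.log M) ^ 4) +
      2 * α ^ 2 * A * (1 + Real.log M) ^ 4 + |T| * (K * α ^ 2) := by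
  set s := (Finset.Icc 1 M).filter (· < K) with hs
  set s' := (Finset.Icc 1 M).filter (fun k => ¬ k < K) with hs'
  have hLp : ∀ k ∈ Finset.Icc 1 M, MemLp (U k) 2 P := fun k hk =>
    hU.memLp k (Finset.mem_Icc.1 hk).1 (Finset.mem_Icc.1 hk).2
  have h1 : MemLp (fun ω => ∑ k ∈ s, a k * U k ω) 2 P :=
    memLp_finsetSum _ fun k hk => (hLp k (Finset.mem_filter.1 hk).1).const_mul _
  have h2 : MemLp (fun ω => ∑ k ∈ s', a k * U k ω) 2 P :=
    memLp_finsetSum _ fun k hk => (hLp k (Finset.mem_filter.1 hk).1).const_mul _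
  have hV1 := hU.variance_head_le hA ha hα
  have hV2 := hU.abs_variance_tail_sub_le hA ha hα
  rw [← hs] at hV1
  rw [← hs'] at hV2
  set E := 2 * α ^ 2 * A * (1 + Real.log M) ^ 4 with hE
  have hE0 : 0 ≤ E := (abs_nonneg _).trans hV2
  have esplit : (fun ω => ∑ k ∈ Finset.Icc 1 M, a k * U k ω) =
      fun ω => ∑ k ∈ s, a k * U k ω + ∑ k ∈ s', a k * U k ω := by
    ext ω; exact (Finset.sum_filter_add_sum_filter_not _ _ _).symm
  have esq : ∑ k ∈ Finset.Icc 1 M, a k ^ 2 = ∑ k ∈ s, a k ^ 2 + ∑ k ∈ s', a k ^ 2 :=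
    (Finset.sum_filter_add_sum_filter_not _ _ _).symm
  have hs0 : 0 ≤ ∑ k ∈ s, a k ^ 2 := Finset.sum_nonneg fun _ _ => sq_nonneg _
  have hs0' : 0 ≤ ∑ k ∈ s', a k ^ 2 := Finset.sum_nonneg fun _ _ => sq_nonneg _
  have hb' : ∑ k ∈ s', a k ^ 2 ≤ b := by linarith
  have hb0 : 0 ≤ b := hs0'.trans hb'
  have hT : T * ∑ k ∈ s', a k ^ 2 ≤ |T| * b :=
    (mul_le_mul_of_nonneg_right (le_abs_self T) hs0').trans
      (mul_le_mul_of_nonneg_left hb' (abs_nonneg T))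
  have hcov := abs_covariance_le_of_variance_le h1 h2 (a := K * α * √A) (by positivity)
    (Real.sqrt_nonneg (|T| * b + E)) hV1 (by
      rw [Real.sq_sqrt (by positivity)]
      linarith [(abs_le.1 hV2).2])
  have hcard : (s.card : ℝ) ≤ K := by
    have : s ⊆ Finset.range K := fun k hk => by
      rw [hs, Finset.mem_filter] at hk; exact Finset.mem_range.2 hk.2
    exact_mod_cast (Finset.card_le_card this).trans_eq (Finset.card_range K)
  have hhead : ∑ k ∈ s, a k ^ 2 ≤ K * α ^ 2 := by
    calc ∑ k ∈ s, a k ^ 2 ≤ ∑ k ∈ s, α ^ 2 := by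
          refine Finset.sum_le_sum fun k hk => ?_
          have h := Finset.mem_Icc.1 (Finset.mem_filter.1 hk).1
          rw [← sq_abs]
          exact pow_le_pow_left₀ (abs_nonneg _) (ha k h.1 h.2) 2
      _ = s.card * α ^ 2 := by simp
      _ ≤ _ := by gcongr
  have hTh : |T * ∑ k ∈ s, a k ^ 2| ≤ |T| * (K * α ^ 2) := by
    rw [abs_mul, abs_of_nonneg hs0]; gcongr
  rw [esplit, variance_fun_add h1 h2, esq]
  have hv0 := variance_nonneg (fun ω => ∑ k ∈ s, a k * U k ω) P
  rw [abs_le] at hcov hV2 hTh ⊢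
  constructor <;> nlinarith [hcov.1, hcov.2, hV2.1, hV2.2, hTh.1, hTh.2]

/-- The error in `IsWeaklyCorrelated.abs_variance_sub_le` is `o(1/m)` for weights of size
`O((1 + log m) / m)`. -/
lemma tendsto_varianceError (K : ℕ) (A T : ℝ) (hA : 0 ≤ A) :
    Tendsto (fun m : ℕ => (m : ℝ) * ((K * (2 * (1 + Real.log m) / m) * √A) ^ 2 +
      2 * (K * (2 * (1 + Real.log m) / m) * √A) * √(|T| * (1 / m) +
        2 * (2 * (1 + Real.log m) / m) ^ 2 * A * (1 + Real.log m) ^ 4) +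
      2 * (2 * (1 + Real.log m) / m) ^ 2 * A * (1 + Real.log m) ^ 4 +
      |T| * (K * (2 * (1 + Real.log m) / m) ^ 2))) atTop (𝓝 0) := by
  have t := tendsto_one_add_log_pow_div_atTop
  have h : Tendsto (fun m : ℕ => 4 * K ^ 2 * A * ((1 + Real.log m) ^ 2 / m) +
      4 * K * √A * √(|T| * ((1 + Real.log m) ^ 2 / m) + 8 * A * ((1 + Real.log m) ^ 4 / m) ^ 2) +
      8 * A * ((1 + Real.log m) ^ 6 / m) + 4 * |T| * K * ((1 + Real.log m) ^ 2 / m)) atTop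
      (𝓝 (4 * K ^ 2 * A * 0 + 4 * K * √A * √(|T| * 0 + 8 * A * 0 ^ 2) + 8 * A * 0 +
        4 * |T| * K * 0)) :=
    ((((t 2).const_mul _).add ((((t 2).const_mul _).add
      (((t 4).pow 2).const_mul _)).sqrt.const_mul _)).add ((t 6).const_mul _)).add
      ((t 2).const_mul _)
  norm_num at h
  refine h.congr' ?_
  filter_upwards [eventually_ge_atTop 1] with m hm
  have hm0 : (0 : ℝ) < m := by positivity
  have hl : 0 ≤ 1 + Real.log m := by have := Real.log_natCast_nonneg m; linarith
  set Λ := 1 + Real.log m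
  have e : √(|T| * (Λ ^ 2 / m) + 8 * A * (Λ ^ 4 / m) ^ 2) =
      Λ * √(|T| * (1 / m) + 2 * (2 * Λ / m) ^ 2 * A * Λ ^ 4) := by
    rw [← Real.sqrt_sq hl, ← Real.sqrt_mul (sq_nonneg _), Real.sqrt_sq hl]
    congr 1
    field_simp
    ring
  rw [e]
  set R := √(|T| * (1 / m) + 2 * (2 * Λ / m) ^ 2 * A * Λ ^ 4)
  rw [mul_pow _ (√A), Real.sq_sqrt hA]
  field_simp
  ring

end WeightedSums

/-! ### The bias from the smooth part of the spectral density -/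

section SmoothPart

/-- Second order Peano expansion at a critical point. -/
lemma abs_sub_quadratic_le {h h' : ℝ → ℝ} {c : ℝ} (hh : ∀ᶠ x in 𝓝 0, HasDerivAt h (h' x) x)
    (hh' : HasDerivAt h' c 0) (h0 : h' 0 = 0) {ε : ℝ} (hε : 0 < ε) :
    ∃ δ > 0, ∀ x, 0 ≤ x → x ≤ δ → |h x - h 0 - c / 2 * x ^ 2| ≤ ε * x ^ 2 := by
  have hlin : ∀ᶠ x in 𝓝 (0 : ℝ), |h' x - c * x| ≤ ε * |x| := by
    have := (hasDerivAt_iff_isLittleO.1 hh').def hε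
    filter_upwards [this] with x hx
    simpa [h0, mul_comm] using hx
  -- Linearising `h'` at the origin bounds the derivative of `h x - c x² / 2` by `ε x`; the mean
  -- value inequality on `[0, x]` then yields `ε x²`.
  obtain ⟨δ, hδ, hb⟩ := Metric.eventually_nhds_iff.1 (hh.and hlin)
  refine ⟨δ / 2, by positivity, fun x hx0 hxδ => ?_⟩
  have hmem : ∀ y ∈ Set.Icc 0 x, HasDerivAt h (h' y) y ∧ |h' y - c * y| ≤ ε * |y| := fun y hy =>
    hb (by rw [Real.dist_eq, sub_zero, abs_of_nonneg hy.1]; linarith [hy.2])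
  have hG : ∀ y ∈ Set.Icc 0 x,
      HasDerivWithinAt (fun y => h y - c / 2 * y ^ 2) (h' y - c * y) (Set.Icc 0 x) y := fun y hy => by
    have := (hmem y hy).1.sub ((hasDerivAt_pow 2 y).const_mul (c / 2))
    refine HasDerivAt.hasDerivWithinAt ?_
    convert! this using 1
    push_cast
    ring
  have := (convex_Icc 0 x).norm_image_sub_le_of_norm_hasDerivWithin_le hG (C := ε * x)
    (fun y hy => by
      refine (hmem y hy).2.trans ?_
      rw [abs_of_nonneg hy.1]
      exact mul_le_mul_of_nonneg_left hy.2 hε.le)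
    (Set.left_mem_Icc.2 hx0) (Set.right_mem_Icc.2 hx0)
  rw [Real.norm_eq_abs, Real.norm_eq_abs, sub_zero, abs_of_nonneg hx0] at this
  calc _ = |h x - c / 2 * x ^ 2 - (h 0 - c / 2 * 0 ^ 2)| := by ring_nf
    _ ≤ ε * x * x := this
    _ = _ := by ring

/-- Because `f⋆'(0) = 0`, the logarithm has a critical point at the origin, with second derivative
`f⋆''(0) / f⋆(0)`. -/
lemma abs_log_sub_log_quadratic_le {fstar : ℝ → ℝ} {Ω₀ : ℝ} (hΩ₀ : 0 < Ω₀) (hf0 : 0 < fstar 0)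
    (hdiff : ∀ k < 3, ∀ ω ∈ Set.Ioo (-Ω₀) Ω₀, DifferentiableAt ℝ (iteratedDeriv k fstar) ω)
    (hderiv : deriv fstar 0 = 0) {ε : ℝ} (hε : 0 < ε) :
    ∃ δ > 0, ∀ x, 0 ≤ x → x ≤ δ → |Real.log (fstar x) - Real.log (fstar 0) -
      iteratedDeriv 2 fstar 0 / fstar 0 / 2 * x ^ 2| ≤ ε * x ^ 2 := by
  have h0 : ∀ x ∈ Set.Ioo (-Ω₀) Ω₀, HasDerivAt fstar (deriv fstar x) x := fun x hx => by
    have := hdiff 0 (by norm_num) x hx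
    rw [iteratedDeriv_zero] at this
    exact this.hasDerivAt
  have hmem : (0 : ℝ) ∈ Set.Ioo (-Ω₀) Ω₀ := ⟨by linarith, hΩ₀⟩
  have h1 : HasDerivAt (deriv fstar) (iteratedDeriv 2 fstar 0) 0 := by
    have := hdiff 1 (by norm_num) 0 hmem
    rw [iteratedDeriv_one] at this
    have e : iteratedDeriv 2 fstar 0 = deriv (deriv fstar) 0 := by
      rw [iteratedDeriv_succ, iteratedDeriv_one]
    rw [e]
    exact this.hasDerivAt
  refine abs_sub_quadratic_le (h := fun x => Real.log (fstar x))
    (h' := fun x => deriv fstar x / fstar x) ?_ ?_ (by simp [hderiv]) hε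
  · filter_upwards [isOpen_Ioo.mem_nhds hmem,
      (h0 0 hmem).continuousAt.eventually (lt_mem_nhds hf0)] with x hx hpos
    exact (h0 x hx).log hpos.ne'
  · have := h1.div (h0 0 hmem) hf0.ne'
    convert! this using 1
    rw [hderiv]
    field_simp
    ring

/-- The contribution of the smooth part of the spectral density to the bias. -/
lemma isLittleO_sum_log_smooth {fstar : ℝ → ℝ} {Ω₀ : ℝ} (hΩ₀ : 0 < Ω₀) (hf0 : 0 < fstar 0)
    (hdiff : ∀ k < 3, ∀ ω ∈ Set.Ioo (-Ω₀) Ω₀, DifferentiableAt ℝ (iteratedDeriv k fstar) ω)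
    (hderiv : deriv fstar 0 = 0) {m : ℕ → ℕ} (hm : Tendsto m atTop atTop)
    (hmn : Tendsto (fun n : ℕ => (m n : ℝ) / (n : ℝ)) atTop (𝓝 0)) :
    (fun n : ℕ => ∑ k ∈ Finset.Icc 1 (m n), regressionWeight 1 (m n) k *
        (Real.log (fstar (fourierFreq n k)) - Real.log (fstar 0)) -
      -(2 * Real.pi ^ 2 * iteratedDeriv 2 fstar 0 * (m n : ℝ) ^ 2
              / (9 * fstar 0 * (n : ℝ) ^ 2)))
      =o[atTop] (fun n : ℕ => (m n : ℝ) ^ 2 / (n : ℝ) ^ 2) := by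
  have hpi := Real.pi_pos
  set c := iteratedDeriv 2 fstar 0 / fstar 0 with hc
  have hA : Tendsto (fun n : ℕ => |c| / 2 * (2 * Real.pi) ^ 2 *
      |(∑ k ∈ Finset.Icc 1 (m n), regressionWeight 1 (m n) k * (k : ℝ) ^ 2) / (m n : ℝ) ^ 2 -
        -(1 / 9)|) atTop (𝓝 0) := by
    have h := ((tendsto_sum_regressionWeight_mul_sq.comp hm).sub_const (-(1 / 9))).abs.const_mul
      (|c| / 2 * (2 * Real.pi) ^ 2)
    simpa using h
  rw [isLittleO_iff]
  intro ε hε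
  obtain ⟨δ, hδ, hb⟩ := abs_log_sub_log_quadratic_le hΩ₀ hf0 hdiff hderiv
    (ε := ε / 2 / (2 * Real.pi) ^ 2) (by positivity)
  have hω : Tendsto (fun n : ℕ => fourierFreq n (m n)) atTop (𝓝 0) := by
    have := hmn.const_mul (2 * Real.pi)
    rw [mul_zero] at this
    refine this.congr fun n => ?_
    rw [fourierFreq, mul_div_assoc]
  filter_upwards [hm.eventually eventually_regressionWeight, hm.eventually_ge_atTop 1,
    eventually_ge_atTop 1, hω.eventually (ge_mem_nhds hδ),
    hA.eventually (ge_mem_nhds (show 0 < ε / 2 by positivity))] with n hw hm1 hn hωδ hAn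
  obtain ⟨-, hw2, -⟩ := hw
  set M := m n with hM
  have hM0 : (0 : ℝ) < M := by positivity
  have hn0 : (0 : ℝ) < n := by positivity
  set a := regressionWeight 1 M
  have hω2 : fourierFreq n M ^ 2 = (2 * Real.pi) ^ 2 * ((M : ℝ) ^ 2 / (n : ℝ) ^ 2) := by
    rw [fourierFreq]; field_simp
  have hterm : ∀ k ∈ Finset.Icc 1 M,
      |a k * (Real.log (fstar (fourierFreq n k)) - Real.log (fstar 0) -
        c / 2 * fourierFreq n k ^ 2)| ≤ |a k| * (ε / 2 * ((M : ℝ) ^ 2 / (n : ℝ) ^ 2)) := by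
    intro k hk
    rw [Finset.mem_Icc] at hk
    have h1 := fourierFreq_pos hn hk.1
    have h2 : fourierFreq n k ≤ fourierFreq n M := fourierFreq_mono n hk.2
    rw [abs_mul]
    refine mul_le_mul_of_nonneg_left ?_ (abs_nonneg _)
    calc _ ≤ ε / 2 / (2 * Real.pi) ^ 2 * fourierFreq n k ^ 2 := hb _ h1.le (h2.trans hωδ)
      _ ≤ ε / 2 / (2 * Real.pi) ^ 2 * fourierFreq n M ^ 2 := by gcongr
      _ = _ := by rw [hω2]; field_simp
  -- The first part is the Peano remainder, controlled by `∑ |a_k| ≤ 1`; the second compares `∑ a_k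
  -- k² / m²` with its limit `-1/9`. The main term arises as `(c / 2) (2π)² (-1/9) = -2π² c / 9`.
  have e : ∑ k ∈ Finset.Icc 1 M, a k *
        (Real.log (fstar (fourierFreq n k)) - Real.log (fstar 0)) -
      -(2 * Real.pi ^ 2 * iteratedDeriv 2 fstar 0 * (M : ℝ) ^ 2 / (9 * fstar 0 * (n : ℝ) ^ 2)) =
      ∑ k ∈ Finset.Icc 1 M, a k * (Real.log (fstar (fourierFreq n k)) - Real.log (fstar 0) -
        c / 2 * fourierFreq n k ^ 2) +
      c / 2 * (2 * Real.pi) ^ 2 * ((∑ k ∈ Finset.Icc 1 M, a k * (k : ℝ) ^ 2) / (M : ℝ) ^ 2 -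
        -(1 / 9)) * ((M : ℝ) ^ 2 / (n : ℝ) ^ 2) := by
    have e1 : ∑ k ∈ Finset.Icc 1 M, a k * (c / 2 * fourierFreq n k ^ 2) =
        c / 2 * ((2 * Real.pi) ^ 2 / (n : ℝ) ^ 2) * ∑ k ∈ Finset.Icc 1 M, a k * (k : ℝ) ^ 2 := by
      rw [Finset.mul_sum]
      refine Finset.sum_congr rfl fun k _ => ?_
      rw [fourierFreq]; field_simp
    simp only [mul_sub _ _ (c / 2 * _), Finset.sum_sub_distrib, e1]
    rw [hc]
    field_simp
    ring
  have hq : 0 ≤ (M : ℝ) ^ 2 / (n : ℝ) ^ 2 := by positivity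
  rw [e, Real.norm_eq_abs, Real.norm_of_nonneg hq]
  refine (abs_add_le _ _).trans ?_
  have p1 : |∑ k ∈ Finset.Icc 1 M, a k * (Real.log (fstar (fourierFreq n k)) -
      Real.log (fstar 0) - c / 2 * fourierFreq n k ^ 2)| ≤
      ε / 2 * ((M : ℝ) ^ 2 / (n : ℝ) ^ 2) := by
    refine (Finset.abs_sum_le_sum_abs _ _).trans ((Finset.sum_le_sum hterm).trans ?_)
    rw [← Finset.sum_mul]
    exact mul_le_of_le_one_left (by positivity) hw2
  have p2 : |c / 2 * (2 * Real.pi) ^ 2 * ((∑ k ∈ Finset.Icc 1 M, a k * (k : ℝ) ^ 2) / (M : ℝ) ^ 2 -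
        -(1 / 9)) * ((M : ℝ) ^ 2 / (n : ℝ) ^ 2)| ≤ ε / 2 * ((M : ℝ) ^ 2 / (n : ℝ) ^ 2) := by
    rw [abs_mul, abs_of_nonneg hq, abs_mul, abs_mul, abs_div, abs_two,
      abs_of_pos (by positivity : 0 < (2 * Real.pi) ^ 2)]
    exact mul_le_mul_of_nonneg_right hAn hq
  linarith

end SmoothPart

/-! ### Decomposition of the estimator and the theorem -/

section Estimator

variable {Ω : Type*} [MeasurableSpace Ω] {P : Measure Ω} {X : ℤ → Ω → ℝ}
  {d : ℝ} {fstar : ℝ → ℝ}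

/-- The regression removes the constants and the power law from the log-periodogram. -/
lemma memoryEstimator_ae_eq {g n M : ℕ} (hg : 1 ≤ g) (hn : 1 ≤ n) (hM : 1 ≤ M)
    (hf : ∀ k, 1 ≤ k → k ≤ M → 0 < fstar (fourierFreq n k))
    (hpos : ∀ k, 1 ≤ k → k ≤ M → ∀ᵐ ω ∂P,
      0 < ‖arrayVector (normalisedTrig X (memorySpectralDensity d fstar) g n M) k ω‖ ^ 2)
    (hw : ∑ k ∈ Finset.Icc 1 M, regressionWeight n M k * (-2 * Real.log (fourierFreq n k)) = 1) :
    (fun ω => memoryEstimator (fun t => X t ω) g n M) =ᵐ[P] fun ω =>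
      (d + ∑ k ∈ Finset.Icc 1 M, regressionWeight 1 M k *
        (Real.log (fstar (fourierFreq n k)) - Real.log (fstar 0))) +
      ∑ k ∈ Finset.Icc 1 M, regressionWeight 1 M k * Real.log
        (‖arrayVector (normalisedTrig X (memorySpectralDensity d fstar) g n M) k ω‖ ^ 2) := by
  have hall : ∀ᵐ ω ∂P, ∀ k : Finset.Icc 1 M,
      0 < ‖arrayVector (normalisedTrig X (memorySpectralDensity d fstar) g n M) k ω‖ ^ 2 :=
    ae_all_iff.2 fun k => hpos k (Finset.mem_Icc.1 k.2).1 (Finset.mem_Icc.1 k.2).2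
  have hg' : (0 : ℝ) < g := by exact_mod_cast hg
  filter_upwards [hall] with ω hω
  have hterm : ∀ k ∈ Finset.Icc 1 M, regressionWeight n M k *
      Real.log (averagedPeriodogram (fun t => X t ω) g n k) =
      d * (regressionWeight n M k * (-2 * Real.log (fourierFreq n k))) +
      regressionWeight 1 M k * (Real.log (fstar (fourierFreq n k)) - Real.log (fstar 0)) +
      regressionWeight 1 M k * Real.log
        (‖arrayVector (normalisedTrig X (memorySpectralDensity d fstar) g n M) k ω‖ ^ 2) +
      regressionWeight 1 M k * (Real.log (fstar 0) + Real.log ((2 * (g : ℝ))⁻¹)) := fun k hk => by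
    have hk1 := (Finset.mem_Icc.1 hk).1
    have hω0 := fourierFreq_pos hn hk1
    have hfk := hf k hk1 (Finset.mem_Icc.1 hk).2
    have hfpos : 0 < memorySpectralDensity d fstar (fourierFreq n k) :=
      memorySpectralDensity_pos hω0 hfk
    rw [norm_sq_arrayVector_normalisedTrig hg hn hk hfpos,
      Real.log_mul (by positivity) (hω ⟨k, hk⟩).ne', Real.log_mul hfpos.ne' (by positivity),
      memorySpectralDensity, abs_of_pos hω0, Real.log_mul (by positivity) hfk.ne',
      Real.log_rpow hω0, regressionWeight_eq hn hM hk1]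
    ring
  rw [memoryEstimator, Finset.sum_congr rfl hterm]
  simp only [Finset.sum_add_distrib, ← Finset.mul_sum, ← Finset.sum_mul, hw,
    sum_regressionWeight hM]
  ring

end Estimator

theorem mainTheorem5 {Ω : Type*} [MeasurableSpace Ω] (P : Measure Ω) [IsProbabilityMeasure P]
    (X : ℤ → Ω → ℝ) (hX : IsGaussianProcess X P) (hstat : IsCovarianceStationary X P)
    (d : ℝ) (hd : d ∈ Set.Ioo (-(1 / 2) : ℝ) (1 / 2))
    (fstar : ℝ → ℝ) (hf : HasSpectralDensity X P (memorySpectralDensity d fstar))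
    (hf0 : 0 < fstar 0)
    (μ ν : ℝ) (hμ : 1 ≤ μ) (hν : ν ∈ Set.Ioc (0 : ℝ) 1) (hL : LocalLipschitz μ ν fstar)
    (Ω₀ : ℝ) (hΩ₀ : Ω₀ ∈ Set.Ioc 0 Real.pi)
    (hdiff : ∀ k < 3, ∀ ω ∈ Set.Ioo (-Ω₀) Ω₀, DifferentiableAt ℝ (iteratedDeriv k fstar) ω)
    (hderiv : deriv fstar 0 = 0)
    (g : ℕ) (hg : 1 ≤ g)
    (m : ℕ → ℕ) (hm : Tendsto m atTop atTop)
    (hmn : Tendsto (fun n : ℕ => (m n : ℝ) / (n : ℝ)) atTop (𝓝 0)) :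
    (∀ᶠ n : ℕ in atTop, MemLp (fun x => memoryEstimator (fun t => X t x) g n (m n)) 2 P) ∧
    (∃ r s : ℕ → ℝ,
      r =o[atTop] (fun n : ℕ => (m n : ℝ) ^ 2 / (n : ℝ) ^ 2) ∧
      s =O[atTop] (fun n : ℕ => Real.log (m n) ^ 3 / (m n : ℝ)) ∧
      ∀ᶠ n : ℕ in atTop,
        ∫ x, (memoryEstimator (fun t => X t x) g n (m n) - d) ∂P =
          -(2 * Real.pi ^ 2 * iteratedDeriv 2 fstar 0 * (m n : ℝ) ^ 2
              / (9 * fstar 0 * (n : ℝ) ^ 2)) + r n + s n) ∧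
    (∃ q : ℕ → ℝ,
      q =o[atTop] (fun n : ℕ => 1 / (m n : ℝ)) ∧
      ∀ᶠ n : ℕ in atTop,
        Var[fun x => memoryEstimator (fun t => X t x) g n (m n); P] =
          trigamma g / (4 * (m n : ℝ)) + q n) := by
  have hpi := Real.pi_pos
  have hμ0 : 0 < μ := by linarith
  have hd2 : |2 * d| < 1 := by rw [abs_lt]; constructor <;> linarith [hd.1, hd.2]
  have : Nonempty (Fin g) := ⟨⟨0, hg⟩⟩
  set f := memorySpectralDensity d fstar with hfdef
  set C := orthonormalityConst d μ
  obtain ⟨K, A, hA, hKA⟩ := exists_isWeaklyCorrelated (P := P) (ι := Fin g × Bool) (C := C)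
    (c := 1 / (64 * Real.pi * μ)) (orthonormalityConst_nonneg hμ0.le hd2) (by positivity)
  set κ := meanLogNormSq (Fin g × Bool)
  -- The vectors have dimension `2g`, so the Gamma shape is `g`.
  have hT : trigamma (((Fintype.card (Fin g × Bool) : ℕ) : ℝ) / 2) = trigamma g := by
    congr 1
    simp
  rw [hT] at hKA
  set T := trigamma g
  set U : ℕ → ℕ → Ω → ℝ := fun n k ω =>
    Real.log (‖arrayVector (normalisedTrig X f g n (m n)) k ω‖ ^ 2)
  set D : ℕ → ℝ := fun n => ∑ k ∈ Finset.Icc 1 (m n), regressionWeight 1 (m n) k *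
        (Real.log (fstar (fourierFreq n k)) - Real.log (fstar 0))
  have hcont : ContinuousAt fstar 0 := by
    have := hdiff 0 (by norm_num) 0 ⟨by linarith [hΩ₀.1], hΩ₀.1⟩
    rw [iteratedDeriv_zero] at this
    exact this.continuousAt
  obtain ⟨δ, hδ, hlow⟩ := Metric.eventually_nhds_iff.1
    (hcont.eventually (lt_mem_nhds (half_lt_self hf0)))
  have hω : Tendsto (fun n : ℕ => fourierFreq n (m n)) atTop (𝓝 0) := by
    have := hmn.const_mul (2 * Real.pi)
    rw [mul_zero] at this
    exact this.congr fun n => by rw [fourierFreq, mul_div_assoc]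
  -- Behind these facts lie `4 m ≤ n`, which keeps the frequencies below `π / 2`, and `2 ω_m < δ`,
  -- which keeps `f⋆` above half its value at zero. The condition `3 ≤ m` gives `log m ≥ 1`.
  have main : ∀ᶠ n : ℕ in atTop, 3 ≤ m n ∧
      (∀ k, 1 ≤ k → k ≤ m n → |regressionWeight 1 (m n) k| ≤ 2 * (1 + Real.log (m n)) / m n) ∧
      (m n : ℝ) ≤ ∑ k ∈ Finset.Icc 1 (m n), centredRegressor 1 (m n) k ^ 2 ∧
      IsWeaklyCorrelated P (U n) (m n) K A κ T ∧
      (fun ω => memoryEstimator (fun t => X t ω) g n (m n)) =ᵐ[P] fun ω =>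
        (d + D n) + ∑ k ∈ Finset.Icc 1 (m n), regressionWeight 1 (m n) k * U n k ω := by
    filter_upwards [hm.eventually_ge_atTop 3, hm.eventually eventually_regressionWeight,
      hm.eventually eventually_le_sum_centredRegressor_sq, eventually_ge_atTop 1,
      hmn.eventually (ge_mem_nhds (show (0 : ℝ) < 1 / 4 by norm_num)),
      hω.eventually (gt_mem_nhds (show 0 < δ / 2 by positivity))] with n hm3 hw hS hn h4 hδn
    have hn0 : (0 : ℝ) < n := by positivity
    have hm0 : (0 : ℝ) < m n := by exact_mod_cast (by omega : 0 < m n)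
    have h4n : 4 * m n ≤ n := by
      rw [div_le_iff₀ hn0] at h4
      have : (4 * m n : ℝ) ≤ n := by linarith
      exact_mod_cast this
    have hlow' : ∀ x, 0 ≤ x → x ≤ 2 * fourierFreq n (m n) → fstar 0 / 2 ≤ fstar x :=
      fun x hx0 hx => (hlow (by
        rw [Real.dist_eq, sub_zero, abs_of_nonneg hx0]; linarith)).le
    have hωm : 0 < fourierFreq n (m n) := fourierFreq_pos hn (by omega)
    obtain ⟨hpos, hweak⟩ := hKA (normalisedTrig X f g n (m n)) (m n)
      (isGaussianProcess_normalisedTrig hX f g n (m n))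
      (integral_normalisedTrig hstat f (by omega))
      (fun j k i i' hk hkj hj => abs_covariance_normalisedTrig_sub_le hL hν.1 hμ0.le hd2 hf
        hstat.memLp hf0 h4n (fun x hx0 hx => hlow' x hx0 (by linarith)) hk hkj hj i i')
      (fun k hk hkM => exists_le_variance_normalisedTrig hL hμ0 hd2 hf hstat.memLp hf0 hg h4n
        hlow' hk hkM)
    refine ⟨hm3, fun k hk hkm => (hw.1 k hk hkm).trans ?_, hS, hweak,
      memoryEstimator_ae_eq hg hn (by omega) (fun k hk hkM => ?_) hpos (hw.2.2 n hn)⟩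
    · gcongr
      linarith
    · have h1 := fourierFreq_pos hn hk
      have h2 := fourierFreq_mono n hkM
      linarith [hlow' _ h1.le (by linarith)]
  have hLp : ∀ n, IsWeaklyCorrelated P (U n) (m n) K A κ T → MemLp (fun ω =>
      ∑ k ∈ Finset.Icc 1 (m n), regressionWeight 1 (m n) k * U n k ω) 2 P := fun n hn =>
    memLp_finsetSum _ fun k hk =>
      (hn.memLp k (Finset.mem_Icc.1 hk).1 (Finset.mem_Icc.1 hk).2).const_mul _
  have hα : ∀ n, 3 ≤ m n → 0 ≤ 2 * (1 + Real.log (m n)) / (m n : ℝ) := fun n _ => by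
    have := Real.log_natCast_nonneg (m n)
    positivity
  refine ⟨?_, ?_, ?_⟩
  · filter_upwards [main] with n ⟨_, _, _, hweak, hae⟩
    exact MemLp.ae_eq hae.symm ((memLp_const (d + D n)).add (hLp n hweak))
  · set B : ℕ → ℝ := fun n => -(2 * Real.pi ^ 2 * iteratedDeriv 2 fstar 0 * (m n : ℝ) ^ 2
              / (9 * fstar 0 * (n : ℝ) ^ 2))
    -- The bias is split exactly: the smooth error of `D` is the `o` term, and everything random
    -- goes into the `O` term.
    refine ⟨fun n => D n - B n, fun n =>
      ∫ x, (memoryEstimator (fun t => X t x) g n (m n) - d) ∂P - D n,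
      isLittleO_sum_log_smooth hΩ₀.1 hf0 hdiff hderiv hm hmn, ?_,
      Eventually.of_forall fun n => by simp only [B]; ring⟩
    -- `16 = 2 * 2³`: the weights bring a factor `2`, and `1 + log m ≤ 2 log m` is cubed.
    refine IsBigO.of_bound (16 * A) ?_
    filter_upwards [main] with n ⟨hm3, ha, _, hweak, hae⟩
    have hm0 : (0 : ℝ) < m n := by positivity
    have hlog1 : 1 ≤ Real.log (m n) := by
      rw [Real.le_log_iff_exp_le hm0]
      have : (3 : ℝ) ≤ m n := by exact_mod_cast hm3
      linarith [Real.exp_one_lt_three]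
    have hint := (hLp n hweak).integrable one_le_two
    have hmean : ∫ x, (memoryEstimator (fun t => X t x) g n (m n) - d) ∂P - D n =
        ∑ k ∈ Finset.Icc 1 (m n), regressionWeight 1 (m n) k * ∫ ω, U n k ω ∂P := by
      rw [integral_congr_ae (hae.mono fun ω hω => by
        show _ - d = D n + ∑ k ∈ Finset.Icc 1 (m n), regressionWeight 1 (m n) k * U n k ω
        have h := congrArg (· - d) hω
        simp only at h
        rw [h]; ring), integral_add (integrable_const _) hint, integral_finsetSum _ fun k hk =>
          ((hweak.memLp k (Finset.mem_Icc.1 hk).1 (Finset.mem_Icc.1 hk).2).integrable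
            one_le_two).const_mul _]
      simp only [integral_const_mul]
      simp
    rw [hmean, Real.norm_eq_abs, Real.norm_of_nonneg (by positivity)]
    refine (hweak.abs_sum_mul_integral_le hA (sum_regressionWeight (by omega)) ha
      (hα n hm3)).trans ?_
    calc 2 * (1 + Real.log (m n)) / (m n : ℝ) * A * (1 + Real.log (m n)) ^ 2 =
        2 * A * (1 + Real.log (m n)) ^ 3 / m n := by ring
      _ ≤ 2 * A * (2 * Real.log (m n)) ^ 3 / m n := by gcongr; linarith
      _ = _ := by ring
  · refine ⟨fun n => Var[fun x => memoryEstimator (fun t => X t x) g n (m n); P] -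
      T / (4 * (m n : ℝ)), ?_, Eventually.of_forall fun n => by ring⟩
    -- The leading variance is `T ∑ a_k² = T / ∑ c_k²`; this limit replaces it by `T / (4m)` up to
    -- `o(1/m)`.
    have hQ : Tendsto (fun n : ℕ => |T| * |((∑ k ∈ Finset.Icc 1 (m n),
        centredRegressor 1 (m n) k ^ 2) / (m n : ℝ))⁻¹ - 4⁻¹|) atTop (𝓝 0) := by
      have h := (((tendsto_sum_centredRegressor_sq.comp hm).inv₀ (by norm_num)).sub_const
        4⁻¹).abs.const_mul |T|
      simpa using h
    have hE := ((tendsto_varianceError K A T hA).comp hm).add hQ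
    rw [add_zero] at hE
    rw [isLittleO_iff]
    intro ε hε
    filter_upwards [main, hE.eventually (ge_mem_nhds hε)] with n ⟨hm3, ha, hS, hweak, hae⟩ hEn
    have hm0 : (0 : ℝ) < m n := by positivity
    have hS0 := hm0.trans_le hS
    set S := ∑ k ∈ Finset.Icc 1 (m n), centredRegressor 1 (m n) k ^ 2
    have hvar : Var[fun x => memoryEstimator (fun t => X t x) g n (m n); P] =
        Var[fun ω => ∑ k ∈ Finset.Icc 1 (m n), regressionWeight 1 (m n) k * U n k ω; P] := by
      rw [variance_congr hae, variance_const_add (hLp n hweak).aestronglyMeasurable]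
    have hb : ∑ k ∈ Finset.Icc 1 (m n), regressionWeight 1 (m n) k ^ 2 ≤ 1 / (m n : ℝ) := by
      rw [sum_regressionWeight_sq, ← one_div]
      exact one_div_le_one_div_of_le hm0 hS
    have h1 := hweak.abs_variance_sub_le hA ha (hα n hm3) hb
    rw [sum_regressionWeight_sq] at h1
    rw [hvar, Real.norm_eq_abs, Real.norm_of_nonneg (by positivity), mul_one_div, le_div_iff₀ hm0]
    refine le_trans ?_ hEn
    simp only [Function.comp]
    set V := Var[fun ω => ∑ k ∈ Finset.Icc 1 (m n), regressionWeight 1 (m n) k * U n k ω; P]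
    have h2 : |T * S⁻¹ - T / (4 * (m n : ℝ))| * m n = |T| * |(S / (m n : ℝ))⁻¹ - 4⁻¹| := by
      rw [← abs_of_pos hm0, ← abs_mul, ← abs_mul, abs_of_pos hm0]
      congr 1
      field_simp
    rw [← h2]
    calc |V - T / (4 * (m n : ℝ))| * m n
        ≤ (|V - T * S⁻¹| + |T * S⁻¹ - T / (4 * (m n : ℝ))|) * m n := by
          gcongr
          exact abs_sub_le _ _ _
      _ ≤ _ := by
          rw [add_mul, mul_comm |V - T * S⁻¹|]
          gcongr
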